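/- Let $q\ge 1$ be an integer, $E_0>0$, and consider the planar system $$\dot x=\partial_yH(x,y,t),\qquad \dot y=-\partial_xH(x,y,t)+F(x,y,t),\qquad t>0,$$ where $H,F$ are infinitely differentiable on $\mathbb R^2\times(0,\infty)$ and, as $t\to\infty$, have the asymptotic series $$H(x,y,t)-H_0(x,y)=\sum_{k\ge1}t^{-k/q}H_k(x,y),\qquad F(x,y,t)=\sum_{k\ge1}t^{-k/q}F_k(x,y)$$ with infinitely differentiable $H_0,H_k,F_k$; that is, for every $N\ge 0$ the remainder after the first $N$ terms is $O(t^{-(N+1)/q})$ uniformly on compact subsets of $\mathbb R^2$, together with its partial derivatives in $x,y$ of order at most two (for $H$), respectively at most one (for $F$). Assume that $\partial_xH(0,0,t)=\partial_yH(0,0,t)=F(0,0,t)=0$ for all $t>0$, that $H_0(x,y)=\frac{x^2+y^2}2+O(r^3)$ as $r=\sqrt{x^2+y^2}\to0$, and that for every $E\in(0,E_0]$ the level line $\{(x,y)\in\mathbb R^2: H_0(x,y)=E\}$ is a closed curve, traversed by a non-constant periodic solution $(x_0(s,E),y_0(s,E))$ of $\dot x=\partial_yH_0$, $\dot y=-\partial_xH_0$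 with least period $T(E)$. Let $1\le n\le q$, and suppose that $F_i\equiv0$ for $1\le i<n$ and $$F_n=\partial_yH_0\,(\lambda_n-\mu_nH_0)+\hat F_n,\qquad \lambda_n,\mu_n\in\mathbb R,$$ where for every $E\in(0,E_0)$ the function $\hat F_n\,\partial_yH_0$ has zero average over the level curve, i.e. $\int_0^{T(E)}(\hat F_n\,\partial_yH_0)(x_0(s,E),y_0(s,E))\,ds=0$. Then the equilibrium $(0,0)$ is (Lyapunov) unstable if $\lambda_n>0$, and asymptotically stable if $\lambda_n<0$, for every initial time $t_0>0$. If in addition $\lambda_n>0$, $\mu_n>0$ and $\lambda_n/\mu_n<E_0$, then the level curve $H_0=\lambda_n/\mu_n$ is a stable limit cycle in the following sense: for every $\varepsilon>0$ there are $\delta_*>0$ and $t_*>0$ such that, for all $\tau_0\ge t_*$ and all $(x_0,y_0)$ with $|H_0(x_0,y_0)-\lambda_n/\mu_n|\le\delta_*$, the solution with $x(\tau_0)=x_0$, $y(\tau_0)=y_0$ exists on $[\tau_0,\infty)$, satisfies $|H_0(x(t),y(t))-\lambda_n/\mu_n|<\varepsilon$ for all $t\ge\tau_0$, and $H_0(x(t),y(t))\to\lambda_n/\mu_n$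 as $t\to\infty$. -/

import Mathlib

open scoped ContDiff Topology

namespace AsymptHam

noncomputable section

/-- The partial derivative of `G (x, y)` in its first variable. -/
def pdx (G : ℝ → ℝ → ℝ) : ℝ → ℝ → ℝ := fun x y => deriv (fun s => G s y) x

/-- The partial derivative of `G (x, y)` in its second variable. -/
def pdy (G : ℝ → ℝ → ℝ) : ℝ → ℝ → ℝ := fun x y => deriv (fun s => G x s) y

/-- The Euclidean length of `(x, y)`. -/
def rad (x y : ℝ) : ℝ := Real.sqrt (x ^ 2 + y ^ 2)

/-- `G (x, y)` is infinitely differentiable on the plane. -/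
def Smooth2 (G : ℝ → ℝ → ℝ) : Prop := ContDiff ℝ ∞ (fun p : ℝ × ℝ => G p.1 p.2)

/-- A time-dependent function, written `G t x y`, is infinitely differentiable
in all its variables jointly for `t > 0`. -/
def SmoothForPosTime (G : ℝ → ℝ → ℝ → ℝ) : Prop :=
  ContDiffOn ℝ ∞ (fun p : ℝ × ℝ × ℝ => G p.1 p.2.1 p.2.2) {p | 0 < p.1}

/-- The asymptotic series `G(x, y, t) = ∑_{k ≥ 1} t^(-k/q) c_k(x, y)` as `t → ∞`, uniformly on
compact sets of the plane and together with the partial derivatives in `x, y` of order at most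
`m`: after subtraction of the first `N` terms, the remainder and these derivatives of it are
`O(t^(-(N+1)/q))`, for every `N`. The coefficient `c 0` is not used. -/
def HasAsymptoticSeries (m q : ℕ) (G : ℝ → ℝ → ℝ → ℝ) (c : ℕ → ℝ → ℝ → ℝ) : Prop :=
  ∀ N i j : ℕ, i + j ≤ m → ∀ K : Set (ℝ × ℝ), IsCompact K →
    ∃ C t₁ : ℝ, 0 < t₁ ∧ ∀ t, t₁ ≤ t → ∀ x y : ℝ, (x, y) ∈ K →
      |(pdx^[i] (pdy^[j] (fun x y =>
          G t x y - ∑ k ∈ Finset.Icc 1 N, t ^ (-(k : ℝ) / (q : ℝ)) * c k x y))) x y|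
        ≤ C * t ^ (-((N : ℝ) + 1) / (q : ℝ))

/-- The whole level line `{H₀ = E}` is a closed curve, traversed by the solution
`s ↦ (x s, y s)` of the Hamiltonian system `x' = ∂_y H₀`, `y' = -∂_x H₀`, which is periodic with
least period `T > 0`. -/
structure IsClosedOrbit (H₀ : ℝ → ℝ → ℝ) (E T : ℝ) (x y : ℝ → ℝ) : Prop where
  period_pos : 0 < T
  deriv_x : ∀ s, HasDerivAt x (pdy H₀ (x s) (y s)) s
  deriv_y : ∀ s, HasDerivAt y (-pdx H₀ (x s) (y s)) s
  periodic_x : Function.Periodic x T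
  periodic_y : Function.Periodic y T
  simple : Set.InjOn (fun s => (x s, y s)) (Set.Ico 0 T)
  range_eq : Set.range (fun s => (x s, y s)) = {p : ℝ × ℝ | H₀ p.1 p.2 = E}

/-- `G` has zero average over the level line `{H₀ = E}`, with respect to the time along the
periodic solution of the Hamiltonian system that traverses it. -/
def ZeroAverage (H₀ G : ℝ → ℝ → ℝ) (E : ℝ) : Prop :=
  ∀ (T : ℝ) (x y : ℝ → ℝ), IsClosedOrbit H₀ E T x y → ∫ s in (0 : ℝ)..T, G (x s) (y s) = 0

/-- The setting: the limiting Hamiltonian `H₀` with its family of closed level lines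
`{H₀ = E}`, `0 < E ≤ E₀`, and smooth `H`, `F` (written `H t x y`, `F t x y`) with the asymptotic
series of `H - H₀` and of `F`, preserving the equilibrium at the origin. -/
structure Setting (q : ℕ) (E₀ : ℝ) (H₀ : ℝ → ℝ → ℝ) (H F : ℝ → ℝ → ℝ → ℝ)
    (Hc Fc : ℕ → ℝ → ℝ → ℝ) : Prop where
  E₀_pos : 0 < E₀
  smooth_H₀ : Smooth2 H₀
  smooth_H : SmoothForPosTime H
  smooth_F : SmoothForPosTime F
  smooth_Hc : ∀ k, 1 ≤ k → Smooth2 (Hc k)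
  smooth_Fc : ∀ k, 1 ≤ k → Smooth2 (Fc k)
  H₀_near_zero : (fun p : ℝ × ℝ => H₀ p.1 p.2 - (p.1 ^ 2 + p.2 ^ 2) / 2)
    =O[𝓝 (0, 0)] (fun p : ℝ × ℝ => rad p.1 p.2 ^ 3)
  closed_levels : ∀ E, 0 < E → E ≤ E₀ → ∃ (T : ℝ) (x y : ℝ → ℝ), IsClosedOrbit H₀ E T x y
  series_H : HasAsymptoticSeries 2 q (fun t x y => H t x y - H₀ x y) Hc
  series_F : HasAsymptoticSeries 1 q F Fc
  pdx_H_zero : ∀ t, 0 < t → pdx (H t) 0 0 = 0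
  pdy_H_zero : ∀ t, 0 < t → pdy (H t) 0 0 = 0
  F_zero : ∀ t, 0 < t → F t 0 0 = 0

/-- `(x, y)` solves `x' = ∂_y H`, `y' = -∂_x H + F` on the time set `I` (an interval). -/
def IsSolOn (H F : ℝ → ℝ → ℝ → ℝ) (I : Set ℝ) (x y : ℝ → ℝ) : Prop :=
  ∀ t ∈ I, HasDerivWithinAt x (pdy (H t) (x t) (y t)) I t ∧
    HasDerivWithinAt y (-pdx (H t) (x t) (y t) + F t (x t) (y t)) I t

/-- Every solution that starts at `(x₀, y₀)` at time `t₀` can be continued to `[t₀, ∞)` and has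
the property `P` there: a solution on `[t₀, ∞)` exists, and all of them satisfy `P`. -/
def SolutionSatisfies (H F : ℝ → ℝ → ℝ → ℝ) (t₀ x₀ y₀ : ℝ)
    (P : (ℝ → ℝ) → (ℝ → ℝ) → Prop) : Prop :=
  (∃ x y : ℝ → ℝ, IsSolOn H F (Set.Ici t₀) x y ∧ x t₀ = x₀ ∧ y t₀ = y₀) ∧
    ∀ x y : ℝ → ℝ, IsSolOn H F (Set.Ici t₀) x y → x t₀ = x₀ → y t₀ = y₀ → P x y

/-- Lyapunov stability of the equilibrium `(0, 0)`, for every initial time `t₀ > 0`. -/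
def Stable (H F : ℝ → ℝ → ℝ → ℝ) : Prop :=
  ∀ t₀, 0 < t₀ → ∀ ε, 0 < ε → ∃ δ, 0 < δ ∧ ∀ x₀ y₀ : ℝ, rad x₀ y₀ < δ →
    SolutionSatisfies H F t₀ x₀ y₀ (fun x y => ∀ t, t₀ ≤ t → rad (x t) (y t) < ε)

/-- Asymptotic stability: Lyapunov stability, and every solution that starts close enough to the
equilibrium tends to it. -/
def AsymptoticallyStable (H F : ℝ → ℝ → ℝ → ℝ) : Prop :=
  Stable H F ∧ ∀ t₀, 0 < t₀ → ∃ δ, 0 < δ ∧ ∀ x₀ y₀ : ℝ, rad x₀ y₀ < δ →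
    SolutionSatisfies H F t₀ x₀ y₀
      (fun x y => Filter.Tendsto (fun t => rad (x t) (y t)) Filter.atTop (𝓝 0))

/-- Instability of the equilibrium `(0, 0)`, at every initial time `t₀ > 0`: arbitrarily close to
the equilibrium there start solutions that leave a fixed neighbourhood of it. -/
def Unstable (H F : ℝ → ℝ → ℝ → ℝ) : Prop :=
  ∀ t₀, 0 < t₀ → ∃ ε, 0 < ε ∧ ∀ δ, 0 < δ → ∃ (t₁ : ℝ) (x y : ℝ → ℝ), t₀ ≤ t₁ ∧
    IsSolOn H F (Set.Icc t₀ t₁) x y ∧ rad (x t₀) (y t₀) < δ ∧ ε ≤ rad (x t₁) (y t₁)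

/-- The level line `{H₀ = V}` is a stable limit cycle: solutions that start close to it at a late
time exist for all later times, stay close to it, and approach it as `t → ∞`. -/
def StableLimitCycle (H₀ : ℝ → ℝ → ℝ) (H F : ℝ → ℝ → ℝ → ℝ) (V : ℝ) : Prop :=
  ∀ ε, 0 < ε → ∃ δ tₛ, 0 < δ ∧ 0 < tₛ ∧ ∀ x₀ y₀ τ : ℝ, |H₀ x₀ y₀ - V| ≤ δ → tₛ ≤ τ →
    SolutionSatisfies H F τ x₀ y₀ (fun x y =>
      (∀ t, τ ≤ t → |H₀ (x t) (y t) - V| < ε) ∧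
        Filter.Tendsto (fun t => H₀ (x t) (y t)) Filter.atTop (𝓝 V))

end

end AsymptHam

open scoped ContDiff Topology
namespace AsymptHam
noncomputable section

/-! The slow quantity is the truncated Hamiltonian K = H₀ + ∑_{k≤n} t^(-k/q) (H_k - H_k(0,0)),
called `slowVar`. Along a solution its bracket with H reduces to its bracket with H - K, whose
gradient is of order t^(-(n+1)/q), and its explicit time derivative is of order t^(-1-1/q),
negligible because n ≤ q. What remains is K' = t^(-n/q) (∂_y H₀ · F_n + o(1) r²). The error carries
the factor r² = x² + y² because the gradients of all H_k and all F_k vanish at the origin, by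
uniqueness of asymptotic coefficients. This is `Setting.exists_estimates`; both halves of the
theorem rest on it.

Near the origin, small level lines are almost circles, so the vanishing averages force ∂_y F̂_n(0,0)
= 0 and hence ∂_y F_n(0,0) = λ (`Setting.pdy_Fc_eq`). To leading order ∂_y H₀ · F_n is y(αx + λy),
with α = ∂_x F_n(0,0). The derivative of W = -(λ/2)xy - (α/2)x² along the rotation x' = y, y' = -x
turns this into (λ/2) r². Thus L = K + t^(-n/q) W is comparable to r², and L' equals t^(-n/q) (λ/2)
r² up to half of that size (`Setting.exists_lyapunov`). As t^(-n/q) ≥ 1/t, the product L t^(-λ/4) is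
monotone (`Setting.exists_power_law`). This forces escape for λ > 0 and decay for λ < 0; a Gronwall
estimate bridges the time from t₀ to the region where the asymptotics apply.

Near the level V = λ/μ the comparison is with one full period of the limiting system. Over a period
starting at time τ at energy E, K changes by τ^(-n/q) ((λ - μE) P + o(1)), where P = ∫ (∂_y H₀)² ds
> 0 and F̂_n drops out (`Setting.exists_local_drift`). Compactness makes this uniform on a band at
positive distance from V (`Setting.exists_drift`). So solutions cannot move far outwards, and since
the steps dominate a constant times 1/t, whose sum diverges logarithmically, they cannot stay
outside any neighbourhood of V (`Setting.exists_one_sided`).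

The hypotheses on level lines say nothing directly about sublevel sets. Positivity of H₀ off the
origin and boundedness of {H₀ ≤ E₀} come from connectedness and compactness of the individual levels
(`value_pos`, `exists_sublevel_bound`). -/

/-! ### Partial derivatives and Taylor bounds in the plane -/

theorem Smooth2.hasDerivAt_fst {G : ℝ → ℝ → ℝ} (hG : Smooth2 G) (x y : ℝ) :
    HasDerivAt (fun s => G s y) (pdx G x y) x := by
  have h1 : DifferentiableAt ℝ (fun s : ℝ => G s y) x := by
    have := (hG.differentiable (by simp)) (x, y)
    exact this.comp x (f := fun s : ℝ => (s, y)) (by fun_prop)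
  exact h1.hasDerivAt

theorem Smooth2.hasDerivAt_snd {G : ℝ → ℝ → ℝ} (hG : Smooth2 G) (x y : ℝ) :
    HasDerivAt (fun s => G x s) (pdy G x y) y := by
  have h1 : DifferentiableAt ℝ (fun s : ℝ => G x s) y := by
    have := (hG.differentiable (by simp)) (x, y)
    exact this.comp y (f := fun s : ℝ => (x, s)) (by fun_prop)
  exact h1.hasDerivAt

theorem Smooth2.pdx_eq {G : ℝ → ℝ → ℝ} (hG : Smooth2 G) (x y : ℝ) :
    pdx G x y = fderiv ℝ (fun p : ℝ × ℝ => G p.1 p.2) (x, y) (1, 0) := by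
  have h := ((hG.differentiable (by simp)) (x, y)).hasFDerivAt
  have h2 : HasDerivAt (fun s : ℝ => (s, y)) ((1 : ℝ), (0 : ℝ)) x :=
    (hasDerivAt_id x).prodMk (hasDerivAt_const x y)
  exact (hG.hasDerivAt_fst x y).unique
    (HasFDerivAt.comp_hasDerivAt (f := fun s : ℝ => (s, y)) x h h2)

theorem Smooth2.pdy_eq {G : ℝ → ℝ → ℝ} (hG : Smooth2 G) (x y : ℝ) :
    pdy G x y = fderiv ℝ (fun p : ℝ × ℝ => G p.1 p.2) (x, y) (0, 1) := by
  have h := ((hG.differentiable (by simp)) (x, y)).hasFDerivAt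
  have h2 : HasDerivAt (fun s : ℝ => (x, s)) ((0 : ℝ), (1 : ℝ)) y :=
    (hasDerivAt_const y x).prodMk (hasDerivAt_id y)
  exact (hG.hasDerivAt_snd x y).unique
    (HasFDerivAt.comp_hasDerivAt (f := fun s : ℝ => (x, s)) y h h2)

theorem Smooth2.fderiv_apply {G : ℝ → ℝ → ℝ} (hG : Smooth2 G) (p v : ℝ × ℝ) :
    fderiv ℝ (fun p : ℝ × ℝ => G p.1 p.2) p v = pdx G p.1 p.2 * v.1 + pdy G p.1 p.2 * v.2 := by
  rw [hG.pdx_eq, hG.pdy_eq]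
  have : v = v.1 • ((1 : ℝ), (0 : ℝ)) + v.2 • ((0 : ℝ), (1 : ℝ)) := by ext <;> simp
  conv_lhs => rw [this, map_add, map_smul, map_smul]
  simp [mul_comm]

theorem Smooth2.pdx {G : ℝ → ℝ → ℝ} (hG : Smooth2 G) : Smooth2 (pdx G) := by
  have h : ContDiff ℝ ∞ (fun p : ℝ × ℝ =>
      fderiv ℝ (fun p : ℝ × ℝ => G p.1 p.2) p (1, 0)) :=
    (hG.fderiv_right (m := ∞) (by simp)).clm_apply contDiff_const
  unfold Smooth2
  convert h using 2 with p
  exact hG.pdx_eq p.1 p.2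

theorem Smooth2.pdy {G : ℝ → ℝ → ℝ} (hG : Smooth2 G) : Smooth2 (pdy G) := by
  have h : ContDiff ℝ ∞ (fun p : ℝ × ℝ =>
      fderiv ℝ (fun p : ℝ × ℝ => G p.1 p.2) p (0, 1)) :=
    (hG.fderiv_right (m := ∞) (by simp)).clm_apply contDiff_const
  unfold Smooth2
  convert h using 2 with p
  exact hG.pdy_eq p.1 p.2

/-- Asymptotic series control only derivatives with `pdx` applied after `pdy`; symmetry of the
second derivative supplies the other order. -/
theorem Smooth2.pdy_pdx {G : ℝ → ℝ → ℝ} (hG : Smooth2 G) (x y : ℝ) :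
    AsymptHam.pdy (AsymptHam.pdx G) x y = AsymptHam.pdx (AsymptHam.pdy G) x y := by
  have hs : IsSymmSndFDerivAt ℝ (fun p : ℝ × ℝ => G p.1 p.2) (x, y) :=
    (hG.contDiffAt).isSymmSndFDerivAt (by simp; exact WithTop.coe_le_coe.2 le_top)
  have hd : DifferentiableAt ℝ (fderiv ℝ (fun p : ℝ × ℝ => G p.1 p.2)) (x, y) :=
    (hG.fderiv_right (m := ∞) (by simp)).differentiable (by simp) _
  rw [hG.pdx.pdy_eq, hG.pdy.pdx_eq]
  have e1 : (fun p : ℝ × ℝ => AsymptHam.pdx G p.1 p.2) =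
      fun p => fderiv ℝ (fun p : ℝ × ℝ => G p.1 p.2) p (1, 0) := by
    ext p; exact hG.pdx_eq _ _
  have e2 : (fun p : ℝ × ℝ => AsymptHam.pdy G p.1 p.2) =
      fun p => fderiv ℝ (fun p : ℝ × ℝ => G p.1 p.2) p (0, 1) := by
    ext p; exact hG.pdy_eq _ _
  rw [e1, e2, fderiv_clm_apply hd (by fun_prop), fderiv_clm_apply hd (by fun_prop)]
  simpa using hs (0, 1) (1, 0)

theorem Smooth2.continuous {G : ℝ → ℝ → ℝ} (hG : Smooth2 G) :
    Continuous (fun p : ℝ × ℝ => G p.1 p.2) := ContDiff.continuous hG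

/-- The chain rule along a curve in the plane. -/
theorem Smooth2.hasDerivWithinAt_comp {G : ℝ → ℝ → ℝ} (hG : Smooth2 G) {x y : ℝ → ℝ}
    {x' y' t : ℝ} {I : Set ℝ} (hx : HasDerivWithinAt x x' I t) (hy : HasDerivWithinAt y y' I t) :
    HasDerivWithinAt (fun s => G (x s) (y s))
      (AsymptHam.pdx G (x t) (y t) * x' + AsymptHam.pdy G (x t) (y t) * y') I t := by
  have h := ((hG.differentiable (by simp)) (x t, y t)).hasFDerivAt
  have := h.comp_hasDerivWithinAt t (hx.prodMk hy)
  rw [hG.fderiv_apply] at this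
  exact this

/-- The closed square with centre at the origin and half side `R`. -/
def square (R : ℝ) : Set (ℝ × ℝ) := Set.Icc (-R) R ×ˢ Set.Icc (-R) R

theorem mem_square {R x y : ℝ} : (x, y) ∈ square R ↔ |x| ≤ R ∧ |y| ≤ R := by
  rw [square, Set.mem_prod]
  simp only [Set.mem_Icc, abs_le]

theorem mem_square' {R : ℝ} {p : ℝ × ℝ} : p ∈ square R ↔ |p.1| ≤ R ∧ |p.2| ≤ R := by
  rw [square, Set.mem_prod]
  simp only [Set.mem_Icc, abs_le]

theorem isCompact_square (R : ℝ) : IsCompact (square R) := isCompact_Icc.prod isCompact_Icc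

theorem convex_square (R : ℝ) : Convex ℝ (square R) := (convex_Icc _ _).prod (convex_Icc _ _)

/-- Mean value inequality along the two legs (x, y) → (0, y) → (0, 0), which stay in the rectangle
where the partial derivatives are bounded. -/
theorem abs_sub_zero_le {G : ℝ → ℝ → ℝ} (hG : Smooth2 G) {x y M : ℝ}
    (h1 : ∀ x' y', |x'| ≤ |x| → |y'| ≤ |y| → |pdx G x' y'| ≤ M)
    (h2 : ∀ x' y', |x'| ≤ |x| → |y'| ≤ |y| → |pdy G x' y'| ≤ M) :
    |G x y - G 0 0| ≤ M * (|x| + |y|) := by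
  have a1 : |G x y - G 0 y| ≤ M * |x - 0| := by
    have := (convex_Icc (-|x|) |x|).norm_image_sub_le_of_norm_hasDerivWithin_le (C := M)
      (f := fun s => G s y) (f' := fun s => pdx G s y) (x := 0) (y := x)
      (fun s _ => (hG.hasDerivAt_fst s y).hasDerivWithinAt)
      (fun s hs => h1 s y (abs_le.2 hs) le_rfl) (Set.mem_Icc.2 (by simp)) (Set.mem_Icc.2 (abs_le.1 le_rfl))
    simpa using this
  have a2 : |G 0 y - G 0 0| ≤ M * |y - 0| := by
    have := (convex_Icc (-|y|) |y|).norm_image_sub_le_of_norm_hasDerivWithin_le (C := M)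
      (f := fun s => G 0 s) (f' := fun s => pdy G 0 s) (x := 0) (y := y)
      (fun s _ => (hG.hasDerivAt_snd 0 s).hasDerivWithinAt)
      (fun s hs => h2 0 s (by simp) (abs_le.2 hs)) (Set.mem_Icc.2 (by simp)) (Set.mem_Icc.2 (abs_le.1 le_rfl))
    simpa using this
  have := abs_sub_le (G x y) (G 0 y) (G 0 0)
  simp only [sub_zero] at a1 a2
  linarith

theorem Smooth2.exists_bound {G : ℝ → ℝ → ℝ} (hG : Smooth2 G) (R : ℝ) :
    ∃ C, 0 < C ∧ ∀ x y, |x| ≤ R → |y| ≤ R → |G x y| ≤ C := by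
  obtain ⟨C, hC⟩ := (isCompact_square R).exists_bound_of_continuousOn hG.continuous.continuousOn
  exact ⟨max C 1, by positivity, fun x y hx hy =>
    (hC (x, y) (mem_square.2 ⟨hx, hy⟩)).trans (le_max_left _ _)⟩

/-- A smooth function vanishing at the origin is bounded linearly. -/
theorem Smooth2.exists_linear_bound {G : ℝ → ℝ → ℝ} (hG : Smooth2 G) (h0 : G 0 0 = 0) (R : ℝ) :
    ∃ C, 0 < C ∧ ∀ x y, |x| ≤ R → |y| ≤ R → |G x y| ≤ C * (|x| + |y|) := by
  obtain ⟨C₁, hC₁, h₁⟩ := hG.pdx.exists_bound R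
  obtain ⟨C₂, hC₂, h₂⟩ := hG.pdy.exists_bound R
  refine ⟨C₁ + C₂, by positivity, fun x y hx hy => ?_⟩
  have := abs_sub_zero_le hG (x := x) (y := y) (M := C₁ + C₂)
    (fun x' y' h h' => (h₁ x' y' (h.trans hx) (h'.trans hy)).trans (by linarith))
    (fun x' y' h h' => (h₂ x' y' (h.trans hx) (h'.trans hy)).trans (by linarith))
  simpa [h0] using this

theorem add_abs_sq_le (x y : ℝ) : (|x| + |y|) * (|x| + |y|) ≤ 2 * (x ^ 2 + y ^ 2) := by
  nlinarith [sq_abs x, sq_abs y, sq_nonneg (|x| - |y|)]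

/-- A smooth function with vanishing gradient at the origin is quadratically close to its value
there. -/
theorem Smooth2.exists_quadratic_bound {G : ℝ → ℝ → ℝ} (hG : Smooth2 G)
    (hx : AsymptHam.pdx G 0 0 = 0) (hy : AsymptHam.pdy G 0 0 = 0) (R : ℝ) :
    ∃ C, 0 < C ∧ ∀ x y, |x| ≤ R → |y| ≤ R → |G x y - G 0 0| ≤ C * (x ^ 2 + y ^ 2) := by
  obtain ⟨C₁, hC₁, h₁⟩ := hG.pdx.exists_linear_bound hx R
  obtain ⟨C₂, hC₂, h₂⟩ := hG.pdy.exists_linear_bound hy R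
  refine ⟨2 * (C₁ + C₂), by positivity, fun x y hx hy => ?_⟩
  have hn : 0 ≤ |x| + |y| := by positivity
  have := abs_sub_zero_le hG (x := x) (y := y) (M := (C₁ + C₂) * (|x| + |y|))
    (fun x' y' h h' => (h₁ x' y' (h.trans hx) (h'.trans hy)).trans
      (mul_le_mul (by linarith) (by linarith) (by positivity) (by positivity)))
    (fun x' y' h h' => (h₂ x' y' (h.trans hx) (h'.trans hy)).trans
      (mul_le_mul (by linarith) (by linarith) (by positivity) (by positivity)))
  calc _ ≤ _ := this
    _ = (C₁ + C₂) * ((|x| + |y|) * (|x| + |y|)) := by ring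
    _ ≤ (C₁ + C₂) * (2 * (x ^ 2 + y ^ 2)) := mul_le_mul_of_nonneg_left (add_abs_sq_le x y) (by positivity)
    _ = _ := by ring

/-- First order expansion at the origin of a smooth function vanishing there. -/
theorem Smooth2.exists_expansion {G : ℝ → ℝ → ℝ} (hG : Smooth2 G) (h0 : G 0 0 = 0) :
    ∀ ε, 0 < ε → ∃ ρ, 0 < ρ ∧ ∀ x y, |x| ≤ ρ → |y| ≤ ρ →
      |G x y - (AsymptHam.pdx G 0 0 * x + AsymptHam.pdy G 0 0 * y)| ≤ ε * (|x| + |y|) := by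
  intro ε hε
  have h := ((hG.differentiable (by simp)) (0, 0)).hasFDerivAt.isLittleO
  obtain ⟨r, hr, hb⟩ := Metric.eventually_nhds_iff.1 (h.def hε)
  refine ⟨r / 2, by positivity, fun x y hx hy => ?_⟩
  have hd : dist (x, y) ((0 : ℝ), (0 : ℝ)) < r := by
    rw [Prod.dist_eq]; simp only [Real.dist_eq, sub_zero]
    exact max_lt (by linarith) (by linarith)
  have := hb hd
  rw [hG.fderiv_apply] at this
  simp only [h0, sub_zero, Real.norm_eq_abs, Prod.fst_sub, Prod.snd_sub] at this
  refine this.trans ?_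
  gcongr
  rw [Prod.norm_def]
  simp only [Prod.fst_sub, Prod.snd_sub, sub_zero, Real.norm_eq_abs]
  exact max_le (by linarith [abs_nonneg y]) (by linarith [abs_nonneg x])

/-! ### Geometry of the level lines and sublevel sets of H₀ -/

section

theorem one_lt_rank_plane : 1 < Module.rank ℝ (ℝ × ℝ) := by
  rw [rank_prod', Module.rank_self, one_add_one_eq_two]
  norm_num

/-- The exterior is the image of [1, ∞) × sphere under scaling, and spheres are connected in
dimension two. The norm is the sup norm, so spheres are boundaries of squares. -/
theorem isPreconnected_exterior {r : ℝ} (hr : 0 < r) :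
    IsPreconnected {p : ℝ × ℝ | r ≤ ‖p‖} := by
  have h1 : IsPreconnected ((Set.Ici (1 : ℝ)) ×ˢ (Metric.sphere (0 : ℝ × ℝ) r)) :=
    isPreconnected_Ici.prod (isPreconnected_sphere one_lt_rank_plane 0 r)
  have h2 := h1.image (fun z : ℝ × (ℝ × ℝ) => z.1 • z.2) (by fun_prop)
  convert h2 using 1
  ext p
  constructor
  · intro hp
    have hp' : r ≤ ‖p‖ := hp
    have hp0 : 0 < ‖p‖ := hr.trans_le hp'
    refine ⟨(‖p‖ / r, (r / ‖p‖) • p), ⟨?_, ?_⟩, ?_⟩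
    · exact (one_le_div hr).2 hp'
    · rw [mem_sphere_zero_iff_norm, norm_smul, Real.norm_of_nonneg (by positivity)]
      field_simp
    · simp only [smul_smul]
      rw [div_mul_div_cancel₀ hr.ne', div_self hp0.ne', one_smul]
  · rintro ⟨⟨s, z⟩, ⟨hs, hz⟩, rfl⟩
    rw [mem_sphere_zero_iff_norm] at hz
    have hs' : (1 : ℝ) ≤ s := hs
    change r ≤ ‖s • z‖
    rw [norm_smul, hz, Real.norm_of_nonneg (by linarith)]
    nlinarith

theorem IsClosedOrbit.continuous {H₀ : ℝ → ℝ → ℝ} {E T : ℝ} {x y : ℝ → ℝ}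
    (h : IsClosedOrbit H₀ E T x y) : Continuous (fun s => (x s, y s)) :=
  (continuous_iff_continuousAt.2 fun s => (h.deriv_x s).continuousAt).prodMk
    (continuous_iff_continuousAt.2 fun s => (h.deriv_y s).continuousAt)

theorem IsClosedOrbit.isCompact_level {H₀ : ℝ → ℝ → ℝ} {E T : ℝ} {x y : ℝ → ℝ}
    (h : IsClosedOrbit H₀ E T x y) : IsCompact {p : ℝ × ℝ | H₀ p.1 p.2 = E} := by
  rw [← h.range_eq]
  have hp : Function.Periodic (fun s => (x s, y s)) T := fun s => by
    simp only [h.periodic_x s, h.periodic_y s]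
  rw [← hp.image_Icc h.period_pos 0]
  exact isCompact_Icc.image h.continuous

theorem IsClosedOrbit.isPreconnected_level {H₀ : ℝ → ℝ → ℝ} {E T : ℝ} {x y : ℝ → ℝ}
    (h : IsClosedOrbit H₀ E T x y) : IsPreconnected {p : ℝ × ℝ | H₀ p.1 p.2 = E} := by
  rw [← h.range_eq]
  exact isPreconnected_range h.continuous

variable {E₀ : ℝ} {H₀ : ℝ → ℝ → ℝ}

theorem exists_near_quadratic (h : (fun p : ℝ × ℝ => H₀ p.1 p.2 - (p.1 ^ 2 + p.2 ^ 2) / 2)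
    =O[𝓝 (0, 0)] (fun p : ℝ × ℝ => rad p.1 p.2 ^ 3)) {ε : ℝ} (hε : 0 < ε) :
    ∃ ρ, 0 < ρ ∧ ∀ x y, |x| ≤ ρ → |y| ≤ ρ →
      |H₀ x y - (x ^ 2 + y ^ 2) / 2| ≤ ε * (x ^ 2 + y ^ 2) := by
  obtain ⟨C, hC, hb⟩ := h.exists_pos
  obtain ⟨r, hr, hb⟩ := Metric.eventually_nhds_iff.1 hb.bound
  -- The first entry gives the strict ball condition; the second gives C · rad ≤ ε, because rad ≤
  -- |x| + |y|.
  refine ⟨min (r / 2) (ε / (2 * C)), by positivity, fun x y hx hy => ?_⟩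
  have hd : dist (x, y) ((0 : ℝ), (0 : ℝ)) < r := by
    rw [Prod.dist_eq]; simp only [Real.dist_eq, sub_zero]
    exact max_lt (by linarith [min_le_left (r / 2) (ε / (2 * C))])
      (by linarith [min_le_left (r / 2) (ε / (2 * C))])
  have h1 := hb hd
  simp only [Real.norm_eq_abs] at h1
  have hrad : rad x y ≤ |x| + |y| := by
    rw [rad, Real.sqrt_le_left (by positivity)]
    nlinarith [sq_abs x, sq_abs y, abs_nonneg x, abs_nonneg y,
      mul_nonneg (abs_nonneg x) (abs_nonneg y)]
  have hrad0 : 0 ≤ rad x y := Real.sqrt_nonneg _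
  have hrad2 : rad x y ^ 2 = x ^ 2 + y ^ 2 := Real.sq_sqrt (by positivity)
  rw [abs_of_nonneg (a := rad x y ^ 3) (pow_nonneg hrad0 3)] at h1
  refine h1.trans ?_
  have h3 : C * rad x y ≤ ε := by
    have : rad x y ≤ ε / C := by
      have e : ε / C = ε / (2 * C) + ε / (2 * C) := by field_simp; norm_num
      rw [e]
      linarith [min_le_right (r / 2) (ε / (2 * C))]
    rwa [le_div_iff₀ hC, mul_comm] at this
  calc C * rad x y ^ 3 = C * rad x y * rad x y ^ 2 := by ring
    _ ≤ ε * (x ^ 2 + y ^ 2) := by rw [hrad2]; gcongr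

/-- A level line is connected, so it cannot jump across a sphere. This is how the closed-curve
hypothesis constrains the shape of H₀. -/
theorem level_meets_sphere (hl : ∀ E, 0 < E → E ≤ E₀ → ∃ (T : ℝ) (x y : ℝ → ℝ),
    IsClosedOrbit H₀ E T x y) {E r : ℝ} (hE : 0 < E) (hE' : E ≤ E₀) {p p' : ℝ × ℝ}
    (hp : H₀ p.1 p.2 = E) (hp' : H₀ p'.1 p'.2 = E) (h1 : ‖p‖ ≤ r) (h2 : r ≤ ‖p'‖) :
    ∃ z : ℝ × ℝ, H₀ z.1 z.2 = E ∧ ‖z‖ = r := by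
  obtain ⟨T, x, y, h⟩ := hl E hE hE'
  obtain ⟨z, hz, hz'⟩ := h.isPreconnected_level.intermediate_value hp hp'
    continuous_norm.continuousOn ⟨h1, h2⟩
  exact ⟨z, hz, hz'⟩

theorem exists_value_inside (hH : Smooth2 H₀) (h0 : H₀ 0 0 = 0) {E : ℝ} (hE : 0 ≤ E)
    {p : ℝ × ℝ} (hp : E ≤ H₀ p.1 p.2) :
    ∃ s : ℝ, 0 ≤ s ∧ s ≤ 1 ∧ H₀ (s * p.1) (s * p.2) = E := by
  have hc : ContinuousOn (fun s : ℝ => H₀ (s * p.1) (s * p.2)) (Set.Icc 0 1) :=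
    (hH.continuous.comp (f := fun s : ℝ => (s * p.1, s * p.2)) (by fun_prop)).continuousOn
  obtain ⟨s, hs, hs'⟩ := intermediate_value_Icc zero_le_one hc (show E ∈ _ by simp [h0, hE, hp])
  exact ⟨s, hs.1, hs.2, hs'⟩

theorem norm_smul_le_of_mem {s : ℝ} (h0 : 0 ≤ s) (h1 : s ≤ 1) (p : ℝ × ℝ) :
    ‖(s * p.1, s * p.2)‖ ≤ ‖p‖ := by
  have : (s * p.1, s * p.2) = s • p := rfl
  rw [this, norm_smul, Real.norm_of_nonneg h0]
  exact mul_le_of_le_one_left (norm_nonneg _) h1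

theorem norm_eq_max_abs (x y : ℝ) : ‖(x, y)‖ = max |x| |y| := by
  rw [Prod.norm_def]; rfl

variable (hH : Smooth2 H₀) (hz : (fun p : ℝ × ℝ => H₀ p.1 p.2 - (p.1 ^ 2 + p.2 ^ 2) / 2)
    =O[𝓝 (0, 0)] (fun p : ℝ × ℝ => rad p.1 p.2 ^ 3))
  (hl : ∀ E, 0 < E → E ≤ E₀ → ∃ (T : ℝ) (x y : ℝ → ℝ), IsClosedOrbit H₀ E T x y)

include hz in
theorem value_zero : H₀ 0 0 = 0 := by
  obtain ⟨ρ, hρ, h⟩ := exists_near_quadratic hz one_pos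
  have := h 0 0 (by simpa using hρ.le) (by simpa using hρ.le)
  simpa using this

include hH hz hl in
-- Inside a small square H₀ dominates r²/4. If H₀ were nonpositive somewhere outside, a small value
-- E would be taken both outside the square and on a segment from the origin. The connected level E
-- would then cross the boundary of the square, where H₀ exceeds E.
theorem value_pos (hE₀ : 0 < E₀) {x y : ℝ} (hxy : (x, y) ≠ 0) : 0 < H₀ x y := by
  have h0 := value_zero hz
  obtain ⟨ρ, hρ, h⟩ := exists_near_quadratic hz (ε := 1 / 4) (by norm_num)
  have hlow : ∀ x y, |x| ≤ ρ → |y| ≤ ρ → (x ^ 2 + y ^ 2) / 4 ≤ H₀ x y := fun x y hx hy => by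
    have := (abs_le.1 (h x y hx hy)).1
    linarith
  have hsph : ∀ p : ℝ × ℝ, ‖p‖ = ρ → ρ ^ 2 / 4 ≤ H₀ p.1 p.2 := by
    rintro ⟨a, b⟩ hp
    rw [norm_eq_max_abs] at hp
    have h1 := hlow a b ((le_max_left _ _).trans hp.le) ((le_max_right _ _).trans hp.le)
    have h2 : ρ ^ 2 ≤ a ^ 2 + b ^ 2 := by
      rcases max_choice |a| |b| with h' | h' <;> rw [h'] at hp <;> rw [← hp, sq_abs] <;>
        nlinarith [sq_nonneg a, sq_nonneg b]
    simp only
    linarith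
  by_cases hin : |x| ≤ ρ ∧ |y| ≤ ρ
  · refine lt_of_lt_of_le ?_ (hlow x y hin.1 hin.2)
    have : x ≠ 0 ∨ y ≠ 0 := by
      by_contra hcon
      push Not at hcon
      exact hxy (by rw [hcon.1, hcon.2]; rfl)
    rcases this with h' | h' <;> positivity
  · have hout : ρ ≤ ‖((x, y) : ℝ × ℝ)‖ := by
      rw [norm_eq_max_abs]
      by_contra hcon
      push Not at hcon
      exact hin ⟨(le_max_left _ _).trans hcon.le, (le_max_right _ _).trans hcon.le⟩
    by_contra hneg
    push Not at hneg
    obtain ⟨E, hE, hE'⟩ := exists_between (show 0 < min (ρ ^ 2 / 4) E₀ by positivity)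
    have hEρ : E < ρ ^ 2 / 4 := hE'.trans_le (min_le_left _ _)
    have hEE : E < E₀ := hE'.trans_le (min_le_right _ _)
    have hρn : ‖((ρ, 0) : ℝ × ℝ)‖ = ρ := by
      rw [norm_eq_max_abs]; simp [abs_of_pos hρ, hρ.le]
    obtain ⟨z, hz1, hz2⟩ := (isPreconnected_exterior hρ).intermediate_value
      (show (x, y) ∈ {p : ℝ × ℝ | ρ ≤ ‖p‖} from hout)
      (show (ρ, 0) ∈ {p : ℝ × ℝ | ρ ≤ ‖p‖} from hρn.ge)
      hH.continuous.continuousOn (show E ∈ _ from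
        ⟨hneg.trans hE.le, hEρ.le.trans (hsph _ hρn)⟩)
    obtain ⟨s, hs0, hs1, hs⟩ := exists_value_inside hH h0 hE.le (p := (ρ, 0))
      (hEρ.le.trans (hsph _ hρn))
    obtain ⟨w, hw, hwn⟩ := level_meets_sphere hl hE hEE.le (p := (s * ρ, s * 0)) hs hz2
      ((norm_smul_le_of_mem hs0 hs1 (ρ, 0)).trans hρn.le) hz1
    have := hsph w hwn
    linarith

include hH hz hl in
-- Outside a square containing the level E₀, H₀ - E₀ has constant sign. If it were negative there,
-- every level line through a far point would also come close to the origin and so cross all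
-- intermediate spheres. The sets of values on growing spheres would then be nested, and a common
-- value would have an unbounded level line, contradicting compactness.
theorem exists_sublevel_bound (hE₀ : 0 < E₀) :
    ∃ R, 0 < R ∧ ∀ x y, H₀ x y ≤ E₀ → |x| < R ∧ |y| < R := by
  have h0 := value_zero hz
  obtain ⟨T, X, Y, hor⟩ := hl E₀ hE₀ le_rfl
  obtain ⟨R, hR⟩ := hor.isCompact_level.isBounded.exists_norm_le
  have hg : H₀ (X 0) (Y 0) = E₀ := by
    have : (X 0, Y 0) ∈ {p : ℝ × ℝ | H₀ p.1 p.2 = E₀} := hor.range_eq ▸ ⟨0, rfl⟩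
    exact this
  have hR0 : 0 ≤ R := (norm_nonneg _).trans (hR (X 0, Y 0) hg)
  refine ⟨R + 1, by positivity, ?_⟩
  suffices hs : ∀ p : ℝ × ℝ, R + 1 ≤ ‖p‖ → E₀ < H₀ p.1 p.2 by
    intro x y hxy
    have : ‖((x, y) : ℝ × ℝ)‖ < R + 1 := by
      by_contra hcon
      exact absurd (hs (x, y) (not_lt.1 hcon)) (not_lt.2 hxy)
    rw [norm_eq_max_abs] at this
    exact max_lt_iff.1 this
  by_contra hcon
  push Not at hcon
  obtain ⟨p, hp, hpE⟩ := hcon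
  have hlt : ∀ z : ℝ × ℝ, R + 1 ≤ ‖z‖ → H₀ z.1 z.2 < E₀ := by
    intro z hz
    by_contra hcon
    push Not at hcon
    obtain ⟨w, hw, hw'⟩ := (isPreconnected_exterior (by positivity)).intermediate_value
      (show p ∈ {p : ℝ × ℝ | R + 1 ≤ ‖p‖} from hp) (show z ∈ {p : ℝ × ℝ | R + 1 ≤ ‖p‖} from hz)
      hH.continuous.continuousOn (show E₀ ∈ _ from ⟨hpE, hcon⟩)
    have := hR w hw'
    have hw2 : R + 1 ≤ ‖w‖ := hw
    linarith
  have hpos : ∀ z : ℝ × ℝ, R + 1 ≤ ‖z‖ → 0 < H₀ z.1 z.2 := by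
    intro z hz'
    refine value_pos hH hz hl hE₀ ?_
    intro h
    have h' : z = 0 := h
    rw [h', norm_zero] at hz'
    linarith
  -- Values taken on the sphere of radius R + 1 + k; nested, since a level line through the larger
  -- sphere also meets the smaller one.
  let S : ℕ → Set ℝ := fun k => (fun p : ℝ × ℝ => H₀ p.1 p.2) '' Metric.sphere 0 (R + 1 + k)
  have hSc : ∀ k, IsCompact (S k) := fun k => (isCompact_sphere _ _).image hH.continuous
  have hSn : ∀ k, (S k).Nonempty := fun k =>
    ((NormedSpace.sphere_nonempty (E := ℝ × ℝ) (x := 0)).2 (by positivity)).image _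
  have hS : ∀ k, S (k + 1) ⊆ S k := by
    rintro k _ ⟨z, hz', rfl⟩
    rw [mem_sphere_zero_iff_norm] at hz'
    push_cast at hz'
    have hk : (0 : ℝ) ≤ k := Nat.cast_nonneg k
    have hz1 : R + 1 ≤ ‖z‖ := by linarith
    obtain ⟨s, hs0, hs1, hs⟩ := exists_value_inside hH h0 (hpos z hz1).le (p := (X 0, Y 0))
      ((hlt z hz1).le.trans hg.ge)
    obtain ⟨w, hw, hwn⟩ := level_meets_sphere hl (r := R + 1 + k) (hpos z hz1) (hlt z hz1).le
      (p := (s * X 0, s * Y 0)) hs (p' := z) rfl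
      ((norm_smul_le_of_mem hs0 hs1 (X 0, Y 0)).trans ((hR _ hg).trans (by linarith)))
      (by linarith)
    exact ⟨w, by simpa using hwn, hw⟩
  obtain ⟨e, he⟩ := IsCompact.nonempty_iInter_of_sequence_nonempty_isCompact_isClosed S hS hSn
    (hSc 0) (fun k => (hSc k).isClosed)
  rw [Set.mem_iInter] at he
  obtain ⟨z, hz', hze⟩ := he 0
  rw [mem_sphere_zero_iff_norm] at hz'
  have hz1 : R + 1 ≤ ‖z‖ := by simp at hz'; linarith
  have hze' : H₀ z.1 z.2 = e := hze
  obtain ⟨T', X', Y', hor'⟩ := hl e (hze' ▸ hpos z hz1) (hze' ▸ (hlt z hz1).le)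
  obtain ⟨M, hM⟩ := hor'.isCompact_level.isBounded.exists_norm_le
  obtain ⟨k, hk⟩ := exists_nat_gt M
  obtain ⟨w, hw, hwe⟩ := he k
  rw [mem_sphere_zero_iff_norm] at hw
  have := hM w hwe
  linarith

include hH hz hl in
/-- The first coordinate takes both signs on each level line. -/
theorem exists_level_points (hE₀ : 0 < E₀) {E : ℝ} (hE : 0 < E) (hE' : E ≤ E₀) :
    ∃ a b y y', a < b ∧ H₀ a y = E ∧ H₀ b y' = E := by
  have h0 := value_zero hz
  obtain ⟨R, hR, hb⟩ := exists_sublevel_bound hH hz hl hE₀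
  have h1 : E₀ < H₀ R 0 := by
    by_contra h
    have := (hb R 0 (not_lt.1 h)).1
    rw [abs_of_pos hR] at this
    exact lt_irrefl _ this
  have h2 : E₀ < H₀ (-R) 0 := by
    by_contra h
    have := (hb (-R) 0 (not_lt.1 h)).1
    rw [abs_neg, abs_of_pos hR] at this
    exact lt_irrefl _ this
  obtain ⟨s, hs0, -, hs⟩ := exists_value_inside hH h0 hE.le (p := (R, 0)) (hE'.trans h1.le)
  obtain ⟨s', hs0', -, hs'⟩ := exists_value_inside hH h0 hE.le (p := (-R, 0)) (hE'.trans h2.le)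
  simp only [mul_zero] at hs hs'
  have hs1 : 0 < s := by
    rcases hs0.eq_or_lt with h | h
    · rw [← h, zero_mul, h0] at hs; linarith
    · exact h
  exact ⟨s' * -R, s * R, 0, 0, by nlinarith [mul_nonneg hs0' hR.le, mul_pos hs1 hR], hs', hs⟩

end

/-! ### Asymptotic series: remainders and uniqueness of coefficients -/

section

theorem Smooth2.sub {A B : ℝ → ℝ → ℝ} (hA : Smooth2 A) (hB : Smooth2 B) :
    Smooth2 (fun x y => A x y - B x y) := ContDiff.sub hA hB

theorem Smooth2.const_mul {A : ℝ → ℝ → ℝ} (hA : Smooth2 A) (c : ℝ) :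
    Smooth2 (fun x y => c * A x y) := contDiff_const.mul hA

theorem Smooth2.mul {A B : ℝ → ℝ → ℝ} (hA : Smooth2 A) (hB : Smooth2 B) :
    Smooth2 (fun x y => A x y * B x y) := ContDiff.mul hA hB

theorem Smooth2.sum {ι : Type*} {s : Finset ι} {A : ι → ℝ → ℝ → ℝ}
    (hA : ∀ k ∈ s, Smooth2 (A k)) : Smooth2 (fun x y => ∑ k ∈ s, A k x y) := ContDiff.sum hA

/-- The remainder of a series expansion after finitely many terms. -/
def remainder (G : ℝ → ℝ → ℝ) (s : Finset ℕ) (a : ℕ → ℝ) (c : ℕ → ℝ → ℝ → ℝ) : ℝ → ℝ → ℝ :=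
  fun x y => G x y - ∑ k ∈ s, a k * c k x y

section remainder

variable {G : ℝ → ℝ → ℝ} {s : Finset ℕ} {a : ℕ → ℝ} {c : ℕ → ℝ → ℝ → ℝ}

theorem smooth2_remainder (hG : Smooth2 G) (hc : ∀ k ∈ s, Smooth2 (c k)) :
    Smooth2 (remainder G s a c) :=
  hG.sub (Smooth2.sum fun k hk => (hc k hk).const_mul (a k))

theorem pdx_remainder (hG : Smooth2 G) (hc : ∀ k ∈ s, Smooth2 (c k)) :
    pdx (remainder G s a c) = remainder (pdx G) s a (fun k => pdx (c k)) := by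
  ext x y
  refine HasDerivAt.deriv ?_
  exact (hG.hasDerivAt_fst x y).sub
    (HasDerivAt.fun_sum fun k hk => ((hc k hk).hasDerivAt_fst x y).const_mul (a k))

theorem pdy_remainder (hG : Smooth2 G) (hc : ∀ k ∈ s, Smooth2 (c k)) :
    pdy (remainder G s a c) = remainder (pdy G) s a (fun k => pdy (c k)) := by
  ext x y
  refine HasDerivAt.deriv ?_
  exact (hG.hasDerivAt_snd x y).sub
    (HasDerivAt.fun_sum fun k hk => ((hc k hk).hasDerivAt_snd x y).const_mul (a k))

end remainder

theorem pdx_sub {A B : ℝ → ℝ → ℝ} (hA : Smooth2 A) (hB : Smooth2 B) (x y : ℝ) :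
    pdx (fun x y => A x y - B x y) x y = pdx A x y - pdx B x y :=
  ((hA.hasDerivAt_fst x y).sub (hB.hasDerivAt_fst x y)).deriv

theorem pdy_sub {A B : ℝ → ℝ → ℝ} (hA : Smooth2 A) (hB : Smooth2 B) (x y : ℝ) :
    pdy (fun x y => A x y - B x y) x y = pdy A x y - pdy B x y :=
  ((hA.hasDerivAt_snd x y).sub (hB.hasDerivAt_snd x y)).deriv

/-- With e = t^(-1/q) all weights become integer powers of one number in (0, 1] for t ≥ 1, and
comparing orders becomes comparing exponents. -/
theorem rpow_neg_div_eq_pow {t : ℝ} (ht : 0 < t) (q k : ℕ) :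
    t ^ (-(k : ℝ) / (q : ℝ)) = (t ^ (-1 / (q : ℝ))) ^ k := by
  rw [← Real.rpow_natCast, ← Real.rpow_mul ht.le]
  congr 1
  ring

theorem rpow_neg_succ_div_eq_pow {t : ℝ} (ht : 0 < t) (q k : ℕ) :
    t ^ (-((k : ℝ) + 1) / (q : ℝ)) = (t ^ (-1 / (q : ℝ))) ^ (k + 1) := by
  rw [← rpow_neg_div_eq_pow ht, Nat.cast_succ]

theorem tendsto_rpow_neg_one_div {q : ℕ} (hq : 1 ≤ q) :
    Filter.Tendsto (fun t : ℝ => t ^ (-1 / (q : ℝ))) Filter.atTop (𝓝 0) := by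
  have : 0 < 1 / (q : ℝ) := by positivity
  simpa [neg_div] using tendsto_rpow_neg_atTop this

/-- Coefficients of an asymptotic expansion of zero vanish. -/
theorem coeff_eq_zero {q : ℕ} (hq : 1 ≤ q) {a : ℕ → ℝ}
    (h : ∀ N : ℕ, ∃ C t₁ : ℝ, 0 < t₁ ∧ ∀ t, t₁ ≤ t →
      |∑ k ∈ Finset.Icc 1 N, t ^ (-(k : ℝ) / (q : ℝ)) * a k|
        ≤ C * t ^ (-((N : ℝ) + 1) / (q : ℝ))) (k : ℕ) (hk : 1 ≤ k) : a k = 0 := by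
  induction k using Nat.strong_induction_on with
  | _ k ih =>
    -- By induction only the k-th term survives; dividing the estimate by t^(-k/q) leaves a bound
    -- that tends to 0.
    obtain ⟨C, t₁, ht₁, hC⟩ := h k
    have hb : ∀ t, t₁ ≤ t → |a k| ≤ C * t ^ (-1 / (q : ℝ)) := by
      intro t ht
      have ht0 : 0 < t := ht₁.trans_le ht
      have hs : ∑ j ∈ Finset.Icc 1 k, t ^ (-(j : ℝ) / (q : ℝ)) * a j
          = t ^ (-(k : ℝ) / (q : ℝ)) * a k := by
        refine Finset.sum_eq_single_of_mem k (by simp [hk]) fun j hj hjk => ?_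
        rw [Finset.mem_Icc] at hj
        rw [ih j (lt_of_le_of_ne hj.2 hjk) hj.1, mul_zero]
      have := hC t ht
      rw [hs, rpow_neg_div_eq_pow ht0, rpow_neg_succ_div_eq_pow ht0, abs_mul] at this
      have hp : 0 < (t ^ (-1 / (q : ℝ))) ^ k := pow_pos (Real.rpow_pos_of_pos ht0 _) k
      rw [abs_of_pos hp, pow_succ] at this
      refine le_of_mul_le_mul_left ?_ hp
      linarith
    have hlim : Filter.Tendsto (fun t : ℝ => C * t ^ (-1 / (q : ℝ))) Filter.atTop (𝓝 0) := by
      simpa using (tendsto_rpow_neg_one_div hq).const_mul C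
    have := ge_of_tendsto hlim (Filter.eventually_atTop.2 ⟨t₁, hb⟩)
    exact abs_nonpos_iff.1 this

theorem SmoothForPosTime.smooth2 {G : ℝ → ℝ → ℝ → ℝ} (h : SmoothForPosTime G) {t : ℝ}
    (ht : 0 < t) : Smooth2 (G t) := by
  have : ContDiffOn ℝ ∞ (fun p : ℝ × ℝ => G t p.1 p.2) Set.univ :=
    ContDiffOn.comp h (f := fun p : ℝ × ℝ => (t, p)) (contDiff_const.prodMk contDiff_id).contDiffOn
      (fun p _ => ht)
  exact contDiffOn_univ.1 this

/-- A finite sum of powers with coefficients controlled by `φ` is controlled by its lowest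
power. -/
theorem exists_sum_pow_bound {G : ℕ → ℝ → ℝ → ℝ} {φ : ℝ → ℝ → ℝ} {R : ℝ}
    (n : ℕ) (hG : ∀ k ∈ Finset.Icc 1 n,
      ∃ C, 0 < C ∧ ∀ x y, |x| ≤ R → |y| ≤ R → |G k x y| ≤ C * φ x y) :
    ∃ C, 0 ≤ C ∧ ∀ e, 0 ≤ e → e ≤ 1 → ∀ x y, |x| ≤ R → |y| ≤ R →
      |∑ k ∈ Finset.Icc 1 n, e ^ k * G k x y| ≤ C * e * φ x y := by
  choose! C hC0 hC using hG
  refine ⟨∑ k ∈ Finset.Icc 1 n, C k, Finset.sum_nonneg fun k hk => (hC0 k hk).le, ?_⟩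
  intro e he he1 x y hx hy
  rw [Finset.sum_mul, Finset.sum_mul]
  refine (Finset.abs_sum_le_sum_abs _ _).trans (Finset.sum_le_sum fun k hk => ?_)
  rw [abs_mul, abs_of_nonneg (pow_nonneg he k)]
  have h1 : e ^ k ≤ e := pow_le_of_le_one he he1 (by rw [Finset.mem_Icc] at hk; omega)
  calc e ^ k * |G k x y| ≤ e * (C k * φ x y) :=
        mul_le_mul h1 (hC k hk x y hx hy) (abs_nonneg _) he
    _ = C k * e * φ x y := by ring

end

/-! ### Vanishing at the origin and remainder bounds linear in the distance -/

section

section slow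

variable {q n : ℕ} {E₀ : ℝ} {H₀ : ℝ → ℝ → ℝ} {H F : ℝ → ℝ → ℝ → ℝ} {Hc Fc : ℕ → ℝ → ℝ → ℝ}

/-- Along each axis H₀ is O(s²), so its derivative at 0 vanishes. -/
theorem Setting.pdx_H₀_zero (hS : Setting q E₀ H₀ H F Hc Fc) :
    pdx H₀ 0 0 = 0 ∧ pdy H₀ 0 0 = 0 := by
  obtain ⟨ρ, hρ, h⟩ := exists_near_quadratic hS.H₀_near_zero one_pos
  have h0 := value_zero hS.H₀_near_zero
  have key : ∀ f : ℝ → ℝ, ∀ f' : ℝ, HasDerivAt f f' 0 → f 0 = 0 →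
      (∀ s, |s| ≤ ρ → |f s| ≤ 2 * s ^ 2) → f' = 0 := by
    intro f f' hf hf0 hb
    have hO : f =O[𝓝 0] (fun s => s ^ 2) := by
      refine Asymptotics.IsBigO.of_bound 2 ?_
      filter_upwards [Metric.ball_mem_nhds (0 : ℝ) hρ] with s hs
      rw [mem_ball_zero_iff, Real.norm_eq_abs] at hs
      simpa using hb s hs.le
    have hz : HasDerivAt f 0 0 := by
      rw [hasDerivAt_iff_isLittleO]
      simp only [hf0, sub_zero, smul_zero]
      refine hO.trans_isLittleO ?_
      simpa using Asymptotics.isLittleO_pow_id (𝕜 := ℝ) one_lt_two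
    exact hf.unique hz
  constructor
  · refine key _ _ (hS.smooth_H₀.hasDerivAt_fst 0 0) h0 fun s hs => ?_
    have := h s 0 hs (by simpa using hρ.le)
    rw [abs_le] at this ⊢
    constructor <;> nlinarith [this.1, this.2]
  · refine key _ _ (hS.smooth_H₀.hasDerivAt_snd 0 0) h0 fun s hs => ?_
    have := h 0 s (by simpa using hρ.le) hs
    rw [abs_le] at this ⊢
    constructor <;> nlinarith [this.1, this.2]

theorem Setting.smooth_rem_H (hS : Setting q E₀ H₀ H F Hc Fc) (N : ℕ) {t : ℝ} (ht : 0 < t)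
    (a : ℕ → ℝ) :
    Smooth2 (remainder (fun x y => H t x y - H₀ x y) (Finset.Icc 1 N) a Hc) :=
  smooth2_remainder ((hS.smooth_H.smooth2 ht).sub hS.smooth_H₀)
    fun k hk => hS.smooth_Hc k (Finset.mem_Icc.1 hk).1

theorem Setting.smooth_rem_F (hS : Setting q E₀ H₀ H F Hc Fc) (N : ℕ) {t : ℝ} (ht : 0 < t)
    (a : ℕ → ℝ) : Smooth2 (remainder (F t) (Finset.Icc 1 N) a Fc) :=
  smooth2_remainder (hS.smooth_F.smooth2 ht) fun k hk => hS.smooth_Fc k (Finset.mem_Icc.1 hk).1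

theorem Setting.pdx_rem_H (hS : Setting q E₀ H₀ H F Hc Fc) (N : ℕ) {t : ℝ} (ht : 0 < t)
    (a : ℕ → ℝ) (x y : ℝ) :
    pdx (remainder (fun x y => H t x y - H₀ x y) (Finset.Icc 1 N) a Hc) x y =
      pdx (H t) x y - pdx H₀ x y - ∑ k ∈ Finset.Icc 1 N, a k * pdx (Hc k) x y := by
  rw [pdx_remainder ((hS.smooth_H.smooth2 ht).sub hS.smooth_H₀)
    fun k hk => hS.smooth_Hc k (Finset.mem_Icc.1 hk).1, remainder,
    pdx_sub (hS.smooth_H.smooth2 ht) hS.smooth_H₀]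

theorem Setting.pdy_rem_H (hS : Setting q E₀ H₀ H F Hc Fc) (N : ℕ) {t : ℝ} (ht : 0 < t)
    (a : ℕ → ℝ) (x y : ℝ) :
    pdy (remainder (fun x y => H t x y - H₀ x y) (Finset.Icc 1 N) a Hc) x y =
      pdy (H t) x y - pdy H₀ x y - ∑ k ∈ Finset.Icc 1 N, a k * pdy (Hc k) x y := by
  rw [pdy_remainder ((hS.smooth_H.smooth2 ht).sub hS.smooth_H₀)
    fun k hk => hS.smooth_Hc k (Finset.mem_Icc.1 hk).1, remainder,
    pdy_sub (hS.smooth_H.smooth2 ht) hS.smooth_H₀]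

/-- The differentiated series, evaluated at the single point (0, 0), is an expansion of zero. -/
theorem Setting.pdx_Hc_zero (hS : Setting q E₀ H₀ H F Hc Fc) (hq : 1 ≤ q) (k : ℕ) (hk : 1 ≤ k) :
    pdx (Hc k) 0 0 = 0 := by
  refine coeff_eq_zero hq (a := fun k => pdx (Hc k) 0 0) (fun N => ?_) k hk
  obtain ⟨C, t₁, ht₁, h⟩ := hS.series_H N 1 0 (by norm_num) {(0, 0)} isCompact_singleton
  refine ⟨C, t₁, ht₁, fun t ht => ?_⟩
  have := h t ht 0 0 rfl
  have ht0 := ht₁.trans_le ht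
  simp only [Function.iterate_one, Function.iterate_zero, id] at this
  change |pdx (remainder (fun x y => H t x y - H₀ x y) (Finset.Icc 1 N)
    (fun k => t ^ (-(k : ℝ) / (q : ℝ))) Hc) 0 0| ≤ _ at this
  rw [hS.pdx_rem_H N ht0, hS.pdx_H_zero t ht0, hS.pdx_H₀_zero.1, sub_zero, zero_sub, abs_neg] at this
  exact this

theorem Setting.pdy_Hc_zero (hS : Setting q E₀ H₀ H F Hc Fc) (hq : 1 ≤ q) (k : ℕ) (hk : 1 ≤ k) :
    pdy (Hc k) 0 0 = 0 := by
  refine coeff_eq_zero hq (a := fun k => pdy (Hc k) 0 0) (fun N => ?_) k hk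
  obtain ⟨C, t₁, ht₁, h⟩ := hS.series_H N 0 1 (by norm_num) {(0, 0)} isCompact_singleton
  refine ⟨C, t₁, ht₁, fun t ht => ?_⟩
  have := h t ht 0 0 rfl
  have ht0 := ht₁.trans_le ht
  simp only [Function.iterate_one, Function.iterate_zero, id] at this
  change |pdy (remainder (fun x y => H t x y - H₀ x y) (Finset.Icc 1 N)
    (fun k => t ^ (-(k : ℝ) / (q : ℝ))) Hc) 0 0| ≤ _ at this
  rw [hS.pdy_rem_H N ht0, hS.pdy_H_zero t ht0, hS.pdx_H₀_zero.2, sub_zero, zero_sub, abs_neg] at this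
  exact this

theorem Setting.Fc_zero (hS : Setting q E₀ H₀ H F Hc Fc) (hq : 1 ≤ q) (k : ℕ) (hk : 1 ≤ k) :
    Fc k 0 0 = 0 := by
  refine coeff_eq_zero hq (a := fun k => Fc k 0 0) (fun N => ?_) k hk
  obtain ⟨C, t₁, ht₁, h⟩ := hS.series_F N 0 0 (by norm_num) {(0, 0)} isCompact_singleton
  refine ⟨C, t₁, ht₁, fun t ht => ?_⟩
  have := h t ht 0 0 rfl
  have ht0 := ht₁.trans_le ht
  simp only [Function.iterate_zero, id] at this
  rw [hS.F_zero t ht0, zero_sub, abs_neg] at this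
  exact this

/-- The gradient of the remainder of the Hamiltonian is small and vanishes at the origin. -/
theorem Setting.exists_grad_rem_H_bound (hS : Setting q E₀ H₀ H F Hc Fc) (hq : 1 ≤ q) (N : ℕ)
    (R : ℝ) : ∃ C t₁ : ℝ, 0 ≤ C ∧ 0 < t₁ ∧ ∀ t, t₁ ≤ t → ∀ x y, |x| ≤ R → |y| ≤ R →
      |pdx (H t) x y - pdx H₀ x y -
          ∑ k ∈ Finset.Icc 1 N, t ^ (-(k : ℝ) / (q : ℝ)) * pdx (Hc k) x y|
        ≤ C * t ^ (-((N : ℝ) + 1) / (q : ℝ)) * (|x| + |y|) ∧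
      |pdy (H t) x y - pdy H₀ x y -
          ∑ k ∈ Finset.Icc 1 N, t ^ (-(k : ℝ) / (q : ℝ)) * pdy (Hc k) x y|
        ≤ C * t ^ (-((N : ℝ) + 1) / (q : ℝ)) * (|x| + |y|) := by
  -- The bounds on second derivatives are integrated from the origin, where the gradient of the
  -- remainder vanishes; this produces the factor |x| + |y| that the first-order bounds alone lack.
  obtain ⟨C₁, t₁, ht₁, h₁⟩ := hS.series_H N 2 0 (by norm_num) _ (isCompact_square R)
  obtain ⟨C₂, t₂, ht₂, h₂⟩ := hS.series_H N 1 1 (by norm_num) _ (isCompact_square R)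
  obtain ⟨C₃, t₃, ht₃, h₃⟩ := hS.series_H N 0 2 (by norm_num) _ (isCompact_square R)
  refine ⟨|C₁| + |C₂| + |C₃|, max t₁ (max t₂ t₃), by positivity, by positivity, ?_⟩
  intro t ht x y hx hy
  have ht1 : t₁ ≤ t := (le_max_left _ _).trans ht
  have ht2 : t₂ ≤ t := ((le_max_left _ _).trans (le_max_right _ _)).trans ht
  have ht3 : t₃ ≤ t := ((le_max_right _ _).trans (le_max_right _ _)).trans ht
  have ht0 : 0 < t := ht₁.trans_le ht1
  set a : ℕ → ℝ := fun k => t ^ (-(k : ℝ) / (q : ℝ)) with ha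
  have hw : 0 < t ^ (-((N : ℝ) + 1) / (q : ℝ)) := Real.rpow_pos_of_pos ht0 _
  set w := t ^ (-((N : ℝ) + 1) / (q : ℝ)) with hw'
  set r := remainder (fun x y => H t x y - H₀ x y) (Finset.Icc 1 N) a Hc with hr
  have hrs : Smooth2 r := hS.smooth_rem_H N ht0 a
  have b1 := h₁ t ht1
  have b2 := h₂ t ht2
  have b3 := h₃ t ht3
  simp only [Function.iterate_succ, Function.comp, Function.iterate_zero, id] at b1 b2 b3
  have m1 : C₁ * w ≤ (|C₁| + |C₂| + |C₃|) * w := mul_le_mul_of_nonneg_right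
    (by linarith [le_abs_self C₁, abs_nonneg C₂, abs_nonneg C₃]) hw.le
  have m2 : C₂ * w ≤ (|C₁| + |C₂| + |C₃|) * w := mul_le_mul_of_nonneg_right
    (by linarith [le_abs_self C₂, abs_nonneg C₁, abs_nonneg C₃]) hw.le
  have m3 : C₃ * w ≤ (|C₁| + |C₂| + |C₃|) * w := mul_le_mul_of_nonneg_right
    (by linarith [le_abs_self C₃, abs_nonneg C₂, abs_nonneg C₁]) hw.le
  have z1 : pdx r 0 0 = 0 := by
    rw [hr, hS.pdx_rem_H N ht0, hS.pdx_H_zero t ht0, hS.pdx_H₀_zero.1, sub_zero, zero_sub,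
      neg_eq_zero]
    exact Finset.sum_eq_zero fun k hk => by
      rw [hS.pdx_Hc_zero hq k (Finset.mem_Icc.1 hk).1, mul_zero]
  have z2 : pdy r 0 0 = 0 := by
    rw [hr, hS.pdy_rem_H N ht0, hS.pdy_H_zero t ht0, hS.pdx_H₀_zero.2, sub_zero, zero_sub,
      neg_eq_zero]
    exact Finset.sum_eq_zero fun k hk => by
      rw [hS.pdy_Hc_zero hq k (Finset.mem_Icc.1 hk).1, mul_zero]
  constructor
  · rw [← hS.pdx_rem_H N ht0 a x y, ← hr]
    have := abs_sub_zero_le hrs.pdx (x := x) (y := y) (M := (|C₁| + |C₂| + |C₃|) * w)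
      (fun x' y' h h' => (b1 x' y' (mem_square.2 ⟨h.trans hx, h'.trans hy⟩)).trans m1)
      (fun x' y' h h' => by
        rw [hrs.pdy_pdx]
        exact (b2 x' y' (mem_square.2 ⟨h.trans hx, h'.trans hy⟩)).trans m2)
    rwa [z1, sub_zero] at this
  · rw [← hS.pdy_rem_H N ht0 a x y, ← hr]
    have := abs_sub_zero_le hrs.pdy (x := x) (y := y) (M := (|C₁| + |C₂| + |C₃|) * w)
      (fun x' y' h h' => (b2 x' y' (mem_square.2 ⟨h.trans hx, h'.trans hy⟩)).trans m2)
      (fun x' y' h h' => (b3 x' y' (mem_square.2 ⟨h.trans hx, h'.trans hy⟩)).trans m3)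
    rwa [z2, sub_zero] at this

/-- The remainder itself vanishes at the origin, so first derivatives suffice. -/
theorem Setting.exists_rem_F_bound (hS : Setting q E₀ H₀ H F Hc Fc) (hq : 1 ≤ q) (N : ℕ)
    (R : ℝ) : ∃ C t₁ : ℝ, 0 ≤ C ∧ 0 < t₁ ∧ ∀ t, t₁ ≤ t → ∀ x y, |x| ≤ R → |y| ≤ R →
      |F t x y - ∑ k ∈ Finset.Icc 1 N, t ^ (-(k : ℝ) / (q : ℝ)) * Fc k x y|
        ≤ C * t ^ (-((N : ℝ) + 1) / (q : ℝ)) * (|x| + |y|) := by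
  obtain ⟨C₁, t₁, ht₁, h₁⟩ := hS.series_F N 1 0 (by norm_num) _ (isCompact_square R)
  obtain ⟨C₂, t₂, ht₂, h₂⟩ := hS.series_F N 0 1 (by norm_num) _ (isCompact_square R)
  refine ⟨|C₁| + |C₂|, max t₁ t₂, by positivity, by positivity, ?_⟩
  intro t ht x y hx hy
  have ht1 : t₁ ≤ t := (le_max_left _ _).trans ht
  have ht2 : t₂ ≤ t := (le_max_right _ _).trans ht
  have ht0 : 0 < t := ht₁.trans_le ht1
  set a : ℕ → ℝ := fun k => t ^ (-(k : ℝ) / (q : ℝ)) with ha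
  have hw : 0 < t ^ (-((N : ℝ) + 1) / (q : ℝ)) := Real.rpow_pos_of_pos ht0 _
  set w := t ^ (-((N : ℝ) + 1) / (q : ℝ)) with hw'
  have hrs : Smooth2 (remainder (F t) (Finset.Icc 1 N) a Fc) := hS.smooth_rem_F N ht0 a
  have b1 := h₁ t ht1
  have b2 := h₂ t ht2
  simp only [Function.iterate_succ, Function.comp, Function.iterate_zero, id] at b1 b2
  have m1 : C₁ * w ≤ (|C₁| + |C₂|) * w := mul_le_mul_of_nonneg_right
    (by linarith [le_abs_self C₁, abs_nonneg C₂]) hw.le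
  have m2 : C₂ * w ≤ (|C₁| + |C₂|) * w := mul_le_mul_of_nonneg_right
    (by linarith [le_abs_self C₂, abs_nonneg C₁]) hw.le
  have z1 : remainder (F t) (Finset.Icc 1 N) a Fc 0 0 = 0 := by
    rw [remainder, hS.F_zero t ht0, zero_sub, neg_eq_zero]
    exact Finset.sum_eq_zero fun k hk => by
      rw [hS.Fc_zero hq k (Finset.mem_Icc.1 hk).1, mul_zero]
  have := abs_sub_zero_le hrs (x := x) (y := y) (M := (|C₁| + |C₂|) * w)
    (fun x' y' h h' => (b1 x' y' (mem_square.2 ⟨h.trans hx, h'.trans hy⟩)).trans m1)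
    (fun x' y' h h' => (b2 x' y' (mem_square.2 ⟨h.trans hx, h'.trans hy⟩)).trans m2)
  rwa [z1, sub_zero] at this

end slow

end

/-! ### The truncated Hamiltonian and its drift along solutions -/

section

/-- The truncated Hamiltonian, normalized at the origin. -/
def slowVar (q n : ℕ) (H₀ : ℝ → ℝ → ℝ) (Hc : ℕ → ℝ → ℝ → ℝ) (t x y : ℝ) : ℝ :=
  H₀ x y + ∑ k ∈ Finset.Icc 1 n, t ^ (-(k : ℝ) / (q : ℝ)) * (Hc k x y - Hc k 0 0)

/-- The derivative of the truncated Hamiltonian along solutions. -/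
def slowRate (q n : ℕ) (H₀ : ℝ → ℝ → ℝ) (H F : ℝ → ℝ → ℝ → ℝ) (Hc : ℕ → ℝ → ℝ → ℝ)
    (t x y : ℝ) : ℝ :=
  ∑ k ∈ Finset.Icc 1 n,
    (-(k : ℝ) / (q : ℝ)) * t ^ (-(k : ℝ) / (q : ℝ) - 1) * (Hc k x y - Hc k 0 0) +
  ((pdx H₀ x y + ∑ k ∈ Finset.Icc 1 n, t ^ (-(k : ℝ) / (q : ℝ)) * pdx (Hc k) x y) *
      pdy (H t) x y +
    (pdy H₀ x y + ∑ k ∈ Finset.Icc 1 n, t ^ (-(k : ℝ) / (q : ℝ)) * pdy (Hc k) x y) *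
      (-pdx (H t) x y + F t x y))

variable {q n : ℕ} {E₀ : ℝ} {H₀ : ℝ → ℝ → ℝ} {H F : ℝ → ℝ → ℝ → ℝ} {Hc Fc : ℕ → ℝ → ℝ → ℝ}

theorem Setting.hasDerivWithinAt_slowVar (hS : Setting q E₀ H₀ H F Hc Fc) (n : ℕ) {I : Set ℝ}
    {x y : ℝ → ℝ} (hsol : IsSolOn H F I x y) {t : ℝ} (ht : t ∈ I) (ht0 : 0 < t) :
    HasDerivWithinAt (fun s => slowVar q n H₀ Hc s (x s) (y s))
      (slowRate q n H₀ H F Hc t (x t) (y t)) I t := by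
  obtain ⟨hx, hy⟩ := hsol t ht
  have h1 := hS.smooth_H₀.hasDerivWithinAt_comp hx hy
  have h2 : HasDerivWithinAt (fun s => ∑ k ∈ Finset.Icc 1 n,
      s ^ (-(k : ℝ) / (q : ℝ)) * (Hc k (x s) (y s) - Hc k 0 0))
      (∑ k ∈ Finset.Icc 1 n, ((-(k : ℝ) / (q : ℝ)) * t ^ (-(k : ℝ) / (q : ℝ) - 1) *
        (Hc k (x t) (y t) - Hc k 0 0) + t ^ (-(k : ℝ) / (q : ℝ)) *
        (pdx (Hc k) (x t) (y t) * pdy (H t) (x t) (y t) +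
          pdy (Hc k) (x t) (y t) * (-pdx (H t) (x t) (y t) + F t (x t) (y t))))) I t := by
    refine HasDerivWithinAt.fun_sum fun k hk => ?_
    have a1 := (Real.hasDerivAt_rpow_const (p := -(k : ℝ) / (q : ℝ)) (Or.inl ht0.ne')
      ).hasDerivWithinAt (s := I)
    have a2 := (hS.smooth_Hc k (Finset.mem_Icc.1 hk).1).hasDerivWithinAt_comp hx hy
    exact a1.mul (a2.sub_const _)
  refine (h1.add h2).congr_deriv ?_
  rw [slowRate, Finset.sum_add_distrib, add_mul, add_mul, Finset.sum_mul, Finset.sum_mul]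
  have : ∑ k ∈ Finset.Icc 1 n, t ^ (-(k : ℝ) / (q : ℝ)) *
        (pdx (Hc k) (x t) (y t) * pdy (H t) (x t) (y t) +
          pdy (Hc k) (x t) (y t) * (-pdx (H t) (x t) (y t) + F t (x t) (y t)))
      = ∑ k ∈ Finset.Icc 1 n, t ^ (-(k : ℝ) / (q : ℝ)) * pdx (Hc k) (x t) (y t) *
          pdy (H t) (x t) (y t) +
        ∑ k ∈ Finset.Icc 1 n, t ^ (-(k : ℝ) / (q : ℝ)) * pdy (Hc k) (x t) (y t) *
          (-pdx (H t) (x t) (y t) + F t (x t) (y t)) := by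
    rw [← Finset.sum_add_distrib]
    exact Finset.sum_congr rfl fun k _ => by ring
  rw [this]
  ring

theorem exists_eventually_small {q : ℕ} (hq : 1 ≤ q) {C ε : ℝ} (hε : 0 < ε) :
    ∃ t₁, 1 ≤ t₁ ∧ ∀ t, t₁ ≤ t → C * t ^ (-1 / (q : ℝ)) ≤ ε := by
  have hlim : Filter.Tendsto (fun t : ℝ => C * t ^ (-1 / (q : ℝ))) Filter.atTop (𝓝 0) := by
    simpa using (tendsto_rpow_neg_one_div hq).const_mul C
  obtain ⟨t₁, h⟩ := Filter.eventually_atTop.1 (hlim.eventually_lt_const hε)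
  exact ⟨max t₁ 1, le_max_right _ _, fun t ht => (h t ((le_max_left _ _).trans ht)).le⟩

/-- Here A is the gradient of H₀, B that of the terms of order 1 to n, R that of the remainder of H,
D the explicit time derivative, f = F_n, S the remainder of F, e = t^(-1/q), p = t^(-n/q) and s =
|x| + |y|. The bracket of A + B with itself cancels; each surviving error has a factor e beyond p
and is quadratic in the distance. -/
theorem slowRate_error_algebra {D Ax Ay Bx By Rx Ry f S p Hx Hy Fv e s Q C₁ C₂ C₃ C₄ C₅ C₆ : ℝ}
    (hHx : Hx = Ax + Bx + Rx) (hHy : Hy = Ay + By + Ry) (hF : Fv = p * f + S)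
    (hp : 0 ≤ p) (he : 0 ≤ e) (hs : 0 ≤ s) (hsQ : s * s ≤ 2 * Q)
    (hC₂ : 0 ≤ C₂) (hC₃ : 0 ≤ C₃) (hC₄ : 0 ≤ C₄) (hC₅ : 0 ≤ C₅) (hC₆ : 0 ≤ C₆)
    (hD : |D| ≤ C₁ * (e * p) * Q) (hKx : |Ax + Bx| ≤ C₂ * s) (hKy : |Ay + By| ≤ C₂ * s)
    (hRx : |Rx| ≤ C₃ * (e * p) * s) (hRy : |Ry| ≤ C₃ * (e * p) * s) (hBy : |By| ≤ C₄ * e * s)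
    (hf : |f| ≤ C₅ * s) (hS : |S| ≤ C₆ * (e * p) * s) :
    |D + ((Ax + Bx) * Hy + (Ay + By) * (-Hx + Fv)) - p * (Ay * f)| ≤
      (C₁ + 2 * (2 * C₂ * C₃ + C₄ * C₅ + C₂ * C₆)) * e * p * Q := by
  have e1 : D + ((Ax + Bx) * Hy + (Ay + By) * (-Hx + Fv)) - p * (Ay * f) =
      D + (Ax + Bx) * Ry + (-((Ay + By) * Rx)) + p * (By * f) + (Ay + By) * S := by
    rw [hHx, hHy, hF]; ring
  rw [e1]
  have t1 : |(Ax + Bx) * Ry| ≤ C₂ * C₃ * (e * p) * (s * s) := by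
    rw [abs_mul]
    calc _ ≤ (C₂ * s) * (C₃ * (e * p) * s) :=
          mul_le_mul hKx hRy (abs_nonneg _) (by positivity)
      _ = _ := by ring
  have t2 : |-((Ay + By) * Rx)| ≤ C₂ * C₃ * (e * p) * (s * s) := by
    rw [abs_neg, abs_mul]
    calc _ ≤ (C₂ * s) * (C₃ * (e * p) * s) :=
          mul_le_mul hKy hRx (abs_nonneg _) (by positivity)
      _ = _ := by ring
  have t3 : |p * (By * f)| ≤ C₄ * C₅ * (e * p) * (s * s) := by
    rw [abs_mul, abs_mul, abs_of_nonneg hp]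
    calc _ ≤ p * ((C₄ * e * s) * (C₅ * s)) :=
          mul_le_mul_of_nonneg_left (mul_le_mul hBy hf (abs_nonneg _) (by positivity)) hp
      _ = _ := by ring
  have t4 : |(Ay + By) * S| ≤ C₂ * C₆ * (e * p) * (s * s) := by
    rw [abs_mul]
    calc _ ≤ (C₂ * s) * (C₆ * (e * p) * s) :=
          mul_le_mul hKy hS (abs_nonneg _) (by positivity)
      _ = _ := by ring
  have t5 : (2 * C₂ * C₃ + C₄ * C₅ + C₂ * C₆) * (e * p) * (s * s) ≤
      (2 * C₂ * C₃ + C₄ * C₅ + C₂ * C₆) * (e * p) * (2 * Q) :=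
    mul_le_mul_of_nonneg_left hsQ (by positivity)
  have u1 := abs_add_le (D + (Ax + Bx) * Ry + (-((Ay + By) * Rx)) + p * (By * f)) ((Ay + By) * S)
  have u2 := abs_add_le (D + (Ax + Bx) * Ry + (-((Ay + By) * Rx))) (p * (By * f))
  have u3 := abs_add_le (D + (Ax + Bx) * Ry) (-((Ay + By) * Rx))
  have u4 := abs_add_le D ((Ax + Bx) * Ry)
  linarith

/-- The system is close to the limiting one, and the truncated Hamiltonian drifts along solutions
at the rate given by the first non-vanishing coefficient of the perturbation. -/
theorem Setting.exists_estimates (hS : Setting q E₀ H₀ H F Hc Fc) (hn : 1 ≤ n) (hnq : n ≤ q)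
    (hF_lt : ∀ i, 1 ≤ i → i < n → ∀ x y, Fc i x y = 0) (R : ℝ) {ε : ℝ} (hε : 0 < ε) :
    ∃ t₁, 1 ≤ t₁ ∧ ∀ t, t₁ ≤ t → ∀ x y, |x| ≤ R → |y| ≤ R →
      |pdy (H t) x y - pdy H₀ x y| ≤ ε * (|x| + |y|) ∧
      |(-pdx (H t) x y + F t x y) - -pdx H₀ x y| ≤ ε * (|x| + |y|) ∧
      |slowVar q n H₀ Hc t x y - H₀ x y| ≤ ε * (x ^ 2 + y ^ 2) ∧
      |slowRate q n H₀ H F Hc t x y - t ^ (-(n : ℝ) / (q : ℝ)) * (pdy H₀ x y * Fc n x y)| ≤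
        ε * t ^ (-(n : ℝ) / (q : ℝ)) * (x ^ 2 + y ^ 2) := by
  have hq : 1 ≤ q := hn.trans hnq
  have hmem : ∀ k ∈ Finset.Icc 1 n, 1 ≤ k := fun k hk => (Finset.mem_Icc.1 hk).1
  obtain ⟨Cx, hCx0, hCx⟩ := exists_sum_pow_bound (φ := fun x y => |x| + |y|) (R := R) n
    (G := fun k => pdx (Hc k)) fun k hk => (hS.smooth_Hc k (hmem k hk)).pdx.exists_linear_bound
      (hS.pdx_Hc_zero hq k (hmem k hk)) R
  obtain ⟨Cy, hCy0, hCy⟩ := exists_sum_pow_bound (φ := fun x y => |x| + |y|) (R := R) n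
    (G := fun k => pdy (Hc k)) fun k hk => (hS.smooth_Hc k (hmem k hk)).pdy.exists_linear_bound
      (hS.pdy_Hc_zero hq k (hmem k hk)) R
  have hquad : ∀ k ∈ Finset.Icc 1 n, ∃ C, 0 < C ∧ ∀ x y, |x| ≤ R → |y| ≤ R →
      |Hc k x y - Hc k 0 0| ≤ C * (x ^ 2 + y ^ 2) := fun k hk =>
    (hS.smooth_Hc k (hmem k hk)).exists_quadratic_bound (hS.pdx_Hc_zero hq k (hmem k hk))
      (hS.pdy_Hc_zero hq k (hmem k hk)) R
  obtain ⟨Ck, hCk0, hCk⟩ := exists_sum_pow_bound (φ := fun x y => x ^ 2 + y ^ 2) (R := R) n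
    (G := fun k x y => Hc k x y - Hc k 0 0) hquad
  obtain ⟨Ct, hCt0, hCt⟩ := exists_sum_pow_bound (φ := fun x y => x ^ 2 + y ^ 2) (R := R) n
    (G := fun k x y => (-(k : ℝ) / (q : ℝ)) * (Hc k x y - Hc k 0 0)) (by
      intro k hk
      obtain ⟨C, hC, h⟩ := hquad k hk
      refine ⟨(|-(k : ℝ) / (q : ℝ)| + 1) * C, by positivity, fun x y hx hy => ?_⟩
      rw [abs_mul, mul_assoc]
      exact mul_le_mul (by linarith) (h x y hx hy) (abs_nonneg _) (by positivity))
  obtain ⟨C₀x, hC₀x0, hC₀x⟩ := hS.smooth_H₀.pdx.exists_linear_bound hS.pdx_H₀_zero.1 R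
  obtain ⟨C₀y, hC₀y0, hC₀y⟩ := hS.smooth_H₀.pdy.exists_linear_bound hS.pdx_H₀_zero.2 R
  obtain ⟨Cf, hCf0, hCf⟩ := (hS.smooth_Fc n hn).exists_linear_bound (hS.Fc_zero hq n hn) R
  obtain ⟨Ch, τ₁, hCh0, hτ₁, hCh⟩ := hS.exists_grad_rem_H_bound hq n R
  obtain ⟨Cs, τ₂, hCs0, hτ₂, hCs⟩ := hS.exists_rem_F_bound hq n R
  set C₂ := C₀x + C₀y + Cx + Cy with hC₂
  -- The three groups serve the drift, the two velocity components and the difference between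
  -- `slowVar` and H₀, so one condition M t^(-1/q) ≤ ε covers all four conclusions.
  set M := (Ct + 2 * (2 * C₂ * Ch + Cy * Cf + C₂ * Cs)) + (Cx + Cy + Ch + Cf + Cs) + Ck with hM
  obtain ⟨τ₃, hτ₃, hsm⟩ := exists_eventually_small hq (C := M) hε
  refine ⟨max τ₃ (max τ₁ τ₂), hτ₃.trans (le_max_left _ _), ?_⟩
  intro t ht x y hx hy
  have ht3 : τ₃ ≤ t := (le_max_left _ _).trans ht
  have ht1 : τ₁ ≤ t := ((le_max_left _ _).trans (le_max_right _ _)).trans ht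
  have ht2 : τ₂ ≤ t := ((le_max_right _ _).trans (le_max_right _ _)).trans ht
  have htone : 1 ≤ t := hτ₃.trans ht3
  have ht0 : 0 < t := zero_lt_one.trans_le htone
  have hMe := hsm t ht3
  obtain ⟨hgx, hgy⟩ := hCh t ht1 x y hx hy
  have hFr := hCs t ht2 x y hx hy
  have hFsum : ∑ k ∈ Finset.Icc 1 n, t ^ (-(k : ℝ) / (q : ℝ)) * Fc k x y
      = t ^ (-(n : ℝ) / (q : ℝ)) * Fc n x y := by
    refine Finset.sum_eq_single_of_mem n (by simp [hn]) fun j hj hjn => ?_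
    rw [Finset.mem_Icc] at hj
    rw [hF_lt j hj.1 (lt_of_le_of_ne hj.2 hjn), mul_zero]
  rw [hFsum] at hFr
  have hsub : ∀ k : ℕ, t ^ (-(k : ℝ) / (q : ℝ) - 1)
      = (t ^ (-1 / (q : ℝ))) ^ q * (t ^ (-1 / (q : ℝ))) ^ k := by
    intro k
    have hq' : (q : ℝ) ≠ 0 := by positivity
    rw [← rpow_neg_div_eq_pow ht0, ← rpow_neg_div_eq_pow ht0, ← Real.rpow_add ht0]
    congr 1; field_simp; ring
  unfold slowVar slowRate
  simp only [hsub, rpow_neg_succ_div_eq_pow ht0, rpow_neg_div_eq_pow ht0] at hgx hgy hFr ⊢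
  have he0 : 0 < t ^ (-1 / (q : ℝ)) := Real.rpow_pos_of_pos ht0 _
  have he1 : t ^ (-1 / (q : ℝ)) ≤ 1 := Real.rpow_le_one_of_one_le_of_nonpos htone
    (by rw [neg_div]; exact neg_nonpos.2 (by positivity))
  set e := t ^ (-1 / (q : ℝ)) with he
  have hBx := hCx e he0.le he1 x y hx hy
  have hBy := hCy e he0.le he1 x y hx hy
  have hK := hCk e he0.le he1 x y hx hy
  have hD := hCt e he0.le he1 x y hx hy
  have hAx := hC₀x x y hx hy
  have hAy := hC₀y x y hx hy
  have hf := hCf x y hx hy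
  have hs0 : 0 ≤ |x| + |y| := by positivity
  have hpn : e ^ n ≤ e := pow_le_of_le_one he0.le he1 (by omega)
  -- Here n ≤ q enters: the explicit time derivative carries e^q e^k with k ≥ 1, hence is smaller
  -- than e^n by a factor e.
  have hqn : e ^ q ≤ e ^ n := pow_le_pow_of_le_one he0.le he1 hnq
  have hp0 : 0 < e ^ n := pow_pos he0 n
  rw [pow_succ, mul_comm (e ^ n) e] at hgx hgy hFr
  set Bx := ∑ k ∈ Finset.Icc 1 n, e ^ k * pdx (Hc k) x y with hBxd
  set By := ∑ k ∈ Finset.Icc 1 n, e ^ k * pdy (Hc k) x y with hByd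
  set s := |x| + |y| with hsd
  have hsQ : s * s ≤ 2 * (x ^ 2 + y ^ 2) := add_abs_sq_le x y
  set Q := x ^ 2 + y ^ 2 with hQ
  have hQ0 : 0 ≤ Q := by positivity
  have hep : e * e ^ n ≤ e := mul_le_of_le_one_right he0.le (hpn.trans he1)
  have hC₂0 : 0 ≤ C₂ := by positivity
  have w1 : Ch * (e * e ^ n) * s ≤ Ch * e * s := by gcongr
  have w2 : Cs * (e * e ^ n) * s ≤ Cs * e * s := by gcongr
  have hMlin : ∀ z, |z| ≤ (Cx + Cy + Ch + Cf + Cs) * e * s → |z| ≤ ε * s := fun z hz' => by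
    refine hz'.trans (mul_le_mul_of_nonneg_right (le_trans ?_ hMe) hs0)
    refine mul_le_mul_of_nonneg_right ?_ he0.le
    have : 0 ≤ Ct + 2 * (2 * C₂ * Ch + Cy * Cf + C₂ * Cs) := by positivity
    linarith
  refine ⟨hMlin _ ?_, hMlin _ ?_, ?_, ?_⟩
  · have e1 : pdy (H t) x y - pdy H₀ x y = (pdy (H t) x y - pdy H₀ x y - By) + By := by ring
    have : 0 ≤ (Cx + Cf + Cs) * e * s := by positivity
    rw [e1]
    refine (abs_add_le _ _).trans ?_
    linarith
  · have e1 : (-pdx (H t) x y + F t x y) - -pdx H₀ x y =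
        (-(pdx (H t) x y - pdx H₀ x y - Bx)) + (-Bx) + (F t x y - e ^ n * Fc n x y) +
          e ^ n * Fc n x y := by ring
    have v1 : |e ^ n * Fc n x y| ≤ Cf * e * s := by
      rw [abs_mul, abs_of_pos hp0]
      calc _ ≤ e * (Cf * s) := mul_le_mul hpn hf (abs_nonneg _) he0.le
        _ = _ := by ring
    have : 0 ≤ Cy * e * s := by positivity
    rw [e1]
    refine (abs_add_le _ _).trans ?_
    have v2 := abs_add_le ((-(pdx (H t) x y - pdx H₀ x y - Bx)) + (-Bx)) (F t x y - e ^ n * Fc n x y)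
    have v3 := abs_add_le (-(pdx (H t) x y - pdx H₀ x y - Bx)) (-Bx)
    rw [abs_neg, abs_neg] at v3
    linarith
  · rw [add_sub_cancel_left]
    refine hK.trans (mul_le_mul_of_nonneg_right (le_trans ?_ hMe) hQ0)
    refine mul_le_mul_of_nonneg_right ?_ he0.le
    have : 0 ≤ Ct + 2 * (2 * C₂ * Ch + Cy * Cf + C₂ * Cs) + (Cx + Cy + Ch + Cf + Cs) := by
      positivity
    linarith
  · have hDeq : ∑ k ∈ Finset.Icc 1 n, -(k : ℝ) / (q : ℝ) * (e ^ q * e ^ k) *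
          (Hc k x y - Hc k 0 0) =
        e ^ q * ∑ k ∈ Finset.Icc 1 n, e ^ k * (-(k : ℝ) / (q : ℝ) * (Hc k x y - Hc k 0 0)) := by
      rw [Finset.mul_sum]
      exact Finset.sum_congr rfl fun k _ => by ring
    have hD' : |∑ k ∈ Finset.Icc 1 n, -(k : ℝ) / (q : ℝ) * (e ^ q * e ^ k) *
          (Hc k x y - Hc k 0 0)| ≤ Ct * (e * e ^ n) * Q := by
      rw [hDeq, abs_mul, abs_of_pos (pow_pos he0 q)]
      calc _ ≤ e ^ n * (Ct * e * Q) := mul_le_mul hqn hD (abs_nonneg _) hp0.le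
        _ = _ := by ring
    have key := slowRate_error_algebra (Ax := pdx H₀ x y) (Ay := pdy H₀ x y) (Bx := Bx)
      (By := By) (Rx := pdx (H t) x y - pdx H₀ x y - Bx)
      (Ry := pdy (H t) x y - pdy H₀ x y - By) (f := Fc n x y)
      (S := F t x y - e ^ n * Fc n x y) (p := e ^ n) (Hx := pdx (H t) x y) (Hy := pdy (H t) x y)
      (Fv := F t x y) (e := e) (s := s) (Q := Q) (C₂ := C₂) (C₄ := Cy)
      (by ring) (by ring) (by ring) hp0.le he0.le hs0 hsQ hC₂0 hCh0 hCy0 hCf0.le hCs0 hD'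
      (by
        have : 0 ≤ (C₀y + Cy) * s := by positivity
        have h2 : Cx * e * s ≤ Cx * 1 * s := by gcongr
        refine (abs_add_le _ _).trans ?_
        rw [hC₂]; linarith)
      (by
        have : 0 ≤ (C₀x + Cx) * s := by positivity
        have h2 : Cy * e * s ≤ Cy * 1 * s := by gcongr
        refine (abs_add_le _ _).trans ?_
        rw [hC₂]; linarith)
      hgx hgy hBy hf hFr
    refine key.trans (mul_le_mul_of_nonneg_right (mul_le_mul_of_nonneg_right
      (le_trans ?_ hMe) hp0.le) hQ0)
    refine mul_le_mul_of_nonneg_right ?_ he0.le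
    rw [hM]
    have : 0 ≤ (Cx + Cy + Ch + Cf + Cs) + Ck := by positivity
    linarith

end

/-! ### Second-order behaviour at the equilibrium and the averaged linear term -/

section

theorem eq_zero_of_abs_le_mul {a C : ℝ} (h : ∀ ε, 0 < ε → |a| ≤ C * ε) : a = 0 := by
  by_contra ha
  have ha' : 0 < |a| := abs_pos.2 ha
  have h1 := h (|a| / (2 * (|C| + 1))) (by positivity)
  have h2 : C * (|a| / (2 * (|C| + 1))) ≤ (|C| + 1) * (|a| / (2 * (|C| + 1))) :=
    mul_le_mul_of_nonneg_right (by linarith [le_abs_self C]) (by positivity)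
  have h3 : (|C| + 1) * (|a| / (2 * (|C| + 1))) = |a| / 2 := by field_simp
  linarith

/-- A smooth function which is `o(r²)` at the origin with critical point there has vanishing second
derivatives. -/
theorem Smooth2.hessian_quadratic_eq_zero {G : ℝ → ℝ → ℝ} (hG : Smooth2 G) (h0 : G 0 0 = 0)
    (hx : AsymptHam.pdx G 0 0 = 0) (hy : AsymptHam.pdy G 0 0 = 0)
    (ho : ∀ ε, 0 < ε → ∃ ρ, 0 < ρ ∧ ∀ x y, |x| ≤ ρ → |y| ≤ ρ → |G x y| ≤ ε * (x ^ 2 + y ^ 2))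
    (u v : ℝ) (hu : |u| ≤ 1) (hv : |v| ≤ 1) :
    u * (AsymptHam.pdx (AsymptHam.pdx G) 0 0 * u + AsymptHam.pdy (AsymptHam.pdx G) 0 0 * v) +
      v * (AsymptHam.pdx (AsymptHam.pdy G) 0 0 * u + AsymptHam.pdy (AsymptHam.pdy G) 0 0 * v)
      = 0 := by
  set A := AsymptHam.pdx (AsymptHam.pdx G) 0 0
  set B := AsymptHam.pdy (AsymptHam.pdx G) 0 0
  set B' := AsymptHam.pdx (AsymptHam.pdy G) 0 0
  set C := AsymptHam.pdy (AsymptHam.pdy G) 0 0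
  set Q := u * (A * u + B * v) + v * (B' * u + C * v) with hQ
  -- On the ray, |Q s²/2| is at most 4εs² from the mean value theorem plus 2εs² from `ho`; doubling
  -- gives 12.
  refine eq_zero_of_abs_le_mul (C := 12) fun ε hε => ?_
  obtain ⟨ρ₁, hρ₁, h₁⟩ := hG.pdx.exists_expansion hx ε hε
  obtain ⟨ρ₂, hρ₂, h₂⟩ := hG.pdy.exists_expansion hy ε hε
  obtain ⟨ρ₃, hρ₃, h₃⟩ := ho ε hε
  obtain ⟨s, hs, hs1, hs2, hs3⟩ : ∃ s, 0 < s ∧ s ≤ ρ₁ ∧ s ≤ ρ₂ ∧ s ≤ ρ₃ :=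
    ⟨min ρ₁ (min ρ₂ ρ₃), by positivity, min_le_left _ _,
      (min_le_right _ _).trans (min_le_left _ _), (min_le_right _ _).trans (min_le_right _ _)⟩
  have hsc : ∀ r w, 0 ≤ r → r ≤ s → |w| ≤ 1 → |r * w| ≤ r := fun r w hr _ hw => by
    rw [abs_mul, abs_of_nonneg hr]
    exact mul_le_of_le_one_right hr hw
  -- Q is the Hessian form in the direction (u, v), so this derivative is o(r) by the expansion of
  -- the gradient.
  have hder : ∀ r : ℝ, HasDerivAt (fun r => G (r * u) (r * v) - Q * r ^ 2 / 2)
      (AsymptHam.pdx G (r * u) (r * v) * u + AsymptHam.pdy G (r * u) (r * v) * v - Q * r) r := by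
    intro r
    have hu' : HasDerivWithinAt (fun r : ℝ => r * u) u Set.univ r :=
      ((hasDerivAt_id r).mul_const u).hasDerivWithinAt.congr_deriv (one_mul u)
    have hv' : HasDerivWithinAt (fun r : ℝ => r * v) v Set.univ r :=
      ((hasDerivAt_id r).mul_const v).hasDerivWithinAt.congr_deriv (one_mul v)
    have h := (hG.hasDerivWithinAt_comp hu' hv').hasDerivAt Filter.univ_mem
    refine (h.sub (((hasDerivAt_pow 2 r).const_mul Q).div_const 2)).congr_deriv ?_
    simp; ring
  have hbd : ∀ r ∈ Set.Icc 0 s, ‖AsymptHam.pdx G (r * u) (r * v) * u +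
      AsymptHam.pdy G (r * u) (r * v) * v - Q * r‖ ≤ 4 * ε * s := by
    intro r hr
    have ru := hsc r u hr.1 hr.2 hu
    have rv := hsc r v hr.1 hr.2 hv
    have a1 := h₁ (r * u) (r * v) (ru.trans (hr.2.trans hs1)) (rv.trans (hr.2.trans hs1))
    have a2 := h₂ (r * u) (r * v) (ru.trans (hr.2.trans hs2)) (rv.trans (hr.2.trans hs2))
    have a3 : ε * (|r * u| + |r * v|) ≤ 2 * ε * s := by
      have : |r * u| + |r * v| ≤ 2 * s := by linarith [hr.2]
      nlinarith
    set p := AsymptHam.pdx G (r * u) (r * v) - (A * (r * u) + B * (r * v))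
    set p' := AsymptHam.pdy G (r * u) (r * v) - (B' * (r * u) + C * (r * v))
    have e1 : AsymptHam.pdx G (r * u) (r * v) * u +
      AsymptHam.pdy G (r * u) (r * v) * v - Q * r = p * u + p' * v := by
      rw [hQ]; ring
    rw [e1, Real.norm_eq_abs]
    have b1 : |p * u| ≤ |p| := by
      rw [abs_mul]; exact mul_le_of_le_one_right (abs_nonneg _) hu
    have b2 : |p' * v| ≤ |p'| := by
      rw [abs_mul]; exact mul_le_of_le_one_right (abs_nonneg _) hv
    linarith [abs_add_le (p * u) (p' * v)]
  have hmv := (convex_Icc 0 s).norm_image_sub_le_of_norm_hasDerivWithin_le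
    (fun r _ => (hder r).hasDerivWithinAt) hbd (Set.left_mem_Icc.2 hs.le)
    (Set.right_mem_Icc.2 hs.le)
  simp only [zero_mul, h0, sub_zero, Real.norm_eq_abs, abs_of_pos hs] at hmv
  have h3 := h₃ (s * u) (s * v) ((hsc s u hs.le le_rfl hu).trans hs3)
    ((hsc s v hs.le le_rfl hv).trans hs3)
  have h4 : ε * ((s * u) ^ 2 + (s * v) ^ 2) ≤ 2 * ε * s ^ 2 := by
    have hu2 : u ^ 2 ≤ 1 := (sq_le_one_iff_abs_le_one u).2 hu
    have hv2 : v ^ 2 ≤ 1 := (sq_le_one_iff_abs_le_one v).2 hv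
    have : ε * ((s * u) ^ 2 + (s * v) ^ 2) = ε * s ^ 2 * (u ^ 2 + v ^ 2) := by ring
    rw [this]
    have h5 : ε * s ^ 2 * (u ^ 2 + v ^ 2) ≤ ε * s ^ 2 * 2 :=
      mul_le_mul_of_nonneg_left (by linarith) (by positivity)
    linarith
  norm_num at hmv
  have h5 : |Q * s ^ 2 / 2| ≤ 6 * ε * s ^ 2 := by
    have := abs_sub_abs_le_abs_sub (Q * s ^ 2 / 2) (G (s * u) (s * v))
    rw [abs_sub_comm] at this
    nlinarith
  rw [abs_div, abs_mul, abs_of_pos (pow_pos hs 2), abs_of_pos (zero_lt_two' ℝ),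
    div_le_iff₀ (zero_lt_two' ℝ)] at h5
  refine le_of_mul_le_mul_right ?_ (pow_pos hs 2)
  linarith

section

variable {q n : ℕ} {E₀ : ℝ} {H₀ : ℝ → ℝ → ℝ} {H F : ℝ → ℝ → ℝ → ℝ} {Hc Fc : ℕ → ℝ → ℝ → ℝ}

/-- The second derivatives of the limiting Hamiltonian at the equilibrium. -/
theorem Setting.hessian (hS : Setting q E₀ H₀ H F Hc Fc) :
    pdx (pdx H₀) 0 0 = 1 ∧ pdy (pdx H₀) 0 0 = 0 ∧ pdx (pdy H₀) 0 0 = 0 ∧ pdy (pdy H₀) 0 0 = 1 := by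
  have hP : Smooth2 (fun x y => (x ^ 2 + y ^ 2) / 2) := by
    unfold Smooth2; fun_prop
  have hG : Smooth2 (fun x y => H₀ x y - (x ^ 2 + y ^ 2) / 2) := hS.smooth_H₀.sub hP
  have hPx : ∀ x y, pdx (fun x y => (x ^ 2 + y ^ 2) / 2) x y = x := fun x y => by
    refine HasDerivAt.deriv ?_
    exact (((hasDerivAt_pow 2 x).add_const (y ^ 2)).div_const 2).congr_deriv (by simp)
  have hPy : ∀ x y, pdy (fun x y => (x ^ 2 + y ^ 2) / 2) x y = y := fun x y => by
    refine HasDerivAt.deriv ?_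
    exact (((hasDerivAt_pow 2 y).const_add (x ^ 2)).div_const 2).congr_deriv (by simp)
  have hGx : pdx (fun x y => H₀ x y - (x ^ 2 + y ^ 2) / 2) = fun x y => pdx H₀ x y - x := by
    ext x y; rw [pdx_sub hS.smooth_H₀ hP, hPx]
  have hGy : pdy (fun x y => H₀ x y - (x ^ 2 + y ^ 2) / 2) = fun x y => pdy H₀ x y - y := by
    ext x y; rw [pdy_sub hS.smooth_H₀ hP, hPy]
  have key := hG.hessian_quadratic_eq_zero (by simp [value_zero hS.H₀_near_zero])
    (by rw [hGx]; simp [hS.pdx_H₀_zero.1]) (by rw [hGy]; simp [hS.pdx_H₀_zero.2])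
    (fun ε hε => exists_near_quadratic hS.H₀_near_zero hε)
  have hsymm := hG.pdy_pdx 0 0
  rw [hGx, hGy] at key hsymm
  have e1 : pdx (fun x y => pdx H₀ x y - x) 0 0 = pdx (pdx H₀) 0 0 - 1 :=
    ((hS.smooth_H₀.pdx.hasDerivAt_fst 0 0).sub (hasDerivAt_id 0)).deriv
  have e2 : pdy (fun x y => pdx H₀ x y - x) 0 0 = pdy (pdx H₀) 0 0 :=
    ((hS.smooth_H₀.pdx.hasDerivAt_snd 0 0).sub_const 0).deriv
  have e3 : pdx (fun x y => pdy H₀ x y - y) 0 0 = pdx (pdy H₀) 0 0 :=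
    ((hS.smooth_H₀.pdy.hasDerivAt_fst 0 0).sub_const 0).deriv
  have e4 : pdy (fun x y => pdy H₀ x y - y) 0 0 = pdy (pdy H₀) 0 0 - 1 :=
    ((hS.smooth_H₀.pdy.hasDerivAt_snd 0 0).sub (hasDerivAt_id 0)).deriv
  rw [e1, e2, e3, e4] at key
  rw [e2, e3] at hsymm
  -- Three directions determine the quadratic form; `hsymm` then separates the mixed derivatives.
  have k1 := key 1 0 (by norm_num) (by norm_num)
  have k2 := key 0 1 (by norm_num) (by norm_num)
  have k3 := key 1 1 (by norm_num) (by norm_num)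
  refine ⟨?_, ?_, ?_, ?_⟩ <;> linarith

theorem Setting.exists_grad_expansion (hS : Setting q E₀ H₀ H F Hc Fc) {ε : ℝ} (hε : 0 < ε) :
    ∃ ρ, 0 < ρ ∧ ∀ x y, |x| ≤ ρ → |y| ≤ ρ →
      |pdx H₀ x y - x| ≤ ε * (|x| + |y|) ∧ |pdy H₀ x y - y| ≤ ε * (|x| + |y|) := by
  obtain ⟨ρ₁, hρ₁, h₁⟩ := hS.smooth_H₀.pdx.exists_expansion hS.pdx_H₀_zero.1 ε hε
  obtain ⟨ρ₂, hρ₂, h₂⟩ := hS.smooth_H₀.pdy.exists_expansion hS.pdx_H₀_zero.2 ε hε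
  obtain ⟨a1, a2, a3, a4⟩ := hS.hessian
  refine ⟨min ρ₁ ρ₂, by positivity, fun x y hx hy => ⟨?_, ?_⟩⟩
  · have := h₁ x y (hx.trans (min_le_left _ _)) (hy.trans (min_le_left _ _))
    rwa [a1, a2, one_mul, zero_mul, add_zero] at this
  · have := h₂ x y (hx.trans (min_le_right _ _)) (hy.trans (min_le_right _ _))
    rwa [a3, a4, one_mul, zero_mul, zero_add] at this

/-- Up to a quadratic coboundary of the linear oscillator, `f ∂_y H₀` is a multiple of
`x² + y²` to leading order. -/
theorem Setting.exists_normal_form (hS : Setting q E₀ H₀ H F Hc Fc) {f : ℝ → ℝ → ℝ}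
    (hf : Smooth2 f) (hf0 : f 0 0 = 0) {ε : ℝ} (hε : 0 < ε) :
    ∃ ρ, 0 < ρ ∧ ∀ x y, |x| ≤ ρ → |y| ≤ ρ →
      |f x y * pdy H₀ x y + ((-(pdy f 0 0 / 2) * y - pdx f 0 0 * x) * pdy H₀ x y +
          (-(pdy f 0 0 / 2) * x) * -pdx H₀ x y) - pdy f 0 0 / 2 * (x ^ 2 + y ^ 2)|
        ≤ ε * (x ^ 2 + y ^ 2) := by
  set α := pdx f 0 0
  set γ := pdy f 0 0
  set M := |α| + |γ| with hM
  have hM0 : 0 ≤ M := by positivity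
  -- η ≤ 1 keeps |∂_y H₀| ≤ 2s with s = |x| + |y|. The errors sum to at most (2 + 3M) η s², and s² ≤
  -- 2(x² + y²).
  set η := min 1 (ε / (2 * (2 + 3 * M))) with hη
  have hη0 : 0 < η := by positivity
  have hη1 : η ≤ 1 := min_le_left _ _
  have hη2 : 2 * (2 + 3 * M) * η ≤ ε := by
    have := min_le_right 1 (ε / (2 * (2 + 3 * M)))
    rw [← hη, le_div_iff₀ (by positivity)] at this
    linarith
  obtain ⟨ρ₁, hρ₁, h₁⟩ := hS.exists_grad_expansion hη0
  obtain ⟨ρ₂, hρ₂, h₂⟩ := hf.exists_expansion hf0 η hη0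
  refine ⟨min ρ₁ ρ₂, by positivity, fun x y hx hy => ?_⟩
  obtain ⟨ha, hb⟩ := h₁ x y (hx.trans (min_le_left _ _)) (hy.trans (min_le_left _ _))
  have hc := h₂ x y (hx.trans (min_le_right _ _)) (hy.trans (min_le_right _ _))
  change |f x y - (α * x + γ * y)| ≤ _ at hc
  set a := pdx H₀ x y - x
  set b := pdy H₀ x y - y
  set c := f x y - (α * x + γ * y)
  set s := |x| + |y| with hs
  have hs0 : 0 ≤ s := by positivity
  -- The correction is the derivative of -(γ/2)xy - (α/2)x² along the Hamiltonian flow. Its leading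
  -- part turns αxy + γy² into (γ/2)(x² + y²), so only terms containing a Taylor error a, b or c
  -- remain.
  have e1 : f x y * pdy H₀ x y + ((-(γ / 2) * y - α * x) * pdy H₀ x y +
      (-(γ / 2) * x) * -pdx H₀ x y) - γ / 2 * (x ^ 2 + y ^ 2) =
      c * (y + b) + (γ / 2 * y) * b + (γ / 2 * x) * a := by
    simp only [a, b, c]; ring
  rw [e1]
  have hy1 : |y + b| ≤ 2 * s := by
    have : η * s ≤ 1 * s := mul_le_mul_of_nonneg_right hη1 hs0
    linarith [abs_add_le y b, abs_nonneg x]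
  have lin : ∀ z, |z| ≤ s → |γ / 2 * z| ≤ M * s := fun z hz => by
    rw [abs_mul, abs_div, abs_of_pos (zero_lt_two' ℝ)]
    exact mul_le_mul (by linarith [abs_nonneg α, abs_nonneg γ]) hz (abs_nonneg _) hM0
  have t1 : |c * (y + b)| ≤ 2 * η * (s * s) := by
    rw [abs_mul]
    calc _ ≤ (η * s) * (2 * s) := mul_le_mul hc hy1 (abs_nonneg _) (by positivity)
      _ = _ := by ring
  have t2 : |(γ / 2 * y) * b| ≤ M * η * (s * s) := by
    rw [abs_mul]
    calc _ ≤ (M * s) * (η * s) := mul_le_mul (lin y (by linarith [abs_nonneg x])) hb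
          (abs_nonneg _) (by positivity)
      _ = _ := by ring
  have t3 : |(γ / 2 * x) * a| ≤ M * η * (s * s) := by
    rw [abs_mul]
    calc _ ≤ (M * s) * (η * s) := mul_le_mul (lin x (by linarith [abs_nonneg y])) ha
          (abs_nonneg _) (by positivity)
      _ = _ := by ring
  have t4 : (2 + 3 * M) * η * (s * s) ≤ (2 + 3 * M) * η * (2 * (x ^ 2 + y ^ 2)) :=
    mul_le_mul_of_nonneg_left (add_abs_sq_le x y) (by positivity)
  have t5 : 2 * (2 + 3 * M) * η * (x ^ 2 + y ^ 2) ≤ ε * (x ^ 2 + y ^ 2) :=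
    mul_le_mul_of_nonneg_right hη2 (by positivity)
  have t6 : 0 ≤ M * η * (s * s) := by positivity
  linarith [abs_add_le (c * (y + b) + (γ / 2 * y) * b) ((γ / 2 * x) * a),
    abs_add_le (c * (y + b)) ((γ / 2 * y) * b)]

/-- Sublevel sets of small energy are small. -/
theorem Setting.exists_small_sublevel (hS : Setting q E₀ H₀ H F Hc Fc) {ρ : ℝ} (hρ : 0 < ρ) :
    ∃ E, 0 < E ∧ E < E₀ ∧ ∀ x y, H₀ x y ≤ E → |x| < ρ ∧ |y| < ρ := by
  obtain ⟨R, hR, hb⟩ := exists_sublevel_bound hS.smooth_H₀ hS.H₀_near_zero hS.closed_levels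
    hS.E₀_pos
  have hE₀ := hS.E₀_pos
  -- H₀ has a positive minimum on this compact set; half of it, capped by E₀, is a suitable energy.
  set K : Set (ℝ × ℝ) := square R ∩ {p | ρ ≤ ‖p‖} with hK
  have hKc : IsCompact K := (isCompact_square R).inter_right
    (isClosed_le continuous_const continuous_norm)
  have hfin : ∀ E, E ≤ E₀ → (∀ p ∈ K, E < H₀ p.1 p.2) → ∀ x y, H₀ x y ≤ E → |x| < ρ ∧ |y| < ρ := by
    intro E hE h x y hxy
    obtain ⟨h1, h2⟩ := hb x y (hxy.trans hE)
    have : ‖((x, y) : ℝ × ℝ)‖ < ρ := by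
      by_contra hcon
      have := h (x, y) ⟨mem_square.2 ⟨h1.le, h2.le⟩, not_lt.1 hcon⟩
      linarith
    rw [norm_eq_max_abs] at this
    exact max_lt_iff.1 this
  rcases K.eq_empty_or_nonempty with he | hne
  · refine ⟨E₀ / 2, by linarith, by linarith, hfin _ (by linarith) ?_⟩
    rw [he]; simp
  · obtain ⟨p, hp, hmin⟩ := hKc.exists_isMinOn hne hS.smooth_H₀.continuous.continuousOn
    have hp0 : 0 < H₀ p.1 p.2 := by
      refine value_pos hS.smooth_H₀ hS.H₀_near_zero hS.closed_levels hE₀ fun h => ?_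
      have h' : p = 0 := h
      have h2 : ρ ≤ ‖p‖ := hp.2
      rw [h', norm_zero] at h2
      linarith
    refine ⟨min (H₀ p.1 p.2) E₀ / 2, by positivity, ?_, hfin _ ?_ ?_⟩
    · linarith [min_le_right (H₀ p.1 p.2) E₀]
    · linarith [min_le_right (H₀ p.1 p.2) E₀]
    · intro z hz
      have : H₀ p.1 p.2 ≤ H₀ z.1 z.2 := hmin hz
      linarith [min_le_left (H₀ p.1 p.2) E₀]

/-- A function whose product with `∂_y H₀` averages to zero over the level lines has no linear
term in `y`. -/
theorem Setting.pdy_eq_zero_of_zeroAverage (hS : Setting q E₀ H₀ H F Hc Fc) {f : ℝ → ℝ → ℝ}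
    (hf : Smooth2 f) (hf0 : f 0 0 = 0)
    (hav : ∀ E, 0 < E → E < E₀ → ZeroAverage H₀ (fun x y => f x y * pdy H₀ x y) E) :
    pdy f 0 0 = 0 := by
  by_contra hγ
  obtain ⟨ρ, hρ, h⟩ := hS.exists_normal_form hf hf0 (ε := |pdy f 0 0| / 4)
    (by have := abs_pos.2 hγ; positivity)
  set α := pdx f 0 0
  set γ := pdy f 0 0 with hγd
  obtain ⟨E, hE, hE', hsub⟩ := hS.exists_small_sublevel hρ
  obtain ⟨T, x, y, hor⟩ := hS.closed_levels E hE hE'.le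
  have hlev : ∀ s, H₀ (x s) (y s) = E := fun s => by
    have : (x s, y s) ∈ {p : ℝ × ℝ | H₀ p.1 p.2 = E} := hor.range_eq ▸ ⟨s, rfl⟩
    exact this
  have hcx : Continuous x := continuous_fst.comp hor.continuous
  have hcy : Continuous y := continuous_snd.comp hor.continuous
  have hc : ∀ {g : ℝ → ℝ → ℝ}, Smooth2 g → Continuous (fun s => g (x s) (y s)) := fun hg =>
    hg.continuous.comp hor.continuous
  have cf := hc hf
  have cx := hc hS.smooth_H₀.pdx
  have cy := hc hS.smooth_H₀.pdy
  have cfy : Continuous (fun s => f (x s) (y s) * pdy H₀ (x s) (y s)) := cf.mul cy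
  have hder : ∀ s, HasDerivAt (fun s => -(γ / 2) * (x s * y s) - α / 2 * (x s) ^ 2)
      ((-(γ / 2) * y s - α * x s) * pdy H₀ (x s) (y s) +
        (-(γ / 2) * x s) * -pdx H₀ (x s) (y s)) s := by
    intro s
    refine ((((hor.deriv_x s).mul (hor.deriv_y s)).const_mul (-(γ / 2))).sub
      (((hor.deriv_x s).pow 2).const_mul (α / 2))).congr_deriv ?_
    push_cast; ring
  -- The correction is an exact derivative along the orbit, so it integrates to zero over a period.
  have hint : ∫ s in (0 : ℝ)..T, ((-(γ / 2) * y s - α * x s) * pdy H₀ (x s) (y s) +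
        (-(γ / 2) * x s) * -pdx H₀ (x s) (y s)) = 0 := by
    rw [intervalIntegral.integral_eq_sub_of_hasDerivAt (fun s _ => hder s)
      (Continuous.intervalIntegrable (by fun_prop) _ _)]
    have h1 := hor.periodic_x 0
    have h2 := hor.periodic_y 0
    rw [zero_add] at h1 h2
    rw [h1, h2, sub_self]
  have hint2 : ∫ s in (0 : ℝ)..T, f (x s) (y s) * pdy H₀ (x s) (y s) = 0 :=
    hav E hE hE' T x y hor
  -- The factor γ handles both signs at once: with the error |γ|/4 the integrand is at least
  -- (γ²/4)(x² + y²).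
  have hpos : 0 < ∫ s in (0 : ℝ)..T, γ * (f (x s) (y s) * pdy H₀ (x s) (y s) +
      ((-(γ / 2) * y s - α * x s) * pdy H₀ (x s) (y s) +
        (-(γ / 2) * x s) * -pdx H₀ (x s) (y s))) := by
    refine intervalIntegral.intervalIntegral_pos_of_pos_on
      (Continuous.intervalIntegrable (continuous_const.mul (cfy.add (by fun_prop))) _ _)
      (fun s _ => ?_) hor.period_pos
    obtain ⟨h1, h2⟩ := hsub (x s) (y s) (hlev s).le
    have hb := h (x s) (y s) h1.le h2.le
    have hr : 0 < x s ^ 2 + y s ^ 2 := by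
      rcases eq_or_ne (x s) 0 with h0 | h0
      · rcases eq_or_ne (y s) 0 with h0' | h0'
        · have := hlev s
          rw [h0, h0', value_zero hS.H₀_near_zero] at this
          linarith
        · positivity
      · positivity
    set Z := f (x s) (y s) * pdy H₀ (x s) (y s) +
      ((-(γ / 2) * y s - α * x s) * pdy H₀ (x s) (y s) +
        (-(γ / 2) * x s) * -pdx H₀ (x s) (y s))
    set r := x s ^ 2 + y s ^ 2
    have e1 : γ * Z = γ * (Z - γ / 2 * r) + γ ^ 2 / 2 * r := by ring
    have e2 : |γ * (Z - γ / 2 * r)| ≤ γ ^ 2 / 4 * r := by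
      rw [abs_mul, ← sq_abs γ]
      calc _ ≤ |γ| * (|γ| / 4 * r) := mul_le_mul_of_nonneg_left hb (abs_nonneg _)
        _ = _ := by ring
    have e3 : 0 < γ ^ 2 * r := by positivity
    rw [e1]
    linarith [neg_abs_le (γ * (Z - γ / 2 * r))]
  rw [intervalIntegral.integral_const_mul, intervalIntegral.integral_add
    (cfy.intervalIntegrable _ _)
    (Continuous.intervalIntegrable (by fun_prop) _ _), hint, hint2] at hpos
  simp at hpos

/-- The coefficient of `y` in the leading perturbation is the parameter `lam`. -/
theorem Setting.pdy_Fc_eq (hS : Setting q E₀ H₀ H F Hc Fc) (hn : 1 ≤ n) (hq : 1 ≤ q)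
    {lam mu : ℝ} {Fhat : ℝ → ℝ → ℝ}
    (hF_n : ∀ x y, Fc n x y = pdy H₀ x y * (lam - mu * H₀ x y) + Fhat x y)
    (hFhat : ∀ E, 0 < E → E < E₀ → ZeroAverage H₀ (fun x y => Fhat x y * pdy H₀ x y) E) :
    pdy (Fc n) 0 0 = lam := by
  have hA : Smooth2 (fun x y => pdy H₀ x y * (lam - mu * H₀ x y)) :=
    hS.smooth_H₀.pdy.mul (Smooth2.sub (A := fun _ _ => lam) contDiff_const
      (hS.smooth_H₀.const_mul mu))
  have hFe : Fhat = fun x y => Fc n x y - pdy H₀ x y * (lam - mu * H₀ x y) := by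
    ext x y; rw [hF_n]; ring
  have hFs : Smooth2 Fhat := by
    rw [hFe]; exact (hS.smooth_Fc n hn).sub hA
  have h0 : Fhat 0 0 = 0 := by
    rw [hFe]; simp [hS.Fc_zero hq n hn, hS.pdx_H₀_zero.2]
  have h1 := hS.pdy_eq_zero_of_zeroAverage hFs h0 hFhat
  rw [hFe, pdy_sub (hS.smooth_Fc n hn) hA] at h1
  have h2 : pdy (fun x y => pdy H₀ x y * (lam - mu * H₀ x y)) 0 0 = lam := by
    refine HasDerivAt.deriv ?_
    refine ((hS.smooth_H₀.pdy.hasDerivAt_snd 0 0).mul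
      (((hS.smooth_H₀.hasDerivAt_snd 0 0).const_mul mu).const_sub lam)).congr_deriv ?_
    rw [hS.hessian.2.2.2, hS.pdx_H₀_zero.2, value_zero hS.H₀_near_zero]
    ring
  linarith

end

end

/-! ### Global existence and dependence on initial data -/

section

/-- If a continuous function reaches the level `R`, there is a first time when it does. -/
theorem exists_first_exit {φ : ℝ → ℝ} {a b R : ℝ} (hab : a ≤ b) (hφ : ContinuousOn φ (Set.Icc a b))
    (ha : φ a < R) (hb : R ≤ φ b) :
    ∃ t ∈ Set.Icc a b, φ t = R ∧ ∀ s ∈ Set.Icc a t, φ s ≤ R := by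
  have hc : IsCompact (Set.Icc a b ∩ φ ⁻¹' Set.Ici R) :=
    isCompact_Icc.of_isClosed_subset (hφ.preimage_isClosed_of_isClosed isClosed_Icc isClosed_Ici)
      Set.inter_subset_left
  obtain ⟨t, ht, hmin⟩ := hc.exists_isLeast ⟨b, ⟨hab, le_rfl⟩, hb⟩
  have hle : ∀ s ∈ Set.Icc a t, s < t → φ s < R := fun s hs hst => by
    by_contra hcon
    exact absurd (hmin ⟨⟨hs.1, hs.2.trans ht.1.2⟩, not_lt.1 hcon⟩) (not_le.2 hst)
  obtain ⟨s, hs, hsR⟩ := intermediate_value_Icc ht.1.1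
    (hφ.mono (Set.Icc_subset_Icc_right ht.1.2)) (show R ∈ _ from ⟨ha.le, ht.2⟩)
  have hst : s = t := le_antisymm hs.2 (hmin ⟨⟨hs.1, hs.2.trans ht.1.2⟩, hsR.ge⟩)
  have htR : φ t = R := hst ▸ hsR
  refine ⟨t, ht.1, htR, fun s hs => ?_⟩
  rcases hs.2.eq_or_lt with h | h
  · rw [h, htR]
  · exact (hle s hs h).le

/-- A bound L valid on the whole space permits the radius L(b - a) in Picard–Lindelöf, so the time
interval need not shrink. -/
theorem exists_hasDerivWithinAt_Icc {E : Type*} [NormedAddCommGroup E] [NormedSpace ℝ E]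
    [CompleteSpace E] {g : ℝ → E → E} {a b : ℝ} (hab : a ≤ b) {K L : NNReal}
    (hK : ∀ t ∈ Set.Icc a b, LipschitzWith K (g t))
    (hc : ∀ z, ContinuousOn (fun t => g t z) (Set.Icc a b))
    (hL : ∀ t ∈ Set.Icc a b, ∀ z, ‖g t z‖ ≤ L) (z₀ : E) :
    ∃ z : ℝ → E, z a = z₀ ∧ ∀ t ∈ Set.Icc a b, HasDerivWithinAt z (g t (z t)) (Set.Icc a b) t := by
  have hp : IsPicardLindelof g (⟨a, Set.left_mem_Icc.2 hab⟩ : Set.Icc a b) z₀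
      (L * Real.toNNReal (b - a)) 0 L K :=
    { lipschitzOnWith := fun t ht => (hK t ht).lipschitzOnWith
      continuousOn := fun z _ => hc z
      norm_le := fun t ht z _ => hL t ht z
      mul_max_le := by
        simp [Real.coe_toNNReal _ (sub_nonneg.2 hab), hab] }
  exact hp.exists_eq_forall_mem_Icc_hasDerivWithinAt₀

/-- Global forward existence for vector fields that are bounded and Lipschitz on compact time
intervals. -/
theorem exists_hasDerivWithinAt_Ici {E : Type*} [NormedAddCommGroup E] [NormedSpace ℝ E]
    [CompleteSpace E] {g : ℝ → E → E} {a : ℝ}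
    (hK : ∀ b, ∃ K : NNReal, ∀ t ∈ Set.Icc a b, LipschitzWith K (g t))
    (hc : ∀ z, ContinuousOn (fun t => g t z) (Set.Ici a))
    (hL : ∀ b, ∃ L : NNReal, ∀ t ∈ Set.Icc a b, ∀ z, ‖g t z‖ ≤ L) (z₀ : E) :
    ∃ z : ℝ → E, z a = z₀ ∧ ∀ t ∈ Set.Ici a, HasDerivWithinAt z (g t (z t)) (Set.Ici a) t := by
  have hex : ∀ N : ℕ, ∃ z : ℝ → E, z a = z₀ ∧
      ∀ t ∈ Set.Icc a (a + N), HasDerivWithinAt z (g t (z t)) (Set.Icc a (a + N)) t := by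
    intro N
    obtain ⟨K, hK'⟩ := hK (a + N)
    obtain ⟨L, hL'⟩ := hL (a + N)
    exact exists_hasDerivWithinAt_Icc (by simp) hK'
      (fun z => (hc z).mono Set.Icc_subset_Ici_self) hL' z₀
  choose α hα0 hα using hex
  have huniq : ∀ M N : ℕ, M ≤ N → ∀ t ∈ Set.Icc a (a + M), α M t = α N t := by
    intro M N hMN
    have hMN' : (M : ℝ) ≤ N := Nat.cast_le.2 hMN
    have hsub : Set.Icc a (a + M) ⊆ Set.Icc a (a + N) :=
      Set.Icc_subset_Icc_right (by linarith)
    obtain ⟨K, hK'⟩ := hK (a + M)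
    have hder : ∀ P : ℕ, M ≤ P → ∀ t ∈ Set.Ico a (a + (M : ℝ)),
        HasDerivWithinAt (α P) (g t (α P t)) (Set.Ici t) t := by
      intro P hP t ht
      have hP' : (M : ℝ) ≤ P := Nat.cast_le.2 hP
      have h1 := hα P t ⟨ht.1, by linarith [ht.2]⟩
      refine h1.mono_of_mem_nhdsWithin ?_
      exact Filter.mem_of_superset (Icc_mem_nhdsGE (show t < a + P by linarith [ht.2]))
        (Set.Icc_subset_Icc_left ht.1)
    have hEq := ODE_solution_unique_of_mem_Icc_right (v := g) (s := fun _ => Set.univ) (K := K)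
      (a := a) (b := a + M) (f := α M) (g := α N)
      (fun t ht => (hK' t ⟨ht.1, ht.2.le⟩).lipschitzOnWith)
      (fun t ht => (hα M t ht).continuousWithinAt)
      (hder M le_rfl) (fun _ _ => trivial)
      (fun t ht => ((hα N t (hsub ht)).continuousWithinAt).mono hsub)
      (hder N hMN) (fun _ _ => trivial) (by rw [hα0, hα0])
    exact hEq
  refine ⟨fun t => α (⌈t - a⌉₊ + 1) t, by simp [hα0], fun t ht => ?_⟩
  have ht' : a ≤ t := ht
  -- One more than the index used at t, so that the single solution `α M` agrees with the glued
  -- function on a neighbourhood of t in [a, ∞).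
  set M := ⌈t - a⌉₊ + 2 with hM
  have hle : t - a ≤ ⌈t - a⌉₊ := Nat.le_ceil _
  have htM : t < a + (M : ℝ) - 1 := by rw [hM]; push_cast; linarith
  have heq : ∀ s, a ≤ s → s ≤ a + M - 1 → α (⌈s - a⌉₊ + 1) s = α M s := by
    intro s hs hs'
    refine huniq _ _ ?_ s ⟨hs, ?_⟩
    · have : ⌈s - a⌉₊ ≤ M - 1 := by
        rw [Nat.ceil_le, Nat.cast_sub (by omega)]
        push_cast; linarith
      omega
    · have : s - a ≤ ⌈s - a⌉₊ := Nat.le_ceil _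
      push_cast; linarith
  have h1 := hα M t ⟨ht', by linarith⟩
  simp only [heq t ht' htM.le]
  have h2 : HasDerivWithinAt (α M) (g t (α M t)) (Set.Ici a) t := by
    refine h1.mono_of_mem_nhdsWithin ?_
    have : Set.Iio (a + (M : ℝ)) ∈ 𝓝 t := Iio_mem_nhds (by linarith)
    filter_upwards [mem_nhdsWithin_of_mem_nhds this, self_mem_nhdsWithin] with s hs hs'
    exact ⟨hs', le_of_lt hs⟩
  refine h2.congr_of_eventuallyEq ?_ (heq t ht' htM.le)
  have : Set.Iio (a + (M : ℝ) - 1) ∈ 𝓝 t := Iio_mem_nhds htM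
  filter_upwards [mem_nhdsWithin_of_mem_nhds this, self_mem_nhdsWithin] with s hs hs'
  exact heq s hs' (le_of_lt hs)

/-- The right-hand side of the system. -/
def vel (H F : ℝ → ℝ → ℝ → ℝ) (t : ℝ) (p : ℝ × ℝ) : ℝ × ℝ :=
  (pdy (H t) p.1 p.2, -pdx (H t) p.1 p.2 + F t p.1 p.2)

theorem isSolOn_iff {H F : ℝ → ℝ → ℝ → ℝ} {I : Set ℝ} {x y : ℝ → ℝ} :
    IsSolOn H F I x y ↔
      ∀ t ∈ I, HasDerivWithinAt (fun s => (x s, y s)) (vel H F t (x t, y t)) I t := by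
  constructor
  · intro h t ht
    exact (h t ht).1.prodMk (h t ht).2
  · intro h t ht
    exact ⟨(h t ht).fst, (h t ht).snd⟩

theorem SmoothForPosTime.contDiffOn_pdx {G : ℝ → ℝ → ℝ → ℝ} (h : SmoothForPosTime G) :
    ContDiffOn ℝ ∞ (fun p : ℝ × ℝ × ℝ => pdx (G p.1) p.2.1 p.2.2) {p | 0 < p.1} := by
  have ho : IsOpen {p : ℝ × ℝ × ℝ | 0 < p.1} := isOpen_lt continuous_const continuous_fst
  have h1 : ContDiffOn ℝ ∞ (fun p => fderiv ℝ (fun p : ℝ × ℝ × ℝ => G p.1 p.2.1 p.2.2) p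
      (0, 1, 0)) {p | 0 < p.1} :=
    (h.fderiv_of_isOpen ho (m := ∞) (by simp)).clm_apply contDiffOn_const
  refine h1.congr fun p hp => ?_
  have hd := ((h.contDiffAt (ho.mem_nhds hp)).differentiableAt (by simp)).hasFDerivAt
  have h2 : HasDerivAt (fun s : ℝ => (p.1, s, p.2.2)) ((0 : ℝ), (1 : ℝ), (0 : ℝ)) p.2.1 :=
    (hasDerivAt_const _ _).prodMk ((hasDerivAt_id _).prodMk (hasDerivAt_const _ _))
  exact (HasFDerivAt.comp_hasDerivAt (f := fun s : ℝ => (p.1, s, p.2.2)) p.2.1 hd h2).deriv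

theorem SmoothForPosTime.contDiffOn_pdy {G : ℝ → ℝ → ℝ → ℝ} (h : SmoothForPosTime G) :
    ContDiffOn ℝ ∞ (fun p : ℝ × ℝ × ℝ => pdy (G p.1) p.2.1 p.2.2) {p | 0 < p.1} := by
  have ho : IsOpen {p : ℝ × ℝ × ℝ | 0 < p.1} := isOpen_lt continuous_const continuous_fst
  have h1 : ContDiffOn ℝ ∞ (fun p => fderiv ℝ (fun p : ℝ × ℝ × ℝ => G p.1 p.2.1 p.2.2) p
      (0, 0, 1)) {p | 0 < p.1} :=
    (h.fderiv_of_isOpen ho (m := ∞) (by simp)).clm_apply contDiffOn_const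
  refine h1.congr fun p hp => ?_
  have hd := ((h.contDiffAt (ho.mem_nhds hp)).differentiableAt (by simp)).hasFDerivAt
  have h2 : HasDerivAt (fun s : ℝ => (p.1, p.2.1, s)) ((0 : ℝ), (0 : ℝ), (1 : ℝ)) p.2.2 :=
    (hasDerivAt_const _ _).prodMk ((hasDerivAt_const _ _).prodMk (hasDerivAt_id _))
  exact (HasFDerivAt.comp_hasDerivAt (f := fun s : ℝ => (p.1, p.2.1, s)) p.2.2 hd h2).deriv

theorem contDiffOn_vel {H F : ℝ → ℝ → ℝ → ℝ} (hH : SmoothForPosTime H)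
    (hF : SmoothForPosTime F) :
    ContDiffOn ℝ ∞ (fun p : ℝ × ℝ × ℝ => vel H F p.1 p.2) {p | 0 < p.1} :=
  hH.contDiffOn_pdy.prodMk (hH.contDiffOn_pdx.neg.add hF)

theorem exists_lipschitz_vel {H F : ℝ → ℝ → ℝ → ℝ} (hH : SmoothForPosTime H)
    (hF : SmoothForPosTime F) {a : ℝ} (ha : 0 < a) (b R : ℝ) :
    ∃ K : NNReal, ∀ t ∈ Set.Icc a b, LipschitzOnWith K (vel H F t) (square R) := by
  obtain ⟨K, hK⟩ := ((contDiffOn_vel hH hF).mono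
    (fun p (hp : p ∈ Set.Icc a b ×ˢ square R) => ha.trans_le hp.1.1)).exists_lipschitzOnWith
    (by simp) ((convex_Icc a b).prod (convex_square R)) (isCompact_Icc.prod (isCompact_square R))
  refine ⟨K, fun t ht => LipschitzOnWith.of_dist_le_mul fun p hp p' hp' => ?_⟩
  have := hK.dist_le_mul (t, p) ⟨ht, hp⟩ (t, p') ⟨ht, hp'⟩
  simpa [Prod.dist_eq] using this

/-- The retraction of the plane onto a square. -/
def clamp (R : ℝ) (p : ℝ × ℝ) : ℝ × ℝ := (max (-R) (min R p.1), max (-R) (min R p.2))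

theorem clamp_mem {R : ℝ} (hR : 0 ≤ R) (p : ℝ × ℝ) : clamp R p ∈ square R :=
  ⟨⟨le_max_left _ _, max_le (by linarith) (min_le_left _ _)⟩,
    ⟨le_max_left _ _, max_le (by linarith) (min_le_left _ _)⟩⟩

theorem clamp_eq {R : ℝ} {p : ℝ × ℝ} (hp : p ∈ square R) : clamp R p = p := by
  obtain ⟨h1, h2⟩ := hp
  unfold clamp
  rw [min_eq_right h1.2, max_eq_right h1.1, min_eq_right h2.2, max_eq_right h2.1]

theorem lipschitzWith_clamp (R : ℝ) : LipschitzWith 1 (clamp R) := by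
  have h1 : LipschitzWith 1 (fun p : ℝ × ℝ => max (-R) (min R p.1)) :=
    (LipschitzWith.prod_fst.const_min R).const_max (-R)
  have h2 : LipschitzWith 1 (fun p : ℝ × ℝ => max (-R) (min R p.2)) :=
    (LipschitzWith.prod_snd.const_min R).const_max (-R)
  have h := h1.prodMk h2
  rw [max_self] at h
  exact h

/-- Composition with the retraction makes the field bounded and globally Lipschitz on compact time
intervals, without changing it inside the square. -/
theorem exists_clamped_solution {H F : ℝ → ℝ → ℝ → ℝ} (hH : SmoothForPosTime H)
    (hF : SmoothForPosTime F) {a : ℝ} (ha : 0 < a) {R : ℝ} (hR : 0 ≤ R) (z₀ : ℝ × ℝ) :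
    ∃ z : ℝ → ℝ × ℝ, z a = z₀ ∧ ∀ t ∈ Set.Ici a,
      HasDerivWithinAt z (vel H F t (clamp R (z t))) (Set.Ici a) t := by
  have hv := (contDiffOn_vel hH hF).continuousOn
  refine exists_hasDerivWithinAt_Ici (g := fun t p => vel H F t (clamp R p)) ?_ ?_ ?_ z₀
  · intro b
    obtain ⟨K, hK⟩ := exists_lipschitz_vel hH hF ha b R
    refine ⟨K, fun t ht => ?_⟩
    have := (hK t ht).comp (lipschitzWith_clamp R).lipschitzOnWith
      (s := Set.univ) (fun p _ => clamp_mem hR p)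
    change LipschitzWith K (vel H F t ∘ clamp R)
    simpa [lipschitzOnWith_univ] using this
  · intro z
    exact hv.comp (f := fun t : ℝ => (t, clamp R z)) (by fun_prop)
      (fun t ht => ha.trans_le ht)
  · intro b
    obtain ⟨L, hL⟩ := (isCompact_Icc.prod (isCompact_square R)).exists_bound_of_continuousOn
      (hv.mono (fun p (hp : p ∈ Set.Icc a b ×ˢ square R) => ha.trans_le hp.1.1))
    exact ⟨Real.toNNReal L, fun t ht z => (hL (t, clamp R z) ⟨ht, clamp_mem hR z⟩).trans
      (Real.le_coe_toNNReal L)⟩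

/-- A solution which cannot leave a square exists for all times. -/
theorem exists_global_solution {H F : ℝ → ℝ → ℝ → ℝ} (hH : SmoothForPosTime H)
    (hF : SmoothForPosTime F) {a R x₀ y₀ : ℝ} (ha : 0 < a) (hx₀ : |x₀| < R) (hy₀ : |y₀| < R)
    (hap : ∀ b, a ≤ b → ∀ x y : ℝ → ℝ, IsSolOn H F (Set.Icc a b) x y → x a = x₀ → y a = y₀ →
      (∀ t ∈ Set.Icc a b, |x t| ≤ R ∧ |y t| ≤ R) → |x b| < R ∧ |y b| < R) :
    ∃ x y : ℝ → ℝ, IsSolOn H F (Set.Ici a) x y ∧ x a = x₀ ∧ y a = y₀ := by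
  have hR : 0 ≤ R := (abs_nonneg _).trans hx₀.le
  obtain ⟨z, hz0, hz⟩ := exists_clamped_solution hH hF ha hR (x₀, y₀)
  have hzc : ContinuousOn z (Set.Ici a) := fun t ht => (hz t ht).continuousWithinAt
  have hmem : ∀ t, a ≤ t → ‖z t‖ < R := by
    intro t ht
    by_contra hcon
    -- Up to the first exit the clamped solution is a genuine one, so the a priori bound `hap`
    -- applies to it and excludes the exit.
    obtain ⟨b, hb, hbR, hb'⟩ := exists_first_exit ht
      ((continuous_norm.comp_continuousOn hzc).mono Set.Icc_subset_Ici_self)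
      (show ‖z a‖ < R by rw [hz0, norm_eq_max_abs]; exact max_lt hx₀ hy₀) (not_lt.1 hcon)
    have hsq : ∀ s ∈ Set.Icc a b, |(z s).1| ≤ R ∧ |(z s).2| ≤ R := fun s hs => by
      have : ‖((z s).1, (z s).2)‖ ≤ R := hb' s hs
      rw [norm_eq_max_abs] at this
      exact max_le_iff.1 this
    have hsol : IsSolOn H F (Set.Icc a b) (fun s => (z s).1) (fun s => (z s).2) := by
      rw [isSolOn_iff]
      intro s hs
      have h1 := (hz s hs.1).mono (Set.Icc_subset_Ici_self : Set.Icc a b ⊆ Set.Ici a)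
      rwa [clamp_eq (mem_square'.2 (hsq s hs))] at h1
    have := hap b hb.1 _ _ hsol (by rw [hz0]) (by rw [hz0]) hsq
    have h2 : ‖((z b).1, (z b).2)‖ = R := hbR
    rw [norm_eq_max_abs] at h2
    exact absurd h2 (max_lt this.1 this.2).ne
  refine ⟨fun s => (z s).1, fun s => (z s).2, ?_, by simp only [hz0], by simp only [hz0]⟩
  rw [isSolOn_iff]
  intro s hs
  have h1 := hz s hs
  have : ‖((z s).1, (z s).2)‖ ≤ R := (hmem s hs).le
  rw [norm_eq_max_abs] at this
  rwa [clamp_eq (mem_square'.2 (max_le_iff.1 this))] at h1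

theorem IsSolOn.mono {H F : ℝ → ℝ → ℝ → ℝ} {I J : Set ℝ} {x y : ℝ → ℝ} (h : IsSolOn H F I x y)
    (hJ : J ⊆ I) : IsSolOn H F J x y :=
  fun t ht => ⟨(h t (hJ ht)).1.mono hJ, (h t (hJ ht)).2.mono hJ⟩

theorem IsSolOn.continuousOn {H F : ℝ → ℝ → ℝ → ℝ} {I : Set ℝ} {x y : ℝ → ℝ}
    (h : IsSolOn H F I x y) : ContinuousOn x I ∧ ContinuousOn y I :=
  ⟨fun t ht => (h t ht).1.continuousWithinAt, fun t ht => (h t ht).2.continuousWithinAt⟩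

theorem IsSolOn.hasDerivWithinAt_Ici {H F : ℝ → ℝ → ℝ → ℝ} {a b : ℝ} {x y : ℝ → ℝ}
    (h : IsSolOn H F (Set.Icc a b) x y) {t : ℝ} (ht : t ∈ Set.Ico a b) :
    HasDerivWithinAt (fun s => (x s, y s)) (vel H F t (x t, y t)) (Set.Ici t) t := by
  refine (isSolOn_iff.1 h t ⟨ht.1, ht.2.le⟩).mono_of_mem_nhdsWithin ?_
  exact Filter.mem_of_superset (Icc_mem_nhdsGE ht.2) (Set.Icc_subset_Icc_left ht.1)

theorem IsSolOn.hasDerivWithinAt_Iic {H F : ℝ → ℝ → ℝ → ℝ} {a b : ℝ} {x y : ℝ → ℝ}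
    (h : IsSolOn H F (Set.Icc a b) x y) {t : ℝ} (ht : t ∈ Set.Ioc a b) :
    HasDerivWithinAt (fun s => (x s, y s)) (vel H F t (x t, y t)) (Set.Iic t) t := by
  refine (isSolOn_iff.1 h t ⟨ht.1.le, ht.2⟩).mono_of_mem_nhdsWithin ?_
  exact Filter.mem_of_superset (Icc_mem_nhdsLE ht.1) (Set.Icc_subset_Icc_right ht.2)

section

variable {q n : ℕ} {E₀ : ℝ} {H₀ : ℝ → ℝ → ℝ} {H F : ℝ → ℝ → ℝ → ℝ} {Hc Fc : ℕ → ℝ → ℝ → ℝ}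

theorem Setting.vel_zero (hS : Setting q E₀ H₀ H F Hc Fc) {t : ℝ} (ht : 0 < t) :
    vel H F t 0 = 0 := by
  simp [vel, hS.pdx_H_zero t ht, hS.pdy_H_zero t ht, hS.F_zero t ht]

/-- Over bounded times, solutions in a square grow at most by a bounded factor. -/
theorem Setting.exists_growth_bound (hS : Setting q E₀ H₀ H F Hc Fc) {a : ℝ} (ha : 0 < a)
    (b R : ℝ) (hR : 0 ≤ R) : ∃ M, 1 ≤ M ∧ ∀ c, c ≤ b → ∀ x y : ℝ → ℝ,
      IsSolOn H F (Set.Icc a c) x y → (∀ t ∈ Set.Icc a c, |x t| ≤ R ∧ |y t| ≤ R) →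
      ∀ t ∈ Set.Icc a c, ‖(x t, y t)‖ ≤ M * ‖(x a, y a)‖ := by
  obtain ⟨K, hK⟩ := exists_lipschitz_vel hS.smooth_H hS.smooth_F ha b R
  refine ⟨Real.exp (K * |b - a|), Real.one_le_exp (by positivity), ?_⟩
  intro c hcb x y hsol hsq t ht
  -- The field vanishes at the origin, so its Lipschitz constant bounds it linearly. The constant
  -- depends on b only, not on c.
  have h1 := norm_le_gronwallBound_of_norm_deriv_right_le (f := fun s => (x s, y s))
    (K := K) (ε := 0) (δ := ‖(x a, y a)‖) (a := a) (b := c)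
    (fun s hs => (isSolOn_iff.1 hsol s hs).continuousWithinAt)
    (fun s hs => hsol.hasDerivWithinAt_Ici hs) le_rfl (fun s hs => by
      have h := (hK s ⟨hs.1, hs.2.le.trans hcb⟩).dist_le_mul (x s, y s)
        (mem_square.2 (hsq s ⟨hs.1, hs.2.le⟩)) 0 (mem_square.2 (by simpa using hR))
      rw [hS.vel_zero (ha.trans_le hs.1), dist_zero_right, dist_zero_right] at h
      rwa [add_zero]) t ht
  rw [gronwallBound_ε0, mul_comm] at h1
  refine h1.trans (mul_le_mul_of_nonneg_right (Real.exp_le_exp.2 ?_) (norm_nonneg _))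
  refine mul_le_mul_of_nonneg_left ?_ K.2
  exact (by linarith [ht.2] : t - a ≤ b - a).trans (le_abs_self _)

/-- A solution that is at the origin at some time has always been there. -/
theorem Setting.eq_zero_of_eq_zero (hS : Setting q E₀ H₀ H F Hc Fc) {a b : ℝ} (ha : 0 < a)
    (hab : a ≤ b) {R : ℝ} (hR : 0 ≤ R) {x y : ℝ → ℝ} (hsol : IsSolOn H F (Set.Icc a b) x y)
    (hsq : ∀ t ∈ Set.Icc a b, |x t| ≤ R ∧ |y t| ≤ R) (hb : (x b, y b) = 0) : (x a, y a) = 0 := by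
  obtain ⟨K, hK⟩ := exists_lipschitz_vel hS.smooth_H hS.smooth_F ha b R
  have := ODE_solution_unique_of_mem_Icc_left (v := vel H F) (s := fun _ => square R) (K := K)
    (a := a) (b := b) (f := fun s => (x s, y s)) (g := fun _ => 0)
    (fun t ht => hK t ⟨ht.1.le, ht.2⟩)
    (fun s hs => (isSolOn_iff.1 hsol s hs).continuousWithinAt)
    (fun s hs => hsol.hasDerivWithinAt_Iic hs)
    (fun s hs => mem_square.2 (hsq s ⟨hs.1.le, hs.2⟩)) continuousOn_const
    (fun s hs => by
      rw [hS.vel_zero (ha.trans hs.1)]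
      exact hasDerivWithinAt_const _ _ _)
    (fun s hs => mem_square.2 (by simpa using hR)) hb
  exact this ⟨le_rfl, hab⟩

end

end

/-! ### Lyapunov function: instability and asymptotic stability of the equilibrium -/

section

theorem rad_sq (x y : ℝ) : rad x y ^ 2 = x ^ 2 + y ^ 2 := Real.sq_sqrt (by positivity)

theorem rad_nonneg (x y : ℝ) : 0 ≤ rad x y := Real.sqrt_nonneg _

theorem rad_le_add_abs (x y : ℝ) : rad x y ≤ |x| + |y| := by
  rw [rad, Real.sqrt_le_left (by positivity)]
  nlinarith [sq_abs x, sq_abs y, abs_nonneg x, abs_nonneg y,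
    mul_nonneg (abs_nonneg x) (abs_nonneg y)]

theorem norm_le_rad (x y : ℝ) : ‖(x, y)‖ ≤ rad x y := by
  rw [norm_eq_max_abs]
  exact max_le (Real.abs_le_sqrt (by nlinarith [sq_nonneg y]))
    (Real.abs_le_sqrt (by nlinarith [sq_nonneg x]))

/-- The weight of the drift is not integrable at infinity, so the perturbation has unbounded
cumulative effect. -/
theorem inv_le_rpow_neg_div {q n : ℕ} (hnq : n ≤ q) (hq : 1 ≤ q) {t : ℝ} (ht : 1 ≤ t) :
    t⁻¹ ≤ t ^ (-(n : ℝ) / (q : ℝ)) := by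
  rw [← Real.rpow_neg_one]
  refine Real.rpow_le_rpow_of_exponent_le ht ?_
  have hq' : (0 : ℝ) < q := by exact_mod_cast hq
  rw [le_div_iff₀ hq']
  have : (n : ℝ) ≤ q := by exact_mod_cast hnq
  linarith

/-- Differentiating K + wW, with w = t^(-n/q), leaves five errors: the drift estimate, the term w'W,
the two deviations of the velocity v from the limiting field, and the normal form. Their constants
add up to (2 + 5M)ε. -/
theorem lyapunov_error_algebra {rate w f Ay Ax vx vy W w' Wx Wy lam ε s Q M : ℝ} (hw : 0 < w)
    (hε : 0 < ε) (hs : 0 ≤ s) (hsQ : s * s ≤ 2 * Q) (hM : 0 ≤ M)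
    (h1 : |rate - w * (Ay * f)| ≤ ε * w * Q) (h2 : |vx - Ay| ≤ ε * s) (h3 : |vy - -Ax| ≤ ε * s)
    (hW : |W| ≤ M * Q) (hw' : |w'| ≤ ε * w) (hWx : |Wx| ≤ M * s) (hWy : |Wy| ≤ M * s)
    (hn : |f * Ay + (Wx * Ay + Wy * -Ax) - lam / 2 * Q| ≤ ε * Q) :
    |rate + (w' * W + w * (Wx * vx + Wy * vy)) - w * (lam / 2) * Q| ≤ (2 + 5 * M) * ε * w * Q := by
  have e : rate + (w' * W + w * (Wx * vx + Wy * vy)) - w * (lam / 2) * Q =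
      (rate - w * (Ay * f)) + w' * W + w * (Wx * (vx - Ay)) + w * (Wy * (vy - -Ax)) +
        w * (f * Ay + (Wx * Ay + Wy * -Ax) - lam / 2 * Q) := by ring
  have t1 : |w' * W| ≤ M * ε * w * Q := by
    rw [abs_mul]
    calc _ ≤ (ε * w) * (M * Q) := mul_le_mul hw' hW (abs_nonneg _) (by positivity)
      _ = _ := by ring
  have t2 : |w * (Wx * (vx - Ay))| ≤ M * ε * w * (s * s) := by
    rw [abs_mul, abs_mul, abs_of_pos hw]
    calc _ ≤ w * ((M * s) * (ε * s)) := mul_le_mul_of_nonneg_left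
          (mul_le_mul hWx h2 (abs_nonneg _) (by positivity)) hw.le
      _ = _ := by ring
  have t3 : |w * (Wy * (vy - -Ax))| ≤ M * ε * w * (s * s) := by
    rw [abs_mul, abs_mul, abs_of_pos hw]
    calc _ ≤ w * ((M * s) * (ε * s)) := mul_le_mul_of_nonneg_left
          (mul_le_mul hWy h3 (abs_nonneg _) (by positivity)) hw.le
      _ = _ := by ring
  have t4 : |w * (f * Ay + (Wx * Ay + Wy * -Ax) - lam / 2 * Q)| ≤ w * (ε * Q) := by
    rw [abs_mul, abs_of_pos hw]
    exact mul_le_mul_of_nonneg_left hn hw.le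
  have t5 : M * ε * w * (s * s) ≤ M * ε * w * (2 * Q) :=
    mul_le_mul_of_nonneg_left hsQ (by positivity)
  rw [e]
  set A := rate - w * (Ay * f)
  set B := w' * W
  set C := w * (Wx * (vx - Ay))
  set D := w * (Wy * (vy - -Ax))
  set G := w * (f * Ay + (Wx * Ay + Wy * -Ax) - lam / 2 * Q)
  linarith [abs_add_le (A + B + C + D) G, abs_add_le (A + B + C) D, abs_add_le (A + B) C,
    abs_add_le A B]

section

variable {q n : ℕ} {E₀ : ℝ} {H₀ : ℝ → ℝ → ℝ} {H F : ℝ → ℝ → ℝ → ℝ} {Hc Fc : ℕ → ℝ → ℝ → ℝ}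

/-- A Lyapunov function near the equilibrium. -/
theorem Setting.exists_lyapunov (hS : Setting q E₀ H₀ H F Hc Fc) (hn : 1 ≤ n) (hnq : n ≤ q)
    (hF_lt : ∀ i, 1 ≤ i → i < n → ∀ x y, Fc i x y = 0) {lam : ℝ} (hlam : lam ≠ 0)
    (hγ : pdy (Fc n) 0 0 = lam) :
    ∃ (L : ℝ → ℝ → ℝ → ℝ) (ρ t₁ : ℝ), 0 < ρ ∧ 1 ≤ t₁ ∧
      (∀ t x y, t₁ ≤ t → |x| ≤ ρ → |y| ≤ ρ →
        (x ^ 2 + y ^ 2) / 4 ≤ L t x y ∧ L t x y ≤ x ^ 2 + y ^ 2) ∧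
      ∀ (I : Set ℝ) (x y : ℝ → ℝ), IsSolOn H F I x y → ∀ t ∈ I, t₁ ≤ t → |x t| ≤ ρ → |y t| ≤ ρ →
        ∃ D, HasDerivWithinAt (fun s => L s (x s) (y s)) D I t ∧
          |D - t ^ (-(n : ℝ) / (q : ℝ)) * (lam / 2) * (x t ^ 2 + y t ^ 2)| ≤
            |lam| / 4 * t ^ (-(n : ℝ) / (q : ℝ)) * (x t ^ 2 + y t ^ 2) := by
  have hq : 1 ≤ q := hn.trans hnq
  set α := pdx (Fc n) 0 0 with hα
  set M := |lam| + |α| with hM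
  have hM0 : 0 ≤ M := by positivity
  have hl0 : 0 < |lam| := abs_pos.2 hlam
  -- Chosen so that the total error is |λ|/4, half of the main coefficient.
  set ε := |lam| / (4 * (2 + 5 * M)) with hε
  have hε0 : 0 < ε := by positivity
  have hεM : (2 + 5 * M) * ε = |lam| / 4 := by rw [hε]; field_simp
  obtain ⟨ρ₁, hρ₁, hnf⟩ := hS.exists_normal_form (hS.smooth_Fc n hn) (hS.Fc_zero hq n hn) hε0
  -- L differs from r²/2 by three errors of r²/16 each, which keeps it between r²/4 and r².
  obtain ⟨ρ₂, hρ₂, hnq2⟩ := exists_near_quadratic hS.H₀_near_zero (ε := 1 / 16) (by norm_num)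
  obtain ⟨τ₁, hτ₁, hest⟩ := hS.exists_estimates hn hnq hF_lt ρ₁ hε0
  obtain ⟨τ₂, hτ₂, hest2⟩ := hS.exists_estimates hn hnq hF_lt ρ₂ (ε := 1 / 16) (by norm_num)
  obtain ⟨τ₃, hτ₃, hsm⟩ := exists_eventually_small hq (C := M) (ε := 1 / 16) (by norm_num)
  rw [hγ] at hnf
  set W : ℝ → ℝ → ℝ := fun x y => -(lam / 2) * (x * y) - α / 2 * x ^ 2 with hW
  have hWb : ∀ x y, |W x y| ≤ M * (x ^ 2 + y ^ 2) := by
    intro x y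
    have h1 : |x * y| ≤ x ^ 2 + y ^ 2 := by
      rw [abs_le]; constructor <;> nlinarith [sq_nonneg (x + y), sq_nonneg (x - y)]
    have h2 : |-(lam / 2) * (x * y)| ≤ |lam| * (x ^ 2 + y ^ 2) := by
      rw [abs_mul, abs_neg, abs_div, abs_of_pos (zero_lt_two' ℝ)]
      exact mul_le_mul (by linarith) h1 (abs_nonneg _) hl0.le
    have h3 : |α / 2 * x ^ 2| ≤ |α| * (x ^ 2 + y ^ 2) := by
      rw [abs_mul, abs_div, abs_of_pos (zero_lt_two' ℝ), abs_of_nonneg (sq_nonneg x)]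
      exact mul_le_mul (by linarith [abs_nonneg α]) (by nlinarith [sq_nonneg y]) (sq_nonneg x)
        (abs_nonneg α)
    have := abs_sub (-(lam / 2) * (x * y)) (α / 2 * x ^ 2)
    rw [hM, add_mul]
    exact this.trans (add_le_add h2 h3)
  refine ⟨fun t x y => slowVar q n H₀ Hc t x y + t ^ (-(n : ℝ) / (q : ℝ)) * W x y,
    min ρ₁ ρ₂, max (max τ₁ τ₂) (max τ₃ (1 / ε)), by positivity,
    hτ₁.trans ((le_max_left _ _).trans (le_max_left _ _)), ?_, ?_⟩
  · intro t x y ht hx hy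
    have ht2 : τ₂ ≤ t := (le_max_right _ _).trans ((le_max_left _ _).trans ht)
    have ht3 : τ₃ ≤ t := (le_max_left _ _).trans ((le_max_right _ _).trans ht)
    have ht0 : 0 < t := by linarith
    have hx2 := hx.trans (min_le_right ρ₁ ρ₂)
    have hy2 := hy.trans (min_le_right ρ₁ ρ₂)
    have a1 := (hest2 t ht2 x y hx2 hy2).2.2.1
    have a2 := hnq2 x y hx2 hy2
    have he0 : 0 < t ^ (-1 / (q : ℝ)) := Real.rpow_pos_of_pos ht0 _
    have he1 : t ^ (-1 / (q : ℝ)) ≤ 1 := Real.rpow_le_one_of_one_le_of_nonpos (by linarith)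
      (by rw [neg_div]; exact neg_nonpos.2 (by positivity))
    have hwe : t ^ (-(n : ℝ) / (q : ℝ)) ≤ t ^ (-1 / (q : ℝ)) := by
      rw [rpow_neg_div_eq_pow ht0]
      exact pow_le_of_le_one he0.le he1 (by omega)
    have hw0 : 0 < t ^ (-(n : ℝ) / (q : ℝ)) := Real.rpow_pos_of_pos ht0 _
    have a3 : |t ^ (-(n : ℝ) / (q : ℝ)) * W x y| ≤ 1 / 16 * (x ^ 2 + y ^ 2) := by
      rw [abs_mul, abs_of_pos hw0]
      calc _ ≤ t ^ (-1 / (q : ℝ)) * (M * (x ^ 2 + y ^ 2)) :=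
            mul_le_mul hwe (hWb x y) (abs_nonneg _) he0.le
        _ = (M * t ^ (-1 / (q : ℝ))) * (x ^ 2 + y ^ 2) := by ring
        _ ≤ _ := mul_le_mul_of_nonneg_right (hsm t ht3) (by positivity)
    have hQ : 0 ≤ x ^ 2 + y ^ 2 := by positivity
    rw [abs_le] at a1 a2 a3
    constructor <;> linarith [a1.1, a1.2, a2.1, a2.2, a3.1, a3.2]
  · intro I x y hsol t ht htt hx hy
    have ht1 : τ₁ ≤ t := (le_max_left _ _).trans ((le_max_left _ _).trans htt)
    have ht4 : 1 / ε ≤ t := (le_max_right _ _).trans ((le_max_right _ _).trans htt)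
    have ht0 : 0 < t := by linarith
    have hx1 := hx.trans (min_le_left ρ₁ ρ₂)
    have hy1 := hy.trans (min_le_left ρ₁ ρ₂)
    obtain ⟨b1, b2, -, b4⟩ := hest t ht1 (x t) (y t) hx1 hy1
    have hw0 : 0 < t ^ (-(n : ℝ) / (q : ℝ)) := Real.rpow_pos_of_pos ht0 _
    obtain ⟨dx, dy⟩ := hsol t ht
    have d1 := hS.hasDerivWithinAt_slowVar n hsol ht ht0
    have d2 : HasDerivWithinAt (fun s : ℝ => s ^ (-(n : ℝ) / (q : ℝ)))
        ((-(n : ℝ) / (q : ℝ)) * t ^ (-(n : ℝ) / (q : ℝ) - 1)) I t :=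
      (Real.hasDerivAt_rpow_const (Or.inl ht0.ne')).hasDerivWithinAt
    have d3 : HasDerivWithinAt (fun s => W (x s) (y s))
        ((-(lam / 2) * y t - α * x t) * pdy (H t) (x t) (y t) +
          (-(lam / 2) * x t) * (-pdx (H t) (x t) (y t) + F t (x t) (y t))) I t := by
      refine (((dx.mul dy).const_mul (-(lam / 2))).sub
        ((dx.pow 2).const_mul (α / 2))).congr_deriv ?_
      push_cast; ring
    refine ⟨_, d1.add (d2.mul d3), ?_⟩
    rw [← hεM]
    have hw' : |(-(n : ℝ) / (q : ℝ)) * t ^ (-(n : ℝ) / (q : ℝ) - 1)| ≤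
        ε * t ^ (-(n : ℝ) / (q : ℝ)) := by
      have hq' : (0 : ℝ) < q := by exact_mod_cast hq
      rw [Real.rpow_sub_one ht0.ne', abs_mul, abs_div, abs_neg, Nat.abs_cast, Nat.abs_cast,
        abs_of_pos (by positivity)]
      have c1 : (n : ℝ) / q ≤ 1 := (div_le_one hq').2 (by exact_mod_cast hnq)
      have c2 : t ^ (-(n : ℝ) / (q : ℝ)) / t ≤ ε * t ^ (-(n : ℝ) / (q : ℝ)) := by
        rw [div_le_iff₀ ht0]
        have : 1 ≤ ε * t := by rwa [div_le_iff₀ hε0, mul_comm] at ht4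
        nlinarith
      calc _ ≤ 1 * (t ^ (-(n : ℝ) / (q : ℝ)) / t) :=
            mul_le_mul_of_nonneg_right c1 (by positivity)
        _ ≤ _ := by rwa [one_mul]
    have hWy : |-(lam / 2) * x t| ≤ M * (|x t| + |y t|) := by
      rw [abs_mul, abs_neg, abs_div, abs_of_pos (zero_lt_two' ℝ)]
      exact mul_le_mul (by linarith [abs_nonneg α]) (by linarith [abs_nonneg (y t)])
        (abs_nonneg _) hM0
    have hWx : |-(lam / 2) * y t - α * x t| ≤ M * (|x t| + |y t|) := by
      refine (abs_sub _ _).trans ?_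
      rw [abs_mul, abs_neg, abs_div, abs_of_pos (zero_lt_two' ℝ), abs_mul]
      have c1 : 0 ≤ |lam| * |x t| := by positivity
      have c2 : 0 ≤ |lam| * |y t| := by positivity
      have c3 : 0 ≤ |α| * |y t| := by positivity
      rw [hM]
      linarith
    exact lyapunov_error_algebra (f := Fc n (x t) (y t)) (Ay := pdy H₀ (x t) (y t))
      (Ax := pdx H₀ (x t) (y t)) hw0 hε0 (by positivity) (add_abs_sq_le (x t) (y t)) hM0 b4 b1 b2
      (hWb _ _) hw' hWx hWy (hnf (x t) (y t) hx1 hy1)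

/-- Near the equilibrium, solutions grow or decay at least like powers of the time. -/
theorem Setting.exists_power_law (hS : Setting q E₀ H₀ H F Hc Fc) (hn : 1 ≤ n) (hnq : n ≤ q)
    (hF_lt : ∀ i, 1 ≤ i → i < n → ∀ x y, Fc i x y = 0) {lam : ℝ} (hlam : lam ≠ 0)
    (hγ : pdy (Fc n) 0 0 = lam) :
    ∃ (L : ℝ → ℝ → ℝ → ℝ) (ρ t₁ : ℝ), 0 < ρ ∧ 1 ≤ t₁ ∧
      (∀ t x y, t₁ ≤ t → |x| ≤ ρ → |y| ≤ ρ →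
        (x ^ 2 + y ^ 2) / 4 ≤ L t x y ∧ L t x y ≤ x ^ 2 + y ^ 2) ∧
      ∀ (a b : ℝ) (x y : ℝ → ℝ), t₁ ≤ a → a ≤ b → IsSolOn H F (Set.Icc a b) x y →
        (∀ t ∈ Set.Icc a b, |x t| ≤ ρ ∧ |y t| ≤ ρ) →
        (0 < lam → L a (x a) (y a) * a ^ (-(lam / 4)) ≤ L b (x b) (y b) * b ^ (-(lam / 4))) ∧
        (lam < 0 → L b (x b) (y b) * b ^ (-(lam / 4)) ≤ L a (x a) (y a) * a ^ (-(lam / 4))) := by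
  obtain ⟨L, ρ, t₁, hρ, ht₁, hL, hD⟩ := hS.exists_lyapunov hn hnq hF_lt hlam hγ
  refine ⟨L, ρ, t₁, hρ, ht₁, hL, fun a b x y ha hab hsol hsq => ?_⟩
  -- The derivative is chosen as a function on all of ℝ, with default value 0 off the interval.
  have hD' : ∀ t, ∃ D, t ∈ Set.Icc a b →
      HasDerivWithinAt (fun s => L s (x s) (y s)) D (Set.Icc a b) t ∧
          |D - t ^ (-(n : ℝ) / (q : ℝ)) * (lam / 2) * (x t ^ 2 + y t ^ 2)| ≤
            |lam| / 4 * t ^ (-(n : ℝ) / (q : ℝ)) * (x t ^ 2 + y t ^ 2) := by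
    intro t
    by_cases ht : t ∈ Set.Icc a b
    · obtain ⟨D, h1, h2⟩ := hD _ x y hsol t ht (ha.trans ht.1) (hsq t ht).1 (hsq t ht).2
      exact ⟨D, fun _ => ⟨h1, h2⟩⟩
    · exact ⟨0, fun h => absurd h ht⟩
  choose D hDD using hD'
  have hder : ∀ t ∈ Set.Icc a b, HasDerivWithinAt
      (fun s => L s (x s) (y s) * s ^ (-(lam / 4)))
      (t ^ (-(lam / 4)) * (D t - lam / 4 * (L t (x t) (y t) / t))) (Set.Icc a b) t := by
    intro t ht
    have ht0 : 0 < t := by linarith [ht.1]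
    refine ((hDD t ht).1.mul (Real.hasDerivAt_rpow_const (p := -(lam / 4))
      (Or.inl ht0.ne')).hasDerivWithinAt).congr_deriv ?_
    rw [Real.rpow_sub_one ht0.ne']
    ring
  -- The loss from differentiating t^(-λ/4) is thus at most (|λ|/4) t^(-n/q) r², which the drift of
  -- L compensates.
  have hbnd : ∀ t ∈ Set.Icc a b, 0 ≤ L t (x t) (y t) / t ∧ L t (x t) (y t) / t ≤
      t ^ (-(n : ℝ) / (q : ℝ)) * (x t ^ 2 + y t ^ 2) := by
    intro t ht
    have ht0 : 1 ≤ t := by linarith [ht.1]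
    obtain ⟨h1, h2⟩ := hL t (x t) (y t) (ha.trans ht.1) (hsq t ht).1 (hsq t ht).2
    have hQ : 0 ≤ x t ^ 2 + y t ^ 2 := by positivity
    refine ⟨div_nonneg (by linarith) (by linarith), ?_⟩
    rw [div_eq_inv_mul]
    exact mul_le_mul (inv_le_rpow_neg_div hnq (hn.trans hnq) ht0) h2 (by linarith)
      (Real.rpow_nonneg (by linarith) _)
  have hcont : ContinuousOn (fun s => L s (x s) (y s) * s ^ (-(lam / 4))) (Set.Icc a b) :=
    fun t ht => (hder t ht).continuousWithinAt
  constructor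
  · intro hpos
    refine monotoneOn_of_hasDerivWithinAt_nonneg (convex_Icc a b) hcont
      (fun t ht => (hder t (interior_subset ht)).mono interior_subset) ?_
      (Set.left_mem_Icc.2 hab) (Set.right_mem_Icc.2 hab) hab
    intro t ht
    have ht' := interior_subset ht
    have ht0 : 0 < t := by linarith [ht'.1]
    refine mul_nonneg (Real.rpow_nonneg ht0.le _) ?_
    have h2 := (hDD t ht').2
    rw [abs_of_pos hpos, abs_le] at h2
    have := mul_le_mul_of_nonneg_left (hbnd t ht').2 (show 0 ≤ lam / 4 by linarith)
    linarith [h2.1]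
  · intro hneg
    refine antitoneOn_of_hasDerivWithinAt_nonpos (convex_Icc a b) hcont
      (fun t ht => (hder t (interior_subset ht)).mono interior_subset) ?_
      (Set.left_mem_Icc.2 hab) (Set.right_mem_Icc.2 hab) hab
    intro t ht
    have ht' := interior_subset ht
    have ht0 : 0 < t := by linarith [ht'.1]
    refine mul_nonpos_of_nonneg_of_nonpos (Real.rpow_nonneg ht0.le _) ?_
    have h2 := (hDD t ht').2
    rw [abs_of_neg hneg, abs_le] at h2
    have := mul_le_mul_of_nonneg_left (hbnd t ht').2 (show 0 ≤ -(lam / 4) by linarith)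
    linarith [h2.2]

/-- Were all solutions starting within δ confined to radius ρ, this confinement would be the a
priori bound giving global existence. A nonzero solution stays nonzero by backward uniqueness, so L
would grow like t^(λ/4), against L ≤ ρ². -/
theorem Setting.unstable (hS : Setting q E₀ H₀ H F Hc Fc) (hn : 1 ≤ n) (hnq : n ≤ q)
    (hF_lt : ∀ i, 1 ≤ i → i < n → ∀ x y, Fc i x y = 0) {lam : ℝ} (hlam : 0 < lam)
    (hγ : pdy (Fc n) 0 0 = lam) : Unstable H F := by
  obtain ⟨L, ρ, t₁, hρ, ht₁, hL, hpl⟩ := hS.exists_power_law hn hnq hF_lt hlam.ne' hγ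
  intro t₀ ht₀
  refine ⟨ρ, hρ, fun δ hδ => ?_⟩
  by_contra hcon
  push Not at hcon
  set d := min (δ / 2) (ρ / 2) with hd
  have hd0 : 0 < d := by positivity
  have hdδ : d < δ := (min_le_left _ _).trans_lt (by linarith)
  have hdρ : d < ρ := (min_le_right _ _).trans_lt (by linarith)
  have hrad : rad d 0 < δ := by
    rw [rad]; simpa [abs_of_pos hd0, Real.sqrt_sq hd0.le] using hdδ
  have habs : ∀ x y, rad x y < ρ → |x| < ρ ∧ |y| < ρ := fun x y h => by
    have := (norm_le_rad x y).trans_lt h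
    rw [norm_eq_max_abs] at this
    exact max_lt_iff.1 this
  obtain ⟨x, y, hsol, hx0, hy0⟩ := exists_global_solution hS.smooth_H hS.smooth_F ht₀ (R := ρ)
    (x₀ := d) (y₀ := 0) (by rwa [abs_of_pos hd0]) (by simpa using hρ)
    (fun b hb x y hs hx hy _ => habs _ _ (hcon b x y hb hs (by rwa [hx, hy])))
  have hrho : ∀ t, t₀ ≤ t → rad (x t) (y t) < ρ := fun t ht =>
    hcon t x y ht (hsol.mono Set.Icc_subset_Ici_self) (by rwa [hx0, hy0])
  have hsq : ∀ t, t₀ ≤ t → |x t| ≤ ρ ∧ |y t| ≤ ρ := fun t ht =>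
    ⟨(habs _ _ (hrho t ht)).1.le, (habs _ _ (hrho t ht)).2.le⟩
  set T := max t₀ t₁ with hT
  have hT0 : t₀ ≤ T := le_max_left _ _
  have hT1 : t₁ ≤ T := le_max_right _ _
  have hTpos : 0 < T := by linarith
  have hne : (x T, y T) ≠ 0 := fun h => by
    have := hS.eq_zero_of_eq_zero ht₀ hT0 hρ.le (hsol.mono Set.Icc_subset_Ici_self)
      (fun t ht => hsq t ht.1) h
    rw [hx0, hy0] at this
    exact hd0.ne' (congrArg Prod.fst this)
  have hLT : 0 < L T (x T) (y T) := by
    refine lt_of_lt_of_le ?_ (hL T _ _ hT1 (hsq T hT0).1 (hsq T hT0).2).1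
    have : x T ≠ 0 ∨ y T ≠ 0 := by
      by_contra hc
      push Not at hc
      exact hne (by rw [hc.1, hc.2]; rfl)
    rcases this with h | h <;> positivity
  set c := L T (x T) (y T) * T ^ (-(lam / 4)) with hc
  have hc0 : 0 < c := mul_pos hLT (Real.rpow_pos_of_pos hTpos _)
  have hgrow : ∀ t, T ≤ t → c * t ^ (lam / 4) ≤ ρ ^ 2 := by
    intro t ht
    have ht0 : 0 < t := by linarith
    have h1 := (hpl T t x y hT1 ht (hsol.mono fun s hs => hT0.trans hs.1)
      (fun s hs => hsq s (hT0.trans hs.1))).1 hlam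
    have h2 := (hL t _ _ (hT1.trans ht) (hsq t (hT0.trans ht)).1 (hsq t (hT0.trans ht)).2).2
    have h3 : x t ^ 2 + y t ^ 2 ≤ ρ ^ 2 := by
      rw [← rad_sq]
      exact pow_le_pow_left₀ (rad_nonneg _ _) (hrho t (hT0.trans ht)).le 2
    rw [Real.rpow_neg ht0.le, ← div_eq_mul_inv, le_div_iff₀ (Real.rpow_pos_of_pos ht0 _)] at h1
    exact h1.trans (h2.trans h3)
  have hlim : Filter.Tendsto (fun t : ℝ => c * t ^ (lam / 4)) Filter.atTop Filter.atTop :=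
    (tendsto_rpow_atTop (by positivity)).const_mul_atTop hc0
  obtain ⟨t, ht, ht'⟩ := ((hlim.eventually_gt_atTop (ρ ^ 2)).and
    (Filter.eventually_ge_atTop T)).exists
  linarith [hgrow t ht']

theorem Setting.asymptoticallyStable (hS : Setting q E₀ H₀ H F Hc Fc) (hn : 1 ≤ n) (hnq : n ≤ q)
    (hF_lt : ∀ i, 1 ≤ i → i < n → ∀ x y, Fc i x y = 0) {lam : ℝ} (hlam : lam < 0)
    (hγ : pdy (Fc n) 0 0 = lam) : AsymptoticallyStable H F := by
  obtain ⟨L, ρ, t₁, hρ, ht₁, hL, hpl⟩ := hS.exists_power_law hn hnq hF_lt hlam.ne hγ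
  have hdecay : ∀ (a b : ℝ) (x y : ℝ → ℝ), t₁ ≤ a → a ≤ b → IsSolOn H F (Set.Icc a b) x y →
      (∀ t ∈ Set.Icc a b, |x t| ≤ ρ ∧ |y t| ≤ ρ) →
      rad (x b) (y b) ^ 2 ≤ 4 * rad (x a) (y a) ^ 2 * (a ^ (-(lam / 4)) * b ^ (lam / 4)) := by
    intro a b x y ha hab hsol hsq
    have ha0 : 0 < a := by linarith
    have hb0 : 0 < b := by linarith
    have h1 := (hpl a b x y ha hab hsol hsq).2 hlam
    have hma := hsq a (Set.left_mem_Icc.2 hab)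
    have hmb := hsq b (Set.right_mem_Icc.2 hab)
    have h2 := (hL b _ _ (ha.trans hab) hmb.1 hmb.2).1
    have h3 := (hL a _ _ ha hma.1 hma.2).2
    rw [rad_sq, rad_sq]
    rw [Real.rpow_neg hb0.le, ← div_eq_mul_inv, div_le_iff₀ (Real.rpow_pos_of_pos hb0 _)] at h1
    have h4 : L a (x a) (y a) * a ^ (-(lam / 4)) * b ^ (lam / 4) ≤
        (x a ^ 2 + y a ^ 2) * a ^ (-(lam / 4)) * b ^ (lam / 4) := by gcongr
    linarith
  -- Stability and attraction share one confinement argument; any fixed ε, such as 1, then yields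
  -- attraction.
  have key : ∀ t₀, 0 < t₀ → ∀ ε, 0 < ε → ∃ δ, 0 < δ ∧ ∀ x₀ y₀ : ℝ, rad x₀ y₀ < δ →
      SolutionSatisfies H F t₀ x₀ y₀ (fun x y => (∀ t, t₀ ≤ t → rad (x t) (y t) < ε) ∧
        Filter.Tendsto (fun t => rad (x t) (y t)) Filter.atTop (𝓝 0)) := by
    intro t₀ ht₀ ε hε
    set R := min ρ (ε / 2) with hR
    have hR0 : 0 < R := by positivity
    have hRρ : R ≤ ρ := min_le_left _ _
    have hRε : R ≤ ε / 2 := min_le_right _ _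
    set T := max t₀ t₁ with hT
    have hT0 : t₀ ≤ T := le_max_left _ _
    have hT1 : t₁ ≤ T := le_max_right _ _
    have hTpos : 0 < T := by linarith
    obtain ⟨M, hM1, hM⟩ := hS.exists_growth_bound ht₀ T R hR0.le
    -- Growth up to time T keeps the sup norm below R/4, so rad² ≤ R²/8 at T. The later factor 4
    -- gives at most R²/2, which excludes reaching R.
    refine ⟨R / (4 * M), by positivity, fun x₀ y₀ h₀ => ?_⟩
    have hδR : R / (4 * M) ≤ R / 4 := by
      gcongr
      linarith
    have hMδ : M * (R / (4 * M)) = R / 4 := by field_simp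
    have hn0 : ‖(x₀, y₀)‖ < R / (4 * M) := (norm_le_rad _ _).trans_lt h₀
    have hap : ∀ b, t₀ ≤ b → ∀ x y : ℝ → ℝ, IsSolOn H F (Set.Icc t₀ b) x y → x t₀ = x₀ →
        y t₀ = y₀ → |x b| < R ∧ |y b| < R := by
      intro b hb x y hsol hx hy
      suffices h : ‖(x b, y b)‖ < R by
        rw [norm_eq_max_abs] at h
        exact max_lt_iff.1 h
      by_contra hcon
      obtain ⟨s, hs, hsR, hle⟩ := exists_first_exit (φ := fun s => ‖(x s, y s)‖) hb
        (hsol.continuousOn.1.prodMk hsol.continuousOn.2).norm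
        (by simp only [hx, hy]; linarith) (not_lt.1 hcon)
      have hsol' : IsSolOn H F (Set.Icc t₀ s) x y := hsol.mono (Set.Icc_subset_Icc_right hs.2)
      have hsq : ∀ r ∈ Set.Icc t₀ s, |x r| ≤ R ∧ |y r| ≤ R := fun r hr => by
        have := hle r hr
        simp only [norm_eq_max_abs] at this
        exact max_le_iff.1 this
      have hgrow : ∀ r, t₀ ≤ r → r ≤ s → r ≤ T → ‖(x r, y r)‖ ≤ R / 4 := fun r h1 h2 h3 => by
        have := hM r h3 x y (hsol'.mono (Set.Icc_subset_Icc_right h2))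
          (fun u hu => hsq u ⟨hu.1, hu.2.trans h2⟩) r ⟨h1, le_rfl⟩
        rw [hx, hy] at this
        refine this.trans ?_
        rw [← hMδ]
        exact mul_le_mul_of_nonneg_left hn0.le (by linarith)
      rcases le_total s T with hsT | hsT
      · have := hgrow s hs.1 le_rfl hsT
        rw [hsR] at this
        linarith
      · have h1 := hgrow T hT0 hsT le_rfl
        have h2 := hdecay T s x y hT1 hsT (hsol'.mono (Set.Icc_subset_Icc_left hT0))
          (fun r hr => ⟨(hsq r ⟨hT0.trans hr.1, hr.2⟩).1.trans hRρ,
            (hsq r ⟨hT0.trans hr.1, hr.2⟩).2.trans hRρ⟩)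
        have h3 : T ^ (-(lam / 4)) * s ^ (lam / 4) ≤ 1 := by
          rw [Real.rpow_neg hTpos.le, inv_mul_le_iff₀ (Real.rpow_pos_of_pos hTpos _), mul_one]
          exact Real.rpow_le_rpow_of_nonpos hTpos hsT (by linarith)
        have h4 : rad (x T) (y T) ^ 2 ≤ 2 * (R / 4) ^ 2 := by
          rw [rad_sq]
          rw [norm_eq_max_abs] at h1
          obtain ⟨u1, u2⟩ := max_le_iff.1 h1
          have := sq_le_sq' (abs_le.1 u1).1 (abs_le.1 u1).2
          have := sq_le_sq' (abs_le.1 u2).1 (abs_le.1 u2).2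
          linarith
        have h5 : R ^ 2 ≤ rad (x s) (y s) ^ 2 := by
          rw [← hsR]
          exact pow_le_pow_left₀ (norm_nonneg _) (norm_le_rad _ _) 2
        have h6 : 4 * rad (x T) (y T) ^ 2 * (T ^ (-(lam / 4)) * s ^ (lam / 4)) ≤
            4 * rad (x T) (y T) ^ 2 * 1 := mul_le_mul_of_nonneg_left h3 (by positivity)
        have : 0 < R ^ 2 := by positivity
        nlinarith
    have hn1 := hn0
    rw [norm_eq_max_abs] at hn1
    obtain ⟨hx₀, hy₀⟩ := max_lt_iff.1 hn1
    refine ⟨exists_global_solution hS.smooth_H hS.smooth_F ht₀ (R := R)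
      (by linarith) (by linarith) (fun b hb x y hs hx hy _ => hap b hb x y hs hx hy), ?_⟩
    intro x y hsol hx hy
    have hsq : ∀ t, t₀ ≤ t → |x t| < R ∧ |y t| < R := fun t ht =>
      hap t ht x y (hsol.mono Set.Icc_subset_Ici_self) hx hy
    refine ⟨fun t ht => ?_, ?_⟩
    · have := rad_le_add_abs (x t) (y t)
      linarith [(hsq t ht).1, (hsq t ht).2]
    · set C := 4 * rad (x T) (y T) ^ 2 * T ^ (-(lam / 4)) with hC
      have hlim : Filter.Tendsto (fun t : ℝ => Real.sqrt (C * t ^ (lam / 4))) Filter.atTop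
          (𝓝 0) := by
        have h1 : Filter.Tendsto (fun t : ℝ => t ^ (lam / 4)) Filter.atTop (𝓝 0) := by
          have := tendsto_rpow_neg_atTop (show 0 < -(lam / 4) by linarith)
          simpa using this
        have h2 := (h1.const_mul C).sqrt
        simpa using h2
      refine squeeze_zero' (Filter.Eventually.of_forall fun t => rad_nonneg _ _) ?_ hlim
      filter_upwards [Filter.eventually_ge_atTop T] with t ht
      refine Real.le_sqrt_of_sq_le ?_
      have := hdecay T t x y hT1 ht (hsol.mono fun s hs => hT0.trans hs.1)
        (fun s hs => ⟨(hsq s (hT0.trans hs.1)).1.le.trans hRρ,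
          (hsq s (hT0.trans hs.1)).2.le.trans hRρ⟩)
      rw [hC, mul_assoc]
      exact this
  refine ⟨fun t₀ ht₀ ε hε => ?_, fun t₀ ht₀ => ?_⟩
  · obtain ⟨δ, hδ, h⟩ := key t₀ ht₀ ε hε
    exact ⟨δ, hδ, fun x₀ y₀ h₀ => ⟨(h x₀ y₀ h₀).1, fun x y a b c => ((h x₀ y₀ h₀).2 x y a b c).1⟩⟩
  · obtain ⟨δ, hδ, h⟩ := key t₀ ht₀ 1 one_pos
    exact ⟨δ, hδ, fun x₀ y₀ h₀ => ⟨(h x₀ y₀ h₀).1, fun x y a b c => ((h x₀ y₀ h₀).2 x y a b c).2⟩⟩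

end

end

/-! ### Return-time arguments and averages over one period -/

section

/-- If a continuous function that starts below `M` returns below `M` within time `T` whenever it
takes the value `M`, then it is below `M` at some time among the last `T`. -/
theorem exists_late_le {φ : ℝ → ℝ} {a b T M : ℝ} (hab : a ≤ b) (hT : 0 ≤ T)
    (hφ : ContinuousOn φ (Set.Icc a b)) (ha : φ a ≤ M)
    (hstep : ∀ s ∈ Set.Icc a b, s + T ≤ b → φ s = M → ∃ s', s < s' ∧ s' ≤ s + T ∧ φ s' ≤ M) :
    ∃ s ∈ Set.Icc a b, b ≤ s + T ∧ φ s ≤ M := by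
  have hc : IsCompact (Set.Icc a b ∩ φ ⁻¹' Set.Iic M) :=
    isCompact_Icc.of_isClosed_subset (hφ.preimage_isClosed_of_isClosed isClosed_Icc isClosed_Iic)
      Set.inter_subset_left
  -- If this last time preceded b - T, the value there would be exactly M and `hstep` would produce
  -- a later one.
  obtain ⟨s, ⟨hs, hsM⟩, hmax⟩ := hc.exists_isGreatest ⟨a, ⟨le_rfl, hab⟩, ha⟩
  refine ⟨s, hs, ?_, hsM⟩
  by_contra hcon
  push Not at hcon
  have hM : φ s = M := by
    by_contra hne
    have hlt : φ s < M := lt_of_le_of_ne hsM hne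
    have hb : M ≤ φ b := by
      by_contra hb
      have := hmax ⟨⟨hab, le_rfl⟩, (not_le.1 hb).le⟩
      linarith
    obtain ⟨r, hr, hrM⟩ := intermediate_value_Icc hs.2 (hφ.mono (Set.Icc_subset_Icc_left hs.1))
      (show M ∈ _ from ⟨hlt.le, hb⟩)
    have := hmax ⟨⟨hs.1.trans hr.1, hr.2⟩, hrM.le⟩
    have hrs : r = s := le_antisymm this hr.1
    exact hne (hrs ▸ hrM)
  obtain ⟨s', h1, h2, h3⟩ := hstep s hs hcon.le hM
  have := hmax ⟨⟨hs.1.trans h1.le, by linarith⟩, h3⟩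
  linarith

theorem gronwallBound_le_mul_exp {δ K ε x : ℝ} (hε : 0 ≤ ε) (hK : 1 ≤ K) :
    gronwallBound δ K ε x ≤ (δ + ε) * Real.exp (K * x) := by
  have hK0 : K ≠ 0 := by linarith
  rw [gronwallBound_of_K_ne_0 hK0]
  have h1 : ε / K * (Real.exp (K * x) - 1) ≤ ε * Real.exp (K * x) := by
    have h2 : ε / K ≤ ε := div_le_self hε hK
    have h3 : 0 ≤ ε / K := by positivity
    nlinarith [Real.exp_pos (K * x)]
  linarith

/-- Since n ≤ q, t · t^(-n/q) is nondecreasing, so over a time T the weight changes by a relative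
amount of at most T/τ and can be frozen. -/
theorem abs_rpow_neg_div_sub_le {q n : ℕ} (hnq : n ≤ q) (hq : 1 ≤ q) {τ t T : ℝ} (hτ : 0 < τ)
    (h1 : τ ≤ t) (h2 : t ≤ τ + T) :
    t ^ (-(n : ℝ) / (q : ℝ)) ≤ τ ^ (-(n : ℝ) / (q : ℝ)) ∧
    |t ^ (-(n : ℝ) / (q : ℝ)) - τ ^ (-(n : ℝ) / (q : ℝ))| ≤
      τ ^ (-(n : ℝ) / (q : ℝ)) * (T / τ) := by
  have ht : 0 < t := by linarith
  have hq' : (0 : ℝ) < q := by exact_mod_cast hq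
  have hle : t ^ (-(n : ℝ) / (q : ℝ)) ≤ τ ^ (-(n : ℝ) / (q : ℝ)) :=
    Real.rpow_le_rpow_of_nonpos hτ h1 (by
      rw [neg_div]; exact neg_nonpos.2 (by positivity))
  refine ⟨hle, ?_⟩
  rw [abs_sub_comm, abs_of_nonneg (by linarith)]
  have hmono : τ ^ (-(n : ℝ) / (q : ℝ)) * τ ≤ t ^ (-(n : ℝ) / (q : ℝ)) * t := by
    rw [← Real.rpow_add_one hτ.ne', ← Real.rpow_add_one ht.ne']
    refine Real.rpow_le_rpow hτ.le h1 ?_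
    have : (n : ℝ) / q ≤ 1 := (div_le_one hq').2 (by exact_mod_cast hnq)
    rw [neg_div]; linarith
  have hw : 0 < t ^ (-(n : ℝ) / (q : ℝ)) := Real.rpow_pos_of_pos ht _
  rw [mul_div_assoc', le_div_iff₀ hτ]
  nlinarith

section

variable {q n : ℕ} {E₀ : ℝ} {H₀ : ℝ → ℝ → ℝ} {H F : ℝ → ℝ → ℝ → ℝ} {Hc Fc : ℕ → ℝ → ℝ → ℝ}

/-- Otherwise x would be constant on the orbit, although the level line contains points with
different first coordinates. This makes the average of (∂_y H₀)² positive. -/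
theorem IsClosedOrbit.exists_pdy_ne_zero (hS : Setting q E₀ H₀ H F Hc Fc) {E T : ℝ} {x y : ℝ → ℝ}
    (hE : 0 < E) (hE' : E ≤ E₀) (hor : IsClosedOrbit H₀ E T x y) :
    ∃ s ∈ Set.Icc 0 T, pdy H₀ (x s) (y s) ≠ 0 := by
  by_contra hcon
  push Not at hcon
  have hall : ∀ s, pdy H₀ (x s) (y s) = 0 := by
    have hper : Function.Periodic (fun s => pdy H₀ (x s) (y s)) T := fun s => by
      simp only [hor.periodic_x s, hor.periodic_y s]
    intro s
    obtain ⟨r, hr, hrs⟩ := hper.exists_mem_Ico₀ hor.period_pos s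
    refine hrs.trans ?_
    exact hcon r ⟨hr.1, hr.2.le⟩
  have hconst : ∀ s r, x s = x r := is_const_of_deriv_eq_zero
    (fun s => (hor.deriv_x s).differentiableAt) (fun s => by rw [(hor.deriv_x s).deriv, hall])
  obtain ⟨a, b, u, v, hab, hu, hv⟩ := exists_level_points hS.smooth_H₀ hS.H₀_near_zero
    hS.closed_levels hS.E₀_pos hE hE'
  have h1 : (a, u) ∈ Set.range (fun s => (x s, y s)) := hor.range_eq ▸ hu
  have h2 : (b, v) ∈ Set.range (fun s => (x s, y s)) := hor.range_eq ▸ hv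
  obtain ⟨s, hs⟩ := h1
  obtain ⟨r, hr⟩ := h2
  have e1 : x s = a := congrArg Prod.fst hs
  have e2 : x r = b := congrArg Prod.fst hr
  have := hconst s r
  rw [e1, e2] at this
  exact hab.ne this

/-- The solution of the limiting system through a point, and the drift over one period. -/
theorem Setting.exists_orbit (hS : Setting q E₀ H₀ H F Hc Fc) {lam mu : ℝ}
    {Fhat : ℝ → ℝ → ℝ} (hn : 1 ≤ n)
    (hF_n : ∀ x y, Fc n x y = pdy H₀ x y * (lam - mu * H₀ x y) + Fhat x y)
    (hFhat : ∀ E, 0 < E → E < E₀ → ZeroAverage H₀ (fun x y => Fhat x y * pdy H₀ x y) E)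
    {x₁ y₁ : ℝ} (hE : 0 < H₀ x₁ y₁) (hE' : H₀ x₁ y₁ < E₀) :
    ∃ (T P : ℝ) (X Y : ℝ → ℝ), 0 < T ∧ 0 < P ∧ X 0 = x₁ ∧ Y 0 = y₁ ∧
      (∀ s, HasDerivAt (fun s => (X s, Y s))
        (pdy H₀ (X s) (Y s), -pdx H₀ (X s) (Y s)) s) ∧
      (∀ s, H₀ (X s) (Y s) = H₀ x₁ y₁) ∧
      ∫ s in (0 : ℝ)..T, pdy H₀ (X s) (Y s) * Fc n (X s) (Y s) = (lam - mu * H₀ x₁ y₁) * P := by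
  obtain ⟨T, x, y, hor⟩ := hS.closed_levels _ hE hE'.le
  have hmem : (x₁, y₁) ∈ Set.range (fun s => (x s, y s)) := by
    rw [hor.range_eq]; rfl
  obtain ⟨s₁, hs₁⟩ := hmem
  have hlev : ∀ s, H₀ (x s) (y s) = H₀ x₁ y₁ := fun s => by
    have : (x s, y s) ∈ {p : ℝ × ℝ | H₀ p.1 p.2 = H₀ x₁ y₁} := hor.range_eq ▸ ⟨s, rfl⟩
    exact this
  have hc : ∀ {g : ℝ → ℝ → ℝ}, Smooth2 g → Continuous (fun s => g (x s) (y s)) := fun hg =>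
    hg.continuous.comp hor.continuous
  have cy := hc hS.smooth_H₀.pdy
  have cf := hc (hS.smooth_Fc n hn)
  have cFh : Continuous (fun s => Fhat (x s) (y s) * pdy H₀ (x s) (y s)) := by
    have : (fun s => Fhat (x s) (y s) * pdy H₀ (x s) (y s)) = fun s =>
        (Fc n (x s) (y s) - pdy H₀ (x s) (y s) * (lam - mu * H₀ x₁ y₁)) * pdy H₀ (x s) (y s) := by
      ext s; rw [hF_n, hlev]; ring
    rw [this]
    exact (cf.sub (cy.mul continuous_const)).mul cy
  have hP : 0 < ∫ s in (0 : ℝ)..T, pdy H₀ (x s) (y s) ^ 2 := by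
    obtain ⟨c, hc, hc'⟩ := hor.exists_pdy_ne_zero hS hE hE'.le
    exact intervalIntegral.integral_pos hor.period_pos (cy.pow 2).continuousOn
      (fun s _ => sq_nonneg _) ⟨c, hc, by positivity⟩
  -- P is the integral of (∂_y H₀)². Shifting time moves the start to the given point, and by
  -- periodicity leaves the integral over a period unchanged.
  refine ⟨T, _, fun s => x (s + s₁), fun s => y (s + s₁), hor.period_pos, hP, ?_, ?_, ?_, ?_, ?_⟩
  · simpa using congrArg Prod.fst hs₁
  · simpa using congrArg Prod.snd hs₁
  · intro s
    exact ((hor.deriv_x (s + s₁)).comp_add_const s s₁).prodMk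
      ((hor.deriv_y (s + s₁)).comp_add_const s s₁)
  · exact fun s => hlev _
  · have hper : Function.Periodic (fun s => pdy H₀ (x s) (y s) * Fc n (x s) (y s)) T := fun s => by
      simp only [hor.periodic_x s, hor.periodic_y s]
    rw [intervalIntegral.integral_comp_add_right
      (fun s => pdy H₀ (x s) (y s) * Fc n (x s) (y s)) s₁, add_comm T s₁,
      zero_add, hper.intervalIntegral_add_eq s₁ 0]
    have e : (fun s => pdy H₀ (x s) (y s) * Fc n (x s) (y s)) = fun s =>
        (lam - mu * H₀ x₁ y₁) * pdy H₀ (x s) (y s) ^ 2 + Fhat (x s) (y s) * pdy H₀ (x s) (y s) := by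
      ext s; rw [hF_n, hlev]; ring
    have cq : Continuous (fun s => (lam - mu * H₀ x₁ y₁) * pdy H₀ (x s) (y s) ^ 2) :=
      continuous_const.mul (cy.pow 2)
    rw [e, zero_add, intervalIntegral.integral_add (cq.intervalIntegrable _ _)
      (cFh.intervalIntegrable _ _),
      intervalIntegral.integral_const_mul, hFhat _ hE hE' T x y hor, add_zero]

end

end

/-! ### Drift of the truncated Hamiltonian over one period -/

section

variable {q n : ℕ} {E₀ : ℝ} {H₀ : ℝ → ℝ → ℝ} {H F : ℝ → ℝ → ℝ → ℝ} {Hc Fc : ℕ → ℝ → ℝ → ℝ}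

theorem add_abs_le_of_mem_square {R : ℝ} {p : ℝ × ℝ} (hp : p ∈ square R) :
    |p.1| + |p.2| ≤ 2 * R ∧ p.1 ^ 2 + p.2 ^ 2 ≤ 2 * R ^ 2 := by
  obtain ⟨h1, h2⟩ := mem_square'.1 hp
  have := sq_le_sq' (abs_le.1 h1).1 (abs_le.1 h1).2
  have := sq_le_sq' (abs_le.1 h2).1 (abs_le.1 h2).2
  constructor <;> linarith

/-- The drift of the truncated Hamiltonian over one period of the limiting system, for solutions
that start near a given point. -/
theorem Setting.exists_local_drift (hS : Setting q E₀ H₀ H F Hc Fc) (hn : 1 ≤ n) (hnq : n ≤ q)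
    {lam mu : ℝ} {Fhat : ℝ → ℝ → ℝ}
    (hF_lt : ∀ i, 1 ≤ i → i < n → ∀ x y, Fc i x y = 0)
    (hF_n : ∀ x y, Fc n x y = pdy H₀ x y * (lam - mu * H₀ x y) + Fhat x y)
    (hFhat : ∀ E, 0 < E → E < E₀ → ZeroAverage H₀ (fun x y => Fhat x y * pdy H₀ x y) E)
    {R : ℝ} (hR : 0 < R) (hsub : ∀ x y, H₀ x y ≤ E₀ → |x| < R ∧ |y| < R)
    {σ : ℝ} (hσ : |σ| = 1) {p₁ : ℝ × ℝ} (hE : 0 < H₀ p₁.1 p₁.2) (hE' : H₀ p₁.1 p₁.2 < E₀)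
    (hsign : σ * (lam - mu * H₀ p₁.1 p₁.2) < 0) :
    ∃ δ T c t₁ : ℝ, 0 < δ ∧ 0 < T ∧ 0 < c ∧ 1 ≤ t₁ ∧ ∀ τ, t₁ ≤ τ → ∀ x y : ℝ → ℝ,
      IsSolOn H F (Set.Icc τ (τ + T)) x y →
      (∀ t ∈ Set.Icc τ (τ + T), (x t, y t) ∈ square R) → dist (x τ, y τ) p₁ ≤ δ →
      σ * slowVar q n H₀ Hc (τ + T) (x (τ + T)) (y (τ + T)) ≤
        σ * slowVar q n H₀ Hc τ (x τ) (y τ) - c * τ ^ (-(n : ℝ) / (q : ℝ)) := by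
  have hq : 1 ≤ q := hn.trans hnq
  obtain ⟨T, P, X, Y, hT, hP, hX0, hY0, hXY, hlev, hint⟩ :=
    hS.exists_orbit hn hF_n hFhat hE hE'
  set g : ℝ × ℝ → ℝ := fun p => pdy H₀ p.1 p.2 * Fc n p.1 p.2 with hg
  have hgs : ContDiff ℝ ∞ g := hS.smooth_H₀.pdy.mul (hS.smooth_Fc n hn)
  set v : ℝ × ℝ → ℝ × ℝ := fun p => (pdy H₀ p.1 p.2, -pdx H₀ p.1 p.2) with hv
  have hvs : ContDiff ℝ ∞ v := ContDiff.prodMk hS.smooth_H₀.pdy hS.smooth_H₀.pdx.neg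
  obtain ⟨Kg, hKg⟩ := hgs.contDiffOn.exists_lipschitzOnWith (by simp) (convex_square R)
    (isCompact_square R)
  obtain ⟨Kv, hKv⟩ := hvs.contDiffOn.exists_lipschitzOnWith (by simp) (convex_square R)
    (isCompact_square R)
  obtain ⟨B, hB⟩ := (isCompact_square R).exists_bound_of_continuousOn hgs.continuous.continuousOn
  set K : NNReal := max Kv 1 with hK
  have hKv' : LipschitzOnWith K v (square R) := hKv.weaken (le_max_left _ _)
  have hK1 : (1 : ℝ) ≤ K := by exact_mod_cast le_max_right Kv 1
  set D := (lam - mu * H₀ p₁.1 p₁.2) * P with hD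
  have hσD : σ * D < 0 := by
    rw [hD, ← mul_assoc]; exact mul_neg_of_neg_of_pos hsign hP
  have hDabs : σ * D = -|D| := by
    have := abs_of_neg hσD
    rw [abs_mul, hσ, one_mul] at this
    linarith
  have hD0 : 0 < |D| := by
    rw [hDabs] at hσD; linarith
  -- The rate may err by η in units of the weight, losing at most |D|/2 over the period. It is split
  -- into three thirds: the asymptotic error, freezing the weight, and replacing the solution by the
  -- limiting orbit.
  set η := |D| / (2 * T) with hη
  have hη0 : 0 < η := by positivity
  have hηT : η * T = |D| / 2 := by rw [hη]; field_simp
  set ν := η / (3 * (Kg + 1)) with hν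
  have hν0 : 0 < ν := by positivity
  have hKν : Kg * ν ≤ η / 3 := by
    have : (Kg + 1) * ν = η / 3 := by rw [hν]; field_simp
    nlinarith
  set G := Real.exp (K * T) with hG
  have hG0 : 0 < G := Real.exp_pos _
  -- The first entry keeps the velocity error on the square below ν/(2G); with an equal initial
  -- error, the Gronwall factor G yields ν. The second makes the drift error at most a third of η.
  set ε := min (ν / (2 * G) / (2 * R)) (η / 3 / (2 * R ^ 2)) with hε
  have hε0 : 0 < ε := by positivity
  have hε1 : ε * (2 * R) ≤ ν / (2 * G) := by
    rw [← le_div_iff₀ (by positivity)]; exact min_le_left _ _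
  have hε2 : ε * (2 * R ^ 2) ≤ η / 3 := by
    rw [← le_div_iff₀ (by positivity)]; exact min_le_right _ _
  obtain ⟨t₁, ht₁, hest⟩ := hS.exists_estimates hn hnq hF_lt R hε0
  set B' := |B| + 1 with hB'
  have hB'0 : 0 < B' := by positivity
  refine ⟨ν / (2 * G), T, |D| / 2, max t₁ (3 * B' * T / η), by positivity, hT, by positivity,
    ht₁.trans (le_max_left _ _), ?_⟩
  intro τ hτ x y hsol hsq hdist
  have hτ1 : t₁ ≤ τ := (le_max_left _ _).trans hτ
  have hτ2 : 3 * B' * T / η ≤ τ := (le_max_right _ _).trans hτ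
  have hτ0 : 0 < τ := by linarith
  have hBT : B' * (T / τ) ≤ η / 3 := by
    rw [div_le_iff₀ hη0] at hτ2
    rw [mul_div_assoc', div_le_iff₀ hτ0]
    linarith
  set w := τ ^ (-(n : ℝ) / (q : ℝ)) with hw
  have hw0 : 0 < w := Real.rpow_pos_of_pos hτ0 _
  have hXYs : ∀ s, (X s, Y s) ∈ square R := fun s => by
    obtain ⟨h1, h2⟩ := hsub (X s) (Y s) ((hlev s).le.trans hE'.le)
    exact mem_square.2 ⟨h1.le, h2.le⟩
  have hshift : ∀ t, HasDerivAt (fun t => (X (t - τ), Y (t - τ))) (v (X (t - τ), Y (t - τ))) t :=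
    fun t => (hXY (t - τ)).comp_sub_const t τ
  have hgron : ∀ t ∈ Set.Icc τ (τ + T), dist (x t, y t) (X (t - τ), Y (t - τ)) ≤ ν := by
    intro t ht
    have h1 := dist_le_of_approx_trajectories_ODE_of_mem (v := fun _ => v)
      (s := fun _ => square R) (K := K) (a := τ) (b := τ + T) (f := fun t => (x t, y t))
      (f' := fun t => vel H F t (x t, y t)) (εf := ν / (2 * G)) (εg := 0) (δ := ν / (2 * G))
      (g := fun t => (X (t - τ), Y (t - τ))) (g' := fun t => v (X (t - τ), Y (t - τ)))
      (fun _ _ => hKv') (fun s hs => (isSolOn_iff.1 hsol s hs).continuousWithinAt)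
      (fun s hs => hsol.hasDerivWithinAt_Ici hs)
      (fun s hs => by
        have hm := hsq s ⟨hs.1, hs.2.le⟩
        obtain ⟨m1, m2⟩ := mem_square'.1 hm
        obtain ⟨e1, e2, -, -⟩ := hest s (hτ1.trans hs.1) (x s) (y s) m1 m2
        have hn := (add_abs_le_of_mem_square hm).1
        have hb : ε * (|x s| + |y s|) ≤ ν / (2 * G) :=
          (mul_le_mul_of_nonneg_left hn hε0.le).trans hε1
        rw [Prod.dist_eq]
        exact max_le (e1.trans hb) (e2.trans hb))
      (fun s hs => hsq s ⟨hs.1, hs.2.le⟩)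
      (fun s _ => (hshift s).continuousAt.continuousWithinAt)
      (fun s _ => (hshift s).hasDerivWithinAt) (fun s _ => (dist_self _).le)
      (fun s _ => hXYs _) (by
        simp only [sub_self, hX0, hY0]
        exact hdist) t ht
    refine h1.trans ?_
    rw [add_zero]
    refine (gronwallBound_le_mul_exp (by positivity) hK1).trans ?_
    have h2 : Real.exp (K * (t - τ)) ≤ G := Real.exp_le_exp.2
      (mul_le_mul_of_nonneg_left (by linarith [ht.2]) (by linarith))
    calc _ ≤ (ν / (2 * G) + ν / (2 * G)) * G := mul_le_mul_of_nonneg_left h2 (by positivity)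
      _ = ν := by field_simp; norm_num
  have hgc : Continuous (fun s => g (X s, Y s)) := hgs.continuous.comp
    (continuous_iff_continuousAt.2 fun s => (hXY s).continuousAt)
  -- The averaged motion is subtracted with the weight frozen at τ, so the mean value inequality
  -- compares the drift over a period with w D.
  have hder : ∀ t ∈ Set.Icc τ (τ + T), HasDerivWithinAt
      (fun t => slowVar q n H₀ Hc t (x t) (y t) - w * ∫ s in (0 : ℝ)..(t - τ), g (X s, Y s))
      (slowRate q n H₀ H F Hc t (x t) (y t) - w * g (X (t - τ), Y (t - τ)))
      (Set.Icc τ (τ + T)) t := by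
    intro t ht
    have h1 := hS.hasDerivWithinAt_slowVar n hsol ht (hτ0.trans_le ht.1)
    have h2 : HasDerivAt (fun t => ∫ s in (0 : ℝ)..(t - τ), g (X s, Y s))
        (g (X (t - τ), Y (t - τ))) t :=
      (hgc.integral_hasStrictDerivAt 0 (t - τ)).hasDerivAt.comp_sub_const t τ
    exact h1.sub (h2.const_mul w).hasDerivWithinAt
  have hbd : ∀ t ∈ Set.Icc τ (τ + T),
      ‖slowRate q n H₀ H F Hc t (x t) (y t) - w * g (X (t - τ), Y (t - τ))‖ ≤ w * η := by
    intro t ht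
    obtain ⟨m1, m2⟩ := mem_square'.1 (hsq t ht)
    have b1 := (hest t (hτ1.trans ht.1) (x t) (y t) m1 m2).2.2.2
    obtain ⟨b2, b3⟩ := abs_rpow_neg_div_sub_le hnq hq hτ0 ht.1 ht.2
    have hwt : 0 < t ^ (-(n : ℝ) / (q : ℝ)) := Real.rpow_pos_of_pos (hτ0.trans_le ht.1) _
    set w' := t ^ (-(n : ℝ) / (q : ℝ)) with hw'
    have b4 : ‖g (x t, y t)‖ ≤ B' := (hB _ (hsq t ht)).trans (by linarith [le_abs_self B])
    have b5 : dist (g (x t, y t)) (g (X (t - τ), Y (t - τ))) ≤ η / 3 :=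
      (hKg.dist_le_mul _ (hsq t ht) _ (hXYs _)).trans
        ((mul_le_mul_of_nonneg_left (hgron t ht) Kg.2).trans hKν)
    rw [Real.dist_eq] at b5
    rw [Real.norm_eq_abs] at b4 ⊢
    have hQ := (add_abs_le_of_mem_square (hsq t ht)).2
    simp only at hQ
    have c1 : |slowRate q n H₀ H F Hc t (x t) (y t) - w' * g (x t, y t)| ≤ w * (η / 3) := by
      refine b1.trans ?_
      calc ε * w' * (x t ^ 2 + y t ^ 2) ≤ ε * w * (2 * R ^ 2) := by gcongr
        _ = w * (ε * (2 * R ^ 2)) := by ring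
        _ ≤ _ := mul_le_mul_of_nonneg_left hε2 hw0.le
    have c2 : |(w' - w) * g (x t, y t)| ≤ w * (η / 3) := by
      rw [abs_mul]
      calc _ ≤ w * (T / τ) * B' := mul_le_mul b3 b4 (abs_nonneg _) (by positivity)
        _ = w * (B' * (T / τ)) := by ring
        _ ≤ _ := mul_le_mul_of_nonneg_left hBT hw0.le
    have c3 : |w * (g (x t, y t) - g (X (t - τ), Y (t - τ)))| ≤ w * (η / 3) := by
      rw [abs_mul, abs_of_pos hw0]
      exact mul_le_mul_of_nonneg_left b5 hw0.le
    have e : slowRate q n H₀ H F Hc t (x t) (y t) - w * g (X (t - τ), Y (t - τ)) =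
        (slowRate q n H₀ H F Hc t (x t) (y t) - w' * g (x t, y t)) +
        (w' - w) * g (x t, y t) + w * (g (x t, y t) - g (X (t - τ), Y (t - τ))) := by ring
    rw [e]
    refine (abs_add_le _ _).trans ?_
    have := abs_add_le (slowRate q n H₀ H F Hc t (x t) (y t) - w' * g (x t, y t))
      ((w' - w) * g (x t, y t))
    linarith
  have hmv := (convex_Icc τ (τ + T)).norm_image_sub_le_of_norm_hasDerivWithin_le hder hbd
    (Set.left_mem_Icc.2 (by linarith)) (Set.right_mem_Icc.2 (by linarith))
  simp only [add_sub_cancel_left, sub_self, intervalIntegral.integral_same, mul_zero, sub_zero,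
    Real.norm_eq_abs, abs_of_pos hT] at hmv
  have hint' : ∫ s in (0 : ℝ)..T, g (X s, Y s) = D := hint
  rw [hint'] at hmv
  set k₁ := slowVar q n H₀ Hc (τ + T) (x (τ + T)) (y (τ + T))
  set k₀ := slowVar q n H₀ Hc τ (x τ) (y τ)
  have h3 : |σ * (k₁ - w * D - k₀)| ≤ w * (|D| / 2) := by
    rw [abs_mul, hσ, one_mul, ← hηT]
    linarith
  have h4 := (abs_le.1 h3).2
  have h5 : σ * (k₁ - w * D - k₀) = σ * k₁ - σ * k₀ - w * (σ * D) := by ring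
  rw [h5, hDabs] at h4
  linarith

/-- Uniform drift over bounded times, for solutions starting in a compact set. -/
theorem Setting.exists_drift (hS : Setting q E₀ H₀ H F Hc Fc) (hn : 1 ≤ n) (hnq : n ≤ q)
    {lam mu : ℝ} {Fhat : ℝ → ℝ → ℝ}
    (hF_lt : ∀ i, 1 ≤ i → i < n → ∀ x y, Fc i x y = 0)
    (hF_n : ∀ x y, Fc n x y = pdy H₀ x y * (lam - mu * H₀ x y) + Fhat x y)
    (hFhat : ∀ E, 0 < E → E < E₀ → ZeroAverage H₀ (fun x y => Fhat x y * pdy H₀ x y) E)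
    {R : ℝ} (hR : 0 < R) (hsub : ∀ x y, H₀ x y ≤ E₀ → |x| < R ∧ |y| < R)
    {σ : ℝ} (hσ : |σ| = 1) {A : Set (ℝ × ℝ)} (hA : IsCompact A)
    (hAE : ∀ p ∈ A, 0 < H₀ p.1 p.2 ∧ H₀ p.1 p.2 < E₀ ∧ σ * (lam - mu * H₀ p.1 p.2) < 0) :
    ∃ T c t₁ : ℝ, 0 < T ∧ 0 < c ∧ 1 ≤ t₁ ∧ ∀ τ, t₁ ≤ τ → ∀ x y : ℝ → ℝ,
      IsSolOn H F (Set.Icc τ (τ + T)) x y →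
      (∀ t ∈ Set.Icc τ (τ + T), (x t, y t) ∈ square R) → (x τ, y τ) ∈ A →
      ∃ s, 0 < s ∧ s ≤ T ∧ σ * slowVar q n H₀ Hc (τ + s) (x (τ + s)) (y (τ + s)) ≤
        σ * slowVar q n H₀ Hc τ (x τ) (y τ) - c * τ ^ (-(n : ℝ) / (q : ℝ)) := by
  -- Periods vary with the level, so the drop is only claimed at some time s ≤ T; in this form
  -- finite unions are handled by taking the largest T and smallest c.
  refine hA.induction_on (p := fun A => ∃ T c t₁ : ℝ, 0 < T ∧ 0 < c ∧ 1 ≤ t₁ ∧ ∀ τ, t₁ ≤ τ →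
    ∀ x y : ℝ → ℝ, IsSolOn H F (Set.Icc τ (τ + T)) x y →
      (∀ t ∈ Set.Icc τ (τ + T), (x t, y t) ∈ square R) → (x τ, y τ) ∈ A →
      ∃ s, 0 < s ∧ s ≤ T ∧ σ * slowVar q n H₀ Hc (τ + s) (x (τ + s)) (y (τ + s)) ≤
        σ * slowVar q n H₀ Hc τ (x τ) (y τ) - c * τ ^ (-(n : ℝ) / (q : ℝ))) ?_ ?_ ?_ ?_
  · exact ⟨1, 1, 1, one_pos, one_pos, le_rfl, fun _ _ _ _ _ _ h => absurd h (Set.notMem_empty _)⟩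
  · rintro s t hst ⟨T, c, t₁, h1, h2, h3, h⟩
    exact ⟨T, c, t₁, h1, h2, h3, fun τ hτ x y hs hq hm => h τ hτ x y hs hq (hst hm)⟩
  · rintro S S' ⟨T, c, t₁, h1, h2, h3, h⟩ ⟨T', c', t₁', h1', h2', h3', h'⟩
    refine ⟨max T T', min c c', max t₁ t₁', lt_max_of_lt_left h1, lt_min h2 h2',
      h3.trans (le_max_left _ _), fun τ hτ x y hs hq hm => ?_⟩
    have hτ0 : 0 < τ := by linarith [(le_max_left t₁ t₁').trans hτ]
    have hw0 : 0 < τ ^ (-(n : ℝ) / (q : ℝ)) := Real.rpow_pos_of_pos hτ0 _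
    rcases hm with hm | hm
    · have hss : Set.Icc τ (τ + T) ⊆ Set.Icc τ (τ + max T T') :=
        Set.Icc_subset_Icc_right (by linarith [le_max_left T T'])
      obtain ⟨s, a1, a2, a3⟩ := h τ ((le_max_left _ _).trans hτ) x y (hs.mono hss)
        (fun t ht => hq t (hss ht)) hm
      refine ⟨s, a1, a2.trans (le_max_left _ _), ?_⟩
      have := mul_le_mul_of_nonneg_right (min_le_left c c') hw0.le
      linarith
    · have hss : Set.Icc τ (τ + T') ⊆ Set.Icc τ (τ + max T T') :=
        Set.Icc_subset_Icc_right (by linarith [le_max_right T T'])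
      obtain ⟨s, a1, a2, a3⟩ := h' τ ((le_max_right _ _).trans hτ) x y (hs.mono hss)
        (fun t ht => hq t (hss ht)) hm
      refine ⟨s, a1, a2.trans (le_max_right _ _), ?_⟩
      have := mul_le_mul_of_nonneg_right (min_le_right c c') hw0.le
      linarith
  · intro p hp
    obtain ⟨e1, e2, e3⟩ := hAE p hp
    obtain ⟨δ, T, c, t₁, hδ, hT, hc, ht₁, h⟩ :=
      hS.exists_local_drift hn hnq hF_lt hF_n hFhat hR hsub hσ e1 e2 e3
    exact ⟨Metric.closedBall p δ, mem_nhdsWithin_of_mem_nhds (Metric.closedBall_mem_nhds p hδ),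
      T, c, t₁, hT, hc, ht₁, fun τ hτ x y hs hq hm => ⟨T, hT, le_rfl, h τ hτ x y hs hq hm⟩⟩

end

/-! ### Attraction to the limit cycle -/

section

variable {q n : ℕ} {E₀ : ℝ} {H₀ : ℝ → ℝ → ℝ} {H F : ℝ → ℝ → ℝ → ℝ} {Hc Fc : ℕ → ℝ → ℝ → ℝ}

/-- Lets energy and truncated Hamiltonian be interchanged at late times, and bounds what can happen
within one incomplete return time. -/
theorem Setting.exists_slow_bounds (hS : Setting q E₀ H₀ H F Hc Fc) (hn : 1 ≤ n) (hnq : n ≤ q)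
    (hF_lt : ∀ i, 1 ≤ i → i < n → ∀ x y, Fc i x y = 0) {R : ℝ} (hR : 0 < R) {ζ : ℝ} (hζ : 0 < ζ) :
    ∃ t₁, 1 ≤ t₁ ∧ ∀ t, t₁ ≤ t → ∀ x y, (x, y) ∈ square R →
      |slowRate q n H₀ H F Hc t x y| ≤ ζ ∧ |slowVar q n H₀ Hc t x y - H₀ x y| ≤ ζ := by
  have hq : 1 ≤ q := hn.trans hnq
  obtain ⟨B, hB0, hB⟩ := (hS.smooth_H₀.pdy.mul (hS.smooth_Fc n hn)).exists_bound R
  set ε := min 1 (ζ / (2 * R ^ 2)) with hε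
  have hε0 : 0 < ε := by positivity
  have hε1 : ε ≤ 1 := min_le_left _ _
  have hε2 : ε * (2 * R ^ 2) ≤ ζ := by
    rw [← le_div_iff₀ (by positivity)]; exact min_le_right _ _
  obtain ⟨t₁, ht₁, hest⟩ := hS.exists_estimates hn hnq hF_lt R hε0
  obtain ⟨t₂, ht₂, hsm⟩ := exists_eventually_small hq (C := B + 2 * R ^ 2) hζ
  refine ⟨max t₁ t₂, ht₁.trans (le_max_left _ _), fun t ht x y hxy => ?_⟩
  have h1 : t₁ ≤ t := (le_max_left _ _).trans ht
  have h2 : t₂ ≤ t := (le_max_right _ _).trans ht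
  have ht0 : 0 < t := by linarith
  obtain ⟨m1, m2⟩ := mem_square.1 hxy
  obtain ⟨-, -, b3, b4⟩ := hest t h1 x y m1 m2
  have hQ := (add_abs_le_of_mem_square hxy).2
  simp only at hQ
  have he0 : 0 < t ^ (-1 / (q : ℝ)) := Real.rpow_pos_of_pos ht0 _
  have he1 : t ^ (-1 / (q : ℝ)) ≤ 1 := Real.rpow_le_one_of_one_le_of_nonpos (by linarith)
    (by rw [neg_div]; exact neg_nonpos.2 (by positivity))
  have hwe : t ^ (-(n : ℝ) / (q : ℝ)) ≤ t ^ (-1 / (q : ℝ)) := by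
    rw [rpow_neg_div_eq_pow ht0]
    exact pow_le_of_le_one he0.le he1 (by omega)
  have hw0 : 0 < t ^ (-(n : ℝ) / (q : ℝ)) := Real.rpow_pos_of_pos ht0 _
  set w := t ^ (-(n : ℝ) / (q : ℝ))
  constructor
  · have c1 : |w * (pdy H₀ x y * Fc n x y)| ≤ w * B := by
      rw [abs_mul, abs_of_pos hw0]
      exact mul_le_mul_of_nonneg_left (hB x y m1 m2) hw0.le
    have c2 : ε * w * (x ^ 2 + y ^ 2) ≤ 1 * w * (2 * R ^ 2) := by gcongr
    have c3 : w * (B + 2 * R ^ 2) ≤ t ^ (-1 / (q : ℝ)) * (B + 2 * R ^ 2) := by gcongr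
    have c4 := abs_sub_abs_le_abs_sub (slowRate q n H₀ H F Hc t x y)
      (w * (pdy H₀ x y * Fc n x y))
    have := hsm t h2
    linarith
  · exact b3.trans ((mul_le_mul_of_nonneg_left hQ hε0.le).trans hε2)

/-- One-sided attraction to the level `V = lam / mu` : solutions near that level do not move away
from it on a given side, and do not stay away from it on that side. -/
theorem Setting.exists_one_sided (hS : Setting q E₀ H₀ H F Hc Fc) (hn : 1 ≤ n) (hnq : n ≤ q)
    {lam mu : ℝ} {Fhat : ℝ → ℝ → ℝ}
    (hF_lt : ∀ i, 1 ≤ i → i < n → ∀ x y, Fc i x y = 0)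
    (hF_n : ∀ x y, Fc n x y = pdy H₀ x y * (lam - mu * H₀ x y) + Fhat x y)
    (hFhat : ∀ E, 0 < E → E < E₀ → ZeroAverage H₀ (fun x y => Fhat x y * pdy H₀ x y) E)
    (hmu : 0 < mu) {σ : ℝ} (hσ : |σ| = 1) {d η : ℝ} (hη : 0 < η)
    (hd1 : d < lam / mu) (hd2 : lam / mu + d < E₀) :
    ∃ t₁ c C : ℝ, 1 ≤ t₁ ∧ 0 < c ∧ ∀ a b : ℝ, ∀ x y : ℝ → ℝ, t₁ ≤ a → a ≤ b →
      IsSolOn H F (Set.Icc a b) x y →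
      (∀ t ∈ Set.Icc a b, |H₀ (x t) (y t) - lam / mu| ≤ d) →
      (σ * (H₀ (x a) (y a) - lam / mu) ≤ η → σ * (H₀ (x b) (y b) - lam / mu) ≤ 4 * η) ∧
      ((∀ t ∈ Set.Icc a b, η ≤ σ * (H₀ (x t) (y t) - lam / mu)) →
        c * (Real.log b - Real.log a) ≤ C) := by
  set V := lam / mu with hV
  have hlam : lam = mu * V := by rw [hV]; field_simp
  obtain ⟨R, hR, hsub⟩ := exists_sublevel_bound hS.smooth_H₀ hS.H₀_near_zero hS.closed_levels
    hS.E₀_pos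
  have hsq : ∀ x y, |H₀ x y - V| ≤ d → (x, y) ∈ square R := fun x y h => by
    obtain ⟨h1, h2⟩ := hsub x y (by linarith [(abs_le.1 h).2])
    exact mem_square.2 ⟨h1.le, h2.le⟩
  have habs : ∀ z : ℝ, |σ * z| = |z| := fun z => by rw [abs_mul, hσ, one_mul]
  have hcu : Continuous (fun p : ℝ × ℝ => σ * (H₀ p.1 p.2 - V)) :=
    continuous_const.mul (hS.smooth_H₀.continuous.sub continuous_const)
  set A : Set (ℝ × ℝ) := square R ∩ {p | σ * (H₀ p.1 p.2 - V) ∈ Set.Icc η d} with hA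
  have hAc : IsCompact A := (isCompact_square R).inter_right (isClosed_Icc.preimage hcu)
  obtain ⟨T, c, t₁, hT, hc, ht₁, hdrift⟩ := hS.exists_drift hn hnq hF_lt hF_n hFhat hR hsub hσ hAc
    (by
      rintro p ⟨-, hp1, hp2⟩
      have h1 : |H₀ p.1 p.2 - V| ≤ d := by
        rw [← habs, abs_of_nonneg (by linarith)]; exact hp2
      have h2 := abs_le.1 h1
      refine ⟨by linarith, by linarith, ?_⟩
      have : σ * (lam - mu * H₀ p.1 p.2) = -(mu * (σ * (H₀ p.1 p.2 - V))) := by rw [hlam]; ring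
      rw [this]
      have := mul_pos hmu (hη.trans_le hp1)
      linarith)
  -- κ stays within η/2 of u, and moves by at most η during a time T.
  obtain ⟨t₂, ht₂, hsl⟩ := hS.exists_slow_bounds hn hnq hF_lt hR (ζ := min (η / 2) (η / T))
    (by positivity)
  refine ⟨max t₁ t₂, c / T, 2 * d + η + c, ht₁.trans (le_max_left _ _), by positivity, ?_⟩
  intro a b x y ha hab hsol hd
  have ha1 : t₁ ≤ a := (le_max_left _ _).trans ha
  have ha2 : t₂ ≤ a := (le_max_right _ _).trans ha
  have ha0 : 1 ≤ a := ht₁.trans ha1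
  have hsqt : ∀ t ∈ Set.Icc a b, (x t, y t) ∈ square R := fun t ht => hsq _ _ (hd t ht)
  set u : ℝ → ℝ := fun t => σ * (H₀ (x t) (y t) - V) with hu
  set κ : ℝ → ℝ := fun t => σ * (slowVar q n H₀ Hc t (x t) (y t) - V) with hκ
  have hud : ∀ t ∈ Set.Icc a b, |u t| ≤ d := fun t ht => by
    rw [hu]; simp only [habs]; exact hd t ht
  have hκu : ∀ t ∈ Set.Icc a b, |κ t - u t| ≤ η / 2 := fun t ht => by
    have h := (hsl t (ha2.trans ht.1) _ _ (hsqt t ht)).2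
    have e : κ t - u t = σ * (slowVar q n H₀ Hc t (x t) (y t) - H₀ (x t) (y t)) := by
      simp only [hκ, hu]; ring
    rw [e, habs]
    exact h.trans (min_le_left _ _)
  have hκd : ∀ t ∈ Set.Icc a b, HasDerivWithinAt κ
      (σ * slowRate q n H₀ H F Hc t (x t) (y t)) (Set.Icc a b) t := fun t ht =>
    ((hS.hasDerivWithinAt_slowVar n hsol ht (by linarith [ht.1])).sub_const V).const_mul σ
  have hκc : ContinuousOn κ (Set.Icc a b) := fun t ht => (hκd t ht).continuousWithinAt
  have hκT : ∀ s ∈ Set.Icc a b, b ≤ s + T → κ b ≤ κ s + η := by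
    intro s hs hsT
    have := (convex_Icc a b).norm_image_sub_le_of_norm_hasDerivWithin_le (C := η / T) hκd
      (fun t ht => by
        rw [Real.norm_eq_abs, habs]
        exact (hsl t (ha2.trans ht.1) _ _ (hsqt t ht)).1.trans (min_le_right _ _)) hs
      (Set.right_mem_Icc.2 hab)
    rw [Real.norm_eq_abs, Real.norm_eq_abs, abs_of_nonneg (sub_nonneg.2 hs.2)] at this
    have h2 : η / T * (b - s) ≤ η / T * T :=
      mul_le_mul_of_nonneg_left (by linarith) (by positivity)
    rw [div_mul_cancel₀ _ hT.ne'] at h2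
    linarith [le_abs_self (κ b - κ s)]
  have hstep : ∀ s ∈ Set.Icc a b, s + T ≤ b → η ≤ u s → ∃ r, 0 < r ∧ r ≤ T ∧
      κ (s + r) ≤ κ s - c * s ^ (-(n : ℝ) / (q : ℝ)) := by
    intro s hs hsT hus
    have hss : Set.Icc s (s + T) ⊆ Set.Icc a b := Set.Icc_subset_Icc hs.1 hsT
    obtain ⟨r, h1, h2, h3⟩ := hdrift s (ha1.trans hs.1) x y (hsol.mono hss)
      (fun t ht => hsqt t (hss ht)) ⟨hsqt s hs, hus, (le_abs_self _).trans (hud s hs)⟩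
    refine ⟨r, h1, h2, ?_⟩
    simp only [hκ]
    linarith
  constructor
  · intro hua
    have hua' : u a ≤ η := hua
    -- u ≤ η gives κ ≤ 3η/2, while κ = 3η/2 forces u ≥ η, where the drift acts. In the last stretch
    -- κ gains at most η.
    obtain ⟨s, hs, hsT, hsM⟩ := exists_late_le (M := 3 * η / 2) hab hT.le hκc
      (by linarith [(abs_le.1 (hκu a (Set.left_mem_Icc.2 hab))).2]) (by
        intro s hs hsT hsM
        have := abs_le.1 (hκu s hs)
        obtain ⟨r, h1, h2, h3⟩ := hstep s hs hsT (by linarith)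
        have hw : 0 < s ^ (-(n : ℝ) / (q : ℝ)) := Real.rpow_pos_of_pos (by linarith [hs.1]) _
        have := mul_pos hc hw
        exact ⟨s + r, by linarith, by linarith, by linarith⟩)
    have h1 := hκT s hs hsT
    have h2 := abs_le.1 (hκu b (Set.right_mem_Icc.2 hab))
    change u b ≤ 4 * η
    linarith
  · intro hall
    -- A drop of c s^(-n/q) ≥ c/s pays for the increase of (c/T) log over a return time r ≤ T, so
    -- this function returns below its initial value. As κ is bounded, log b - log a is too.
    have hlogc : ContinuousOn (fun t => κ t + c / T * Real.log t) (Set.Icc a b) :=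
      hκc.add (continuousOn_const.mul (Real.continuousOn_log.mono fun t ht => by
        have : 0 < t := by linarith [ht.1]
        exact this.ne'))
    have hlog : ∀ s r, 1 ≤ s → 0 ≤ r → Real.log (s + r) ≤ Real.log s + r / s := by
      intro s r hs hr
      have hs0 : 0 < s := by linarith
      have h1 : s + r = s * (1 + r / s) := by field_simp
      rw [h1, Real.log_mul hs0.ne' (by positivity)]
      have := Real.log_le_sub_one_of_pos (show 0 < 1 + r / s by positivity)
      linarith
    obtain ⟨s, hs, hsT, hsM⟩ := exists_late_le (M := κ a + c / T * Real.log a) hab hT.le hlogc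
      le_rfl (by
        intro s hs hsT hsM
        obtain ⟨r, h1, h2, h3⟩ := hstep s hs hsT (hall s hs)
        refine ⟨s + r, by linarith, by linarith, ?_⟩
        have hs1 : 1 ≤ s := ha0.trans hs.1
        have hw := inv_le_rpow_neg_div hnq (hn.trans hnq) hs1
        have e1 : c / T * Real.log (s + r) ≤ c / T * (Real.log s + r / s) :=
          mul_le_mul_of_nonneg_left (hlog s r hs1 h1.le) (by positivity)
        have e2 : c / T * (r / s) ≤ c * s⁻¹ := by
          have : c / T * (r / s) = c * s⁻¹ * (r / T) := by ring
          rw [this]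
          exact mul_le_of_le_one_right (by positivity) ((div_le_one hT).2 h2)
        have e3 := mul_le_mul_of_nonneg_left hw hc.le
        rw [← hsM]
        linarith)
    have hs1 : 1 ≤ s := ha0.trans hs.1
    have hb1 : Real.log b ≤ Real.log s + T / s := by
      refine le_trans ?_ (hlog s T hs1 hT.le)
      exact Real.log_le_log (by linarith) hsT
    have e1 : c / T * Real.log b ≤ c / T * (Real.log s + T / s) :=
      mul_le_mul_of_nonneg_left hb1 (by positivity)
    have e2 : c / T * (T / s) ≤ c := by
      have : c / T * (T / s) = c / s := by field_simp
      rw [this]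
      exact div_le_self hc.le hs1
    have h1 := abs_le.1 (hκu a (Set.left_mem_Icc.2 hab))
    have h2 := abs_le.1 (hκu s hs)
    have h3 := abs_le.1 (hud a (Set.left_mem_Icc.2 hab))
    have h4 := abs_le.1 (hud s hs)
    linarith

/-- The one-sided result is used for σ = 1 and σ = -1. With a fixed η it confines solutions to the
band; with η → 0 it gives convergence, since log b is unbounded and a solution must enter each
smaller band, after which it stays within four times its width. -/
theorem Setting.stableLimitCycle (hS : Setting q E₀ H₀ H F Hc Fc) (hn : 1 ≤ n) (hnq : n ≤ q)
    {lam mu : ℝ} {Fhat : ℝ → ℝ → ℝ}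
    (hF_lt : ∀ i, 1 ≤ i → i < n → ∀ x y, Fc i x y = 0)
    (hF_n : ∀ x y, Fc n x y = pdy H₀ x y * (lam - mu * H₀ x y) + Fhat x y)
    (hFhat : ∀ E, 0 < E → E < E₀ → ZeroAverage H₀ (fun x y => Fhat x y * pdy H₀ x y) E)
    (hlam : 0 < lam) (hmu : 0 < mu) (hV : lam / mu < E₀) :
    StableLimitCycle H₀ H F (lam / mu) := by
  have hV0 : 0 < lam / mu := by positivity
  obtain ⟨R, hR, hsub⟩ := exists_sublevel_bound hS.smooth_H₀ hS.H₀_near_zero hS.closed_levels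
    hS.E₀_pos
  set V := lam / mu with hVd
  intro ε hε
  -- The band of half-width d around V lies within the ε-band and in (0, E₀), where orbits and
  -- vanishing averages are available.
  set d := min (ε / 2) (min (V / 2) ((E₀ - V) / 2)) with hd
  have hd0 : 0 < d := by
    have : 0 < E₀ - V := by linarith
    positivity
  have hdε : d < ε := (min_le_left _ _).trans_lt (by linarith)
  have hdV : d < V := ((min_le_right _ _).trans (min_le_left _ _)).trans_lt (by linarith)
  have hdE : V + d < E₀ := by
    have : d ≤ (E₀ - V) / 2 := (min_le_right _ _).trans (min_le_right _ _)
    linarith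
  have hside : ∀ η, 0 < η → ∃ t₁ c C : ℝ, 1 ≤ t₁ ∧ 0 < c ∧
      ∀ σ : ℝ, σ = 1 ∨ σ = -1 → ∀ a b : ℝ, ∀ x y : ℝ → ℝ, t₁ ≤ a → a ≤ b →
      IsSolOn H F (Set.Icc a b) x y → (∀ t ∈ Set.Icc a b, |H₀ (x t) (y t) - V| ≤ d) →
      (σ * (H₀ (x a) (y a) - V) ≤ η → σ * (H₀ (x b) (y b) - V) ≤ 4 * η) ∧
      ((∀ t ∈ Set.Icc a b, η ≤ σ * (H₀ (x t) (y t) - V)) →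
        c * (Real.log b - Real.log a) ≤ C) := by
    intro η hη
    obtain ⟨t₁, c₁, C₁, h1, hc1, h⟩ := hS.exists_one_sided hn hnq hF_lt hF_n hFhat hmu
      (σ := 1) (by simp) hη hdV hdE
    obtain ⟨t₂, c₂, C₂, h2, hc2, h'⟩ := hS.exists_one_sided hn hnq hF_lt hF_n hFhat hmu
      (σ := -1) (by simp) hη hdV hdE
    refine ⟨max t₁ t₂, min c₁ c₂, max C₁ C₂, h1.trans (le_max_left _ _), lt_min hc1 hc2, ?_⟩
    intro σ hσ a b x y ha hab hsol hdd
    have ha0 : 0 < a := by linarith [(le_max_left t₁ t₂).trans ha]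
    have hlog : 0 ≤ Real.log b - Real.log a := sub_nonneg.2 (Real.log_le_log ha0 hab)
    rcases hσ with rfl | rfl
    · obtain ⟨k1, k2⟩ := h a b x y ((le_max_left _ _).trans ha) hab hsol hdd
      exact ⟨k1, fun hh => (mul_le_mul_of_nonneg_right (min_le_left _ _) hlog).trans
        ((k2 hh).trans (le_max_left _ _))⟩
    · obtain ⟨k1, k2⟩ := h' a b x y ((le_max_right _ _).trans ha) hab hsol hdd
      exact ⟨k1, fun hh => (mul_le_mul_of_nonneg_right (min_le_right _ _) hlog).trans
        ((k2 hh).trans (le_max_right _ _))⟩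
  -- Starting within d/8, both sides stay within 4 · d/8 = d/2 at a first exit time, contradicting
  -- that the distance there is d.
  obtain ⟨t₁, _, _, ht₁, _, h⟩ := hside (d / 8) (by positivity)
  refine ⟨d / 8, t₁, by positivity, by linarith, fun x₀ y₀ τ h₀ hτ => ?_⟩
  have hτ0 : 0 < τ := by linarith
  have hin : ∀ x y, |H₀ x y - V| ≤ d → |x| < R ∧ |y| < R := fun x y hxy =>
    hsub x y (by linarith [(abs_le.1 hxy).2])
  have hap : ∀ b, τ ≤ b → ∀ x y : ℝ → ℝ, IsSolOn H F (Set.Icc τ b) x y → x τ = x₀ → y τ = y₀ →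
      |H₀ (x b) (y b) - V| ≤ d := by
    intro b hb x y hsol hx hy
    by_contra hcon
    have hc : ContinuousOn (fun t => |H₀ (x t) (y t) - V|) (Set.Icc τ b) :=
      ((hS.smooth_H₀.continuous.comp_continuousOn
        (hsol.continuousOn.1.prodMk hsol.continuousOn.2)).sub continuousOn_const).abs
    obtain ⟨s, hs, hsd, hle⟩ := exists_first_exit (R := d) hb hc
      (by simp only [hx, hy]; linarith) (not_le.1 hcon).le
    have hsol' := hsol.mono (Set.Icc_subset_Icc_right hs.2 : Set.Icc τ s ⊆ Set.Icc τ b)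
    have h₀' := abs_le.1 h₀
    have k1 := (h 1 (Or.inl rfl) τ s x y hτ hs.1 hsol' hle).1 (by rw [hx, hy]; linarith [h₀'.2])
    have k2 := (h (-1) (Or.inr rfl) τ s x y hτ hs.1 hsol' hle).1
      (by rw [hx, hy]; linarith [h₀'.1])
    have : |H₀ (x s) (y s) - V| ≤ d / 2 := abs_le.2 ⟨by linarith, by linarith⟩
    linarith
  obtain ⟨hx₀, hy₀⟩ := hin x₀ y₀ (by linarith)
  refine ⟨exists_global_solution hS.smooth_H hS.smooth_F hτ0 hx₀ hy₀
    (fun b hb x y hsol hx hy _ => hin _ _ (hap b hb x y hsol hx hy)), ?_⟩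
  intro x y hsol hx hy
  have hdd : ∀ t, τ ≤ t → |H₀ (x t) (y t) - V| ≤ d := fun t ht =>
    hap t ht x y (hsol.mono Set.Icc_subset_Ici_self) hx hy
  refine ⟨fun t ht => (hdd t ht).trans_lt hdε, ?_⟩
  have hev : ∀ ζ, 0 < ζ → ∀ σ : ℝ, σ = 1 ∨ σ = -1 →
      ∃ t₂, ∀ t, t₂ ≤ t → σ * (H₀ (x t) (y t) - V) ≤ ζ := by
    intro ζ hζ σ hσ
    set η := ζ / 4 with hη
    obtain ⟨t₃, c, C, ht₃, hc, h3⟩ := hside η (by positivity)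
    set a := max τ t₃ with ha
    have haτ : τ ≤ a := le_max_left _ _
    have hat : t₃ ≤ a := le_max_right _ _
    obtain ⟨b, hab, hb⟩ : ∃ b, a ≤ b ∧ σ * (H₀ (x b) (y b) - V) ≤ η := by
      by_contra hcon
      push Not at hcon
      have hlim : Filter.Tendsto (fun b => c * (Real.log b - Real.log a)) Filter.atTop
          Filter.atTop :=
        (Filter.tendsto_atTop_add_const_right _ _ Real.tendsto_log_atTop).const_mul_atTop hc
      obtain ⟨b, hb1, hb2⟩ := ((hlim.eventually_gt_atTop C).and
        (Filter.eventually_ge_atTop a)).exists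
      have := (h3 σ hσ a b x y hat hb2 (hsol.mono fun t ht => haτ.trans ht.1)
        (fun t ht => hdd t (haτ.trans ht.1))).2 (fun t ht => (hcon t ht.1).le)
      linarith
    refine ⟨b, fun t ht => ?_⟩
    have := (h3 σ hσ b t x y (hat.trans hab) ht
      (hsol.mono fun s hs => (haτ.trans hab).trans hs.1)
      (fun s hs => hdd s ((haτ.trans hab).trans hs.1))).1 hb
    linarith
  rw [Metric.tendsto_atTop]
  intro ζ hζ
  obtain ⟨t₂, h2⟩ := hev (ζ / 2) (by positivity) 1 (Or.inl rfl)
  obtain ⟨t₃, h3⟩ := hev (ζ / 2) (by positivity) (-1) (Or.inr rfl)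
  refine ⟨max t₂ t₃, fun t ht => ?_⟩
  have k1 := h2 t ((le_max_left _ _).trans ht)
  have k2 := h3 t ((le_max_right _ _).trans ht)
  rw [Real.dist_eq]
  have : |H₀ (x t) (y t) - V| ≤ ζ / 2 := abs_le.2 ⟨by linarith, by linarith⟩
  linarith

end

end
end AsymptHam

theorem theorem3 (q n : ℕ) (E₀ : ℝ) (H₀ : ℝ → ℝ → ℝ) (H F : ℝ → ℝ → ℝ → ℝ)
    (Hc Fc : ℕ → ℝ → ℝ → ℝ) (hS : AsymptHam.Setting q E₀ H₀ H F Hc Fc)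
    (hn : 1 ≤ n) (hnq : n ≤ q) (lam mu : ℝ) (Fhat : ℝ → ℝ → ℝ)
    (hF_lt : ∀ i, 1 ≤ i → i < n → ∀ x y, Fc i x y = 0)
    (hF_n : ∀ x y, Fc n x y = AsymptHam.pdy H₀ x y * (lam - mu * H₀ x y) + Fhat x y)
    (hFhat : ∀ E, 0 < E → E < E₀ →
      AsymptHam.ZeroAverage H₀ (fun x y => Fhat x y * AsymptHam.pdy H₀ x y) E) :
    (0 < lam → AsymptHam.Unstable H F) ∧
    (lam < 0 → AsymptHam.AsymptoticallyStable H F) ∧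
    (0 < lam → 0 < mu → lam / mu < E₀ →
      AsymptHam.StableLimitCycle H₀ H F (lam / mu)) := by
  have hγ := hS.pdy_Fc_eq hn (hn.trans hnq) hF_n hFhat
  exact ⟨fun h => hS.unstable hn hnq hF_lt h hγ,
    fun h => hS.asymptoticallyStable hn hnq hF_lt h hγ,
    fun h1 h2 h3 => hS.stableLimitCycle hn hnq hF_lt hF_n hFhat h1 h2 h3⟩
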